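/- Let $f\colon M^m\to\mathbb{H}^n$ be a smooth isometric immersion of a Riemannian manifold into hyperbolic space (of curvature $-1$), with second fundamental form $\alpha$. Assume that the relative nullity subspaces $\mathcal{D}(x)=\{X\in T_xM\colon \alpha(X,Y)=0 \text{ for all } Y\in T_xM\}$ have constant dimension $\nu$, where $1\le\nu\le m-2$, and that the conullity distribution $\mathcal{D}^\perp$ is umbilical, that is, there is a smooth section $\delta$ of $\mathcal{D}$ with $\langle\nabla_XY,T\rangle=\langle X,Y\rangle\langle\delta,T\rangle$ for all smooth sections $X,Y$ of $\mathcal{D}^\perp$ and $T$ of $\mathcal{D}$. For an isometric immersion $g\colon\Sigma^{m-\nu}\to\mathbb{Q}_c^{n-\nu}$ of a connected Riemannian manifold into a complete simply connected umbilical submanifold $i\colon\mathbb{Q}_c^{n-\nu}\to\mathbb{H}^n$ of constant curvature $c\neq-1$, let $N$ be the pullback to $\Sigma$ of the normal bundle of $i$, and let $G\colon N\to\mathbb{H}^n$, $G(x,w)=\exp_{i(g(x))}w$. The generalized cone over $g$ is the isometric immersion $F_g=G|_{M_g}\colon M_g\to\mathbb{H}^n$, where $M_g\subset N$ is the open set of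 all points at which $G$ is an immersion, endowed with the metric induced by $G$. Then: 1. $f$ is locally a generalized cone: every point of $M$ has an open neighbourhood $U$ for which there are a $g$ as above and a diffeomorphism (hence isometry) $\Phi$ of $U$ onto an open subset of $M_g$ with $f|_U=F_g\circ\Phi$. 2. If $M$ is connected and the leaves of the relative nullity distribution $\mathcal{D}$ are complete, then $f$ is globally a generalized cone: there are a $g$ as above and a diffeomorphism (hence isometry) $\Phi$ of $M$ onto $M_g$ with $f=F_g\circ\Phi$. -/

import Mathlib

open scoped Manifold ContDiff

universe u

noncomputable section

namespace HypCone

/-! ### Hyperbolic space: the hyperboloid in Lorentz space -/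

/-- The vector space `ℝ^{n+1}` underlying Lorentz space. -/
abbrev Lor (n : ℕ) := EuclideanSpace ℝ (Fin (n + 1))

/-- The Lorentz inner product `-x₀y₀ + x₁y₁ + ⋯ + xₙyₙ`. -/
def lor {n : ℕ} (x y : Lor n) : ℝ := -(x 0 * y 0) + ∑ i : Fin n, x i.succ * y i.succ

theorem lor_add_left {n : ℕ} (x x' y : Lor n) : lor (x + x') y = lor x y + lor x' y := by
  simp only [lor, PiLp.add_apply, add_mul, Finset.sum_add_distrib]; ring

theorem lor_smul_left {n : ℕ} (a : ℝ) (x y : Lor n) : lor (a • x) y = a * lor x y := by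
  simp only [lor, PiLp.smul_apply, smul_eq_mul, mul_add, Finset.mul_sum]
  congr 1
  · ring
  · exact Finset.sum_congr rfl fun i _ => by ring

theorem lor_zero_left {n : ℕ} (y : Lor n) : lor 0 y = 0 := by
  simp [lor]

/-- Hyperbolic space `ℍⁿ` (curvature `-1`): the upper sheet of `⟨x, x⟩ = -1`. Its tangent space at
`p` is `{w | ⟨w, p⟩ = 0}`, and its Riemannian metric is the restriction of the Lorentz product. -/
def Hyp (n : ℕ) : Set (Lor n) := {x | lor x x = -1 ∧ 0 < x 0}

/-- The exponential map of `ℍⁿ` at `p`: for `w` tangent at `p`,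
`exp_p w = cosh ‖w‖ p + sinh ‖w‖ (w / ‖w‖)` (and `exp_p 0 = p`). -/
def hexp {n : ℕ} (p w : Lor n) : Lor n :=
  Real.cosh (√(lor w w)) • p + (Real.sinh (√(lor w w)) / √(lor w w)) • w

/-! ### Immersions into hyperbolic space -/

section Immersions

variable {n d : ℕ} {N : Type*} [TopologicalSpace N] [ChartedSpace (EuclideanSpace ℝ (Fin d)) N]

/-- The differential `h_* X` of a map into Lorentz space. -/
def push (h : N → Lor n) (x : N) (X : TangentSpace (𝓡 d) x) : Lor n :=
  mfderiv (𝓡 d) 𝓘(ℝ, Lor n) h x X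

theorem push_add (h : N → Lor n) (x : N) (X Y : TangentSpace (𝓡 d) x) :
    push h x (X + Y) = push h x X + push h x Y :=
  (mfderiv (𝓡 d) 𝓘(ℝ, Lor n) h x).map_add X Y

theorem push_smul (h : N → Lor n) (x : N) (a : ℝ) (X : TangentSpace (𝓡 d) x) :
    push h x (a • X) = a • push h x X :=
  (mfderiv (𝓡 d) 𝓘(ℝ, Lor n) h x).map_smul a X

theorem push_zero (h : N → Lor n) (x : N) : push h x (0 : TangentSpace (𝓡 d) x) = 0 :=
  (mfderiv (𝓡 d) 𝓘(ℝ, Lor n) h x).map_zero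

/-- `h : N → ℍⁿ` is a smooth immersion of the `d`-dimensional manifold `N`. -/
structure IsHypImmersion (d : ℕ) {N : Type*} [TopologicalSpace N]
    [ChartedSpace (EuclideanSpace ℝ (Fin d)) N] (h : N → Lor n) : Prop where
  smooth : ContMDiff (𝓡 d) 𝓘(ℝ, Lor n) ∞ h
  mem : ∀ x, h x ∈ Hyp n
  injective_push : ∀ x, Function.Injective (push (d := d) h x)

/-- The induced metric `⟨h_* X, h_* Y⟩`. -/
def indInner (h : N → Lor n) (x : N) (X Y : TangentSpace (𝓡 d) x) : ℝ :=
  lor (push h x X) (push h x Y)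

/-- The vector field `X` on `N` is smooth. -/
def IsSmoothField (X : ∀ x : N, TangentSpace (𝓡 d) x) [IsManifold (𝓡 d) ∞ N] : Prop :=
  ContMDiff (𝓡 d) (𝓡 d).tangent ∞ (fun x => (⟨x, X x⟩ : TangentBundle (𝓡 d) N))

/-- The normal space of the immersion `h` at `x`: the tangent vectors of `ℍⁿ` at `h x` that are
orthogonal to `h_* T_x N`. -/
def normalSpace (h : N → Lor n) (x : N) : Submodule ℝ (Lor n) where
  carrier := {ξ | lor ξ (h x) = 0 ∧ ∀ X : TangentSpace (𝓡 d) x, lor ξ (push h x X) = 0}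
  add_mem' := fun {a b} ha hb =>
    ⟨by rw [lor_add_left, ha.1, hb.1, add_zero],
      fun X => by rw [lor_add_left, ha.2, hb.2, add_zero]⟩
  zero_mem' := ⟨lor_zero_left _, fun X => lor_zero_left _⟩
  smul_mem' := fun c a ha =>
    ⟨by rw [lor_smul_left, ha.1, mul_zero], fun X => by rw [lor_smul_left, ha.2, mul_zero]⟩

/-- The connection `∇̃_X V` that the Levi-Civita connection of `ℍⁿ` induces along `h`, for a vector
field `V` along `h` tangent to `ℍⁿ`: the derivative of `V` in direction `X`, projected
orthogonally to the tangent space `h(x)^⊥` of `ℍⁿ`. -/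
def covAlong (h : N → Lor n) (V : N → Lor n) (x : N) (X : TangentSpace (𝓡 d) x) : Lor n :=
  push V x X + lor (push V x X) (h x) • h x

/-- `⟨α(X, Y), ξ⟩` for a normal vector `ξ` at `x`, where `α(X, Y)` is the second fundamental form,
that is the normal component of `∇̃_X h_* Y`. -/
def sff (h : N → Lor n) (x : N) (X : TangentSpace (𝓡 d) x) (Y : ∀ y : N, TangentSpace (𝓡 d) y)
    (ξ : Lor n) : ℝ :=
  lor (covAlong h (fun y => push h y (Y y)) x X) ξ

/-- The relative nullity subspace `𝒟(x) = {X | α(X, Y) = 0 for all Y}`. -/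
def relNullity [IsManifold (𝓡 d) ∞ N] (h : N → Lor n) (x : N) :
    Submodule ℝ (TangentSpace (𝓡 d) x) where
  carrier := {X | ∀ Y : ∀ y : N, TangentSpace (𝓡 d) y, IsSmoothField Y →
    ∀ ξ ∈ normalSpace (d := d) h x, sff h x X Y ξ = 0}
  add_mem' := fun {a b} ha hb Y hY ξ hξ => by
    have h1 := ha Y hY ξ hξ
    have h2 := hb Y hY ξ hξ
    simp only [sff, covAlong, push_add, lor_add_left, lor_smul_left] at h1 h2 ⊢
    linear_combination h1 + h2
  zero_mem' := fun Y _ ξ _ => by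
    simp [sff, covAlong, push_zero, lor_zero_left]
  smul_mem' := fun c a ha Y hY ξ hξ => by
    have h1 := ha Y hY ξ hξ
    simp only [sff, covAlong, push_smul, lor_add_left, lor_smul_left] at h1 ⊢
    linear_combination c * h1

/-- The leaves of the (integrable) distribution `D` on `N`, with the metric induced by the
immersion `h : N → ℍⁿ`, are complete. A geodesic of a leaf is a curve `γ` tangent to `D` such that
the acceleration of `h ∘ γ` in `ℍⁿ` is orthogonal to the leaf; completeness says that each leaf
geodesic is defined for all times. For `D = ⊤` this is completeness of `N` itself. -/
def LeavesComplete (h : N → Lor n) (D : ∀ x : N, Submodule ℝ (TangentSpace (𝓡 d) x)) : Prop :=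
  ∀ (x : N), ∀ T ∈ D x, ∃ γ : ℝ → N, ContMDiff 𝓘(ℝ, ℝ) (𝓡 d) ∞ γ ∧ γ 0 = x ∧
    deriv (h ∘ γ) 0 = push h x T ∧
    (∀ t : ℝ, mfderiv 𝓘(ℝ, ℝ) (𝓡 d) γ t (1 : ℝ) ∈ D (γ t)) ∧
    ∀ t : ℝ, ∀ S ∈ D (γ t),
      lor (deriv (deriv (h ∘ γ)) t + lor (deriv (deriv (h ∘ γ)) t) (h (γ t)) • h (γ t))
        (push h (γ t) S) = 0

end Immersions

/-! ### Riemannian manifolds, isometric immersions, umbilical conullity -/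

section Riemannian

variable {n d : ℕ} {M : Type*} [TopologicalSpace M] [ChartedSpace (EuclideanSpace ℝ (Fin d)) M]
  [IsManifold (𝓡 d) ∞ M]

/-- Smooth Riemannian metrics on the manifold `M` of dimension `d`. -/
abbrev RiemMetric (d : ℕ) (M : Type*) [TopologicalSpace M]
    [ChartedSpace (EuclideanSpace ℝ (Fin d)) M] [IsManifold (𝓡 d) ∞ M] :=
  Bundle.ContMDiffRiemannianMetric (𝓡 d) ∞ (EuclideanSpace ℝ (Fin d))
    (fun x : M => TangentSpace (𝓡 d) x)

/-- `f : (M, g) → ℍⁿ` is an isometric immersion. -/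
structure IsIsometricImmersion (g : RiemMetric d M) (f : M → Lor n) : Prop
    extends IsHypImmersion d f where
  isometric : ∀ (x : M) (X Y : TangentSpace (𝓡 d) x), g.inner x X Y = indInner f x X Y

/-- `⟨∇_X Y, Z⟩` at `x`, for the Levi-Civita connection `∇` of `g` (Koszul formula). -/
def leviCivita (g : RiemMetric d M) (X Y Z : ∀ x : M, TangentSpace (𝓡 d) x) (x : M) : ℝ :=
  let D (A B C : ∀ x : M, TangentSpace (𝓡 d) x) : ℝ :=
    mfderiv (𝓡 d) 𝓘(ℝ, ℝ) (fun y => g.inner y (B y) (C y)) x (A x)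
  (D X Y Z + D Y X Z - D Z X Y
    + g.inner x (VectorField.mlieBracket (𝓡 d) X Y x) (Z x)
    - g.inner x (VectorField.mlieBracket (𝓡 d) X Z x) (Y x)
    - g.inner x (VectorField.mlieBracket (𝓡 d) Y Z x) (X x)) / 2

/-- The vector field `X` is a smooth section of the distribution `D`. -/
def IsSection (D : ∀ x : M, Submodule ℝ (TangentSpace (𝓡 d) x))
    (X : ∀ x : M, TangentSpace (𝓡 d) x) : Prop :=
  IsSmoothField X ∧ ∀ x, X x ∈ D x

/-- The vector field `X` is a smooth section of the orthogonal complement `D^⊥`. -/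
def IsOrthSection (g : RiemMetric d M) (D : ∀ x : M, Submodule ℝ (TangentSpace (𝓡 d) x))
    (X : ∀ x : M, TangentSpace (𝓡 d) x) : Prop :=
  IsSmoothField X ∧ ∀ x, ∀ T ∈ D x, g.inner x (X x) T = 0

/-- The distribution `D^⊥` is umbilical: there is a smooth section `δ` of `D` with
`⟨∇_X Y, T⟩ = ⟨X, Y⟩ ⟨δ, T⟩` for all sections `X, Y` of `D^⊥` and `T` of `D`. -/
def OrthUmbilical (g : RiemMetric d M) (D : ∀ x : M, Submodule ℝ (TangentSpace (𝓡 d) x)) :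
    Prop :=
  ∃ δ : ∀ x : M, TangentSpace (𝓡 d) x, IsSection D δ ∧
    ∀ X Y T : ∀ x : M, TangentSpace (𝓡 d) x,
      IsOrthSection g D X → IsOrthSection g D Y → IsSection D T →
        ∀ x, leviCivita g X Y T x = g.inner x (X x) (Y x) * g.inner x (δ x) (T x)

end Riemannian

/-! ### Generalized cones -/

section Cones

/-- `i : Q → ℍⁿ` is the inclusion of `Q = ℚ_c^d` as a complete simply connected umbilical
submanifold, where `Q` has the metric induced by `i`. The mean curvature vector `H` satisfies
`α(X, Y) = ⟨X, Y⟩ H`, so that by the Gauss equation the curvature of `Q` is `c = -1 + ‖H‖²`. -/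
structure IsUmbilicalInclusion {n : ℕ} (d : ℕ) (c : ℝ) {Q : Type*} [TopologicalSpace Q]
    [ChartedSpace (EuclideanSpace ℝ (Fin d)) Q] [IsManifold (𝓡 d) ∞ Q] (i : Q → Lor n) : Prop
    extends IsHypImmersion d i where
  isEmbedding : Topology.IsEmbedding i
  simplyConnected : SimplyConnectedSpace Q
  complete : LeavesComplete (d := d) i (fun _ => ⊤)
  umbilical : ∀ y : Q, ∃ H ∈ normalSpace (d := d) i y, lor H H = c + 1 ∧
    ∀ (X : TangentSpace (𝓡 d) y) (Y : ∀ z : Q, TangentSpace (𝓡 d) z), IsSmoothField Y →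
      ∀ ξ ∈ normalSpace (d := d) i y, sff i y X Y ξ = indInner i y X (Y y) * lor H ξ

/-- `η₁, …, η_ν` is a smooth orthonormal frame of the normal bundle `N_i Q` of `i : Q^d → ℍⁿ`,
where `d + ν = n`. -/
structure IsNormalFrame {n : ℕ} (d : ℕ) {ν : ℕ} {Q : Type*} [TopologicalSpace Q]
    [ChartedSpace (EuclideanSpace ℝ (Fin d)) Q] (i : Q → Lor n) (η : Fin ν → Q → Lor n) :
    Prop where
  rank : d + ν = n
  smooth : ∀ j, ContMDiff (𝓡 d) 𝓘(ℝ, Lor n) ∞ (η j)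
  normal : ∀ j y, η j y ∈ normalSpace (d := d) i y
  orthonormal : ∀ j l y, lor (η j y) (η l y) = if j = l then 1 else 0

/-- A generalized cone in `ℍⁿ`: an isometric immersion `g : S^k → ℚ_c^{n-ν}` of a connected
Riemannian manifold into a complete simply connected umbilical submanifold `i : ℚ_c^{n-ν} → ℍⁿ`
with `c ≠ -1`, together with an orthonormal frame of the normal bundle of `i`. (The manifold
`ℚ_c^{n-ν}` has the metric induced by `i`, so that `g` is isometric exactly if `i ∘ g` is.) -/
structure GeneralizedCone (n k ν : ℕ) : Type (u + 1) where
  c : ℝ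
  c_ne : c ≠ -1
  Q : Type
  [topQ : TopologicalSpace Q]
  [chartedQ : ChartedSpace (EuclideanSpace ℝ (Fin (n - ν))) Q]
  [manifoldQ : IsManifold (𝓡 (n - ν)) ∞ Q]
  i : Q → Lor n
  umbilicalInclusion : IsUmbilicalInclusion (n - ν) c i
  frame : Fin ν → Q → Lor n
  normalFrame : IsNormalFrame (n - ν) i frame
  S : Type u
  [topS : TopologicalSpace S]
  [chartedS : ChartedSpace (EuclideanSpace ℝ (Fin k)) S]
  [manifoldS : IsManifold (𝓡 k) ∞ S]
  [t2S : T2Space S]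
  [secondCountableS : SecondCountableTopology S]
  [connectedS : ConnectedSpace S]
  metric : RiemMetric k S
  g : S → Q
  smooth_g : ContMDiff (𝓡 k) (𝓡 (n - ν)) ∞ g
  isometric_g : IsIsometricImmersion metric (i ∘ g)

attribute [instance] GeneralizedCone.topS GeneralizedCone.chartedS

namespace GeneralizedCone

variable {n k ν : ℕ} (C : GeneralizedCone.{u} n k ν)

/-- The map `G(x, w) = exp_{g(x)} w` on the pullback to `S` of the normal bundle of `i`, which is
identified with `S × ℝ^ν` by the frame `η`: the point `(x, t)` stands for the normal vector
`w = t₁ η₁(g x) + ⋯ + t_ν η_ν(g x)`. -/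
def G (p : C.S × EuclideanSpace ℝ (Fin ν)) : Lor n :=
  hexp (C.i (C.g p.1)) (∑ j, p.2 j • C.frame j (C.g p.1))

/-- The manifold on which the generalized cone `F_g = G|` lives: the open set of all points
where `G` is an immersion, with the metric induced by `G`. -/
def domain : Set (C.S × EuclideanSpace ℝ (Fin ν)) :=
  {p | Function.Injective (mfderiv ((𝓡 k).prod (𝓡 ν)) 𝓘(ℝ, Lor n) C.G p)}

/-- On the open set `Φ.source` the map `f : M^m → ℍⁿ` coincides with the generalized cone
`F_g` restricted to `Φ.target`, up to the diffeomorphism `Φ`. If `f` is isometric, then so is `Φ`,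
since the domain of the cone has the metric induced by `F_g`. -/
def CoincidesVia {m : ℕ} {M : Type*} [TopologicalSpace M]
    [ChartedSpace (EuclideanSpace ℝ (Fin m)) M] (f : M → Lor n)
    (Φ : PartialDiffeomorph (𝓡 m) ((𝓡 k).prod (𝓡 ν)) M (C.S × EuclideanSpace ℝ (Fin ν)) ∞) :
    Prop :=
  Φ.target ⊆ C.domain ∧ ∀ x ∈ Φ.source, f x = C.G (Φ x)

end GeneralizedCone

/-- `f : M^m → ℍⁿ` is locally a generalized cone (with `ν`-dimensional fibres): every point of `M`
has an open neighbourhood on which `f` is, up to a diffeomorphism, an open part of a generalized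
cone. -/
def IsLocallyGeneralizedCone {m n : ℕ} (ν : ℕ) {M : Type u} [TopologicalSpace M]
    [ChartedSpace (EuclideanSpace ℝ (Fin m)) M] (f : M → Lor n) : Prop :=
  ∀ p : M, ∃ (C : GeneralizedCone.{u} n (m - ν) ν) (Φ : PartialDiffeomorph (𝓡 m)
    ((𝓡 (m - ν)).prod (𝓡 ν)) M (C.S × EuclideanSpace ℝ (Fin ν)) ∞),
    p ∈ Φ.source ∧ C.CoincidesVia f Φ

/-- `f : M^m → ℍⁿ` is globally a generalized cone: up to a diffeomorphism of `M` with the whole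
domain of a generalized cone `F_g`, it is equal to `F_g`. -/
def IsGeneralizedCone {m n : ℕ} (ν : ℕ) {M : Type u} [TopologicalSpace M]
    [ChartedSpace (EuclideanSpace ℝ (Fin m)) M] (f : M → Lor n) : Prop :=
  ∃ (C : GeneralizedCone.{u} n (m - ν) ν) (Φ : PartialDiffeomorph (𝓡 m)
    ((𝓡 (m - ν)).prod (𝓡 ν)) M (C.S × EuclideanSpace ℝ (Fin ν)) ∞),
    Φ.source = Set.univ ∧ Φ.target = C.domain ∧ C.CoincidesVia f Φ

end Cones

end HypCone

end

noncomputable section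

set_option linter.unusedSectionVars false

namespace HypCone

/-! ### Smooth families of linear maps -/

section LinearFamilies

open Filter Topology

variable {E F G V : Type*} [NormedAddCommGroup E] [NormedSpace ℝ E]
  [NormedAddCommGroup F] [NormedSpace ℝ F] [FiniteDimensional ℝ F]
  [NormedAddCommGroup G] [NormedSpace ℝ G] [FiniteDimensional ℝ G]
  [NormedAddCommGroup V] [NormedSpace ℝ V] [FiniteDimensional ℝ V]

/-! View `f` as a map into Lorentz space, where the connection of `ℍⁿ` is the ordinary derivative up
to a multiple of the position vector. The theorem rests on one linear object: the ν-dimensional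
subspace `K(x) = {⟨δ,T⟩ f + f_* T : T ∈ 𝒟(x)}` is locally constant (`map_conicMap_eventually_eq`,
transferred to `M` in `conicSpace_eventually_eq`). Indeed, leaves of `𝒟` are totally geodesic
(Codazzi) and `𝒟^⊥` is umbilical, so the derivative of a section of `K` has the form `ω(Z) f` plus
an element of `K`. Symmetry of second derivatives then puts `ω(Z) f_* Y - ω(Y) f_* Z` into the span
of `f` and `f_* 𝒟`, and this forces `ω = 0` because `𝒟` has codimension at least two.

A constant `K` determines the cone. The position `f(x)` never lies in `K`, and `X ∈ 𝒟(x)` exactly if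
`f_* X + b f ∈ K` for some `b`. Fix `q ∈ ℍⁿ` outside `K`. Then `K` has a parametrization `κ` with
`⟨κ s, κ t⟩ = ⟨s,t⟩ - ⟨a,s⟩⟨a,t⟩`, where `⟨a,t⟩ = ⟨q, κ t⟩`. The set `umbSet a κ`, which is `ℍⁿ ∩ (q
+ K^⊥)`, is umbilical of curvature `‖a‖² - 1` with parallel normal frame `κ t + ⟨a,t⟩ z`, and its
normal exponential map is `coneMap a κ z t = φ(t) z + (sinh ‖t‖ / ‖t‖) κ t`. The condition `c ≠ -1`
is `a ≠ 0`, which holds for a suitable `q`. The products of `coneMap a κ z t` with `K` do not depend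
on `z` (`lor_coneMap`). Hence they recover `t` wherever `heights a` is invertible, and then `z`.
Applied to `f(x)` this gives maps `t` and `h` on `M` with `f = coneMap a κ h t`. The differential of
`h` vanishes on `𝒟`, and that of `t` is an isomorphism there (`isConeChart_of_heights`). A fibre of
`t`, immersed by `h`, is the base `Σ`; a flow box for `(h, t)` proves the local statement.

If the leaves are complete and `M` is connected, `K` is one subspace, and it contains no timelike
vector: otherwise a leaf geodesic would run into `K`. So `‖a‖ ≤ 1`, in which case the cone factor is
positive everywhere and the height map is injective with image large enough to contain all heights
of `f`. Thus `h` and `t` are global. The curves `τ ↦ coneMap a κ z (τ v)` are geodesics which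
completeness lifts to the leaves for all times, and following them identifies `M` with the product
of a fibre of `t` and `ℝ^ν`.

The ambient umbilical submanifolds are realized by explicit models: graphs over `ℝ^d` for `c ≤ 0`
and round spheres for `c > 0`. The latter are simply connected since `d ≥ 2`. -/

theorem exists_generalized_inverse (A : F →L[ℝ] G) :
    ∃ B : G →L[ℝ] F, ∀ x, A (B (A x)) = A x := by
  obtain ⟨g, hg⟩ := (A : F →ₗ[ℝ] G).rangeRestrict.exists_rightInverse_of_surjective
    (LinearMap.range_rangeRestrict _)
  obtain ⟨p, hp⟩ := Submodule.exists_isCompl (LinearMap.range (A : F →ₗ[ℝ] G))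
  refine ⟨LinearMap.toContinuousLinearMap
    (g ∘ₗ Submodule.projectionOnto (LinearMap.range (A : F →ₗ[ℝ] G)) p hp), fun x => ?_⟩
  have h1 : Submodule.projectionOnto (LinearMap.range (A : F →ₗ[ℝ] G)) p hp (A x)
      = ⟨A x, ⟨x, rfl⟩⟩ :=
    Submodule.projectionOnto_apply_left hp ⟨A x, ⟨x, rfl⟩⟩
  have h2 := congrArg Subtype.val (LinearMap.congr_fun hg ⟨A x, ⟨x, rfl⟩⟩)
  simpa [h1] using h2

theorem exists_kernel_parametrization (A : F →L[ℝ] G) :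
    ∃ (r : ℕ) (J : (Fin r → ℝ) →L[ℝ] F), Function.Injective J ∧ ∀ y, A y = 0 ↔ ∃ x, J x = y := by
  let b := Module.finBasis ℝ (LinearMap.ker (A : F →ₗ[ℝ] G))
  refine ⟨_, LinearMap.toContinuousLinearMap
    ((LinearMap.ker (A : F →ₗ[ℝ] G)).subtype ∘ₗ b.equivFun.symm.toLinearMap), ?_, fun y => ?_⟩
  · exact Subtype.val_injective.comp b.equivFun.symm.injective
  · constructor
    · intro hy
      exact ⟨b.equivFun ⟨y, hy⟩, by simp⟩
    · rintro ⟨x, rfl⟩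
      exact (b.equivFun.symm x).2

theorem exists_continuous_leftInverse (A : F →L[ℝ] V) (hA : Function.Injective A) :
    ∃ B : V →L[ℝ] F, ∀ x, B (A x) = x := by
  obtain ⟨B, hB⟩ := ContinuousLinearMap.HasLeftInverse.of_injective_of_finiteDimensional (f := A) hA
  exact ⟨B, hB⟩

theorem contDiffAt_inverse_clm {M : E → (F →L[ℝ] F)} {u : E} (hM : ContDiffAt ℝ ∞ M u)
    (hu : IsUnit (M u)) : ContDiffAt ℝ ∞ (fun v => Ring.inverse (M v)) u := by
  obtain ⟨x, hx⟩ := hu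
  have h := contDiffAt_ringInverse ℝ (n := ∞) x
  rw [hx] at h
  exact h.comp u hM

theorem eventually_isUnit {M : E → (F →L[ℝ] F)} {u : E} (hM : ContinuousAt M u)
    (hu : IsUnit (M u)) : ∀ᶠ v in 𝓝 u, IsUnit (M v) :=
  hM.eventually (Units.isOpen.mem_nhds hu)

/-- The kernels of a smooth family of linear maps of constant rank are the images of one of them
under a smooth family of automorphisms. -/
theorem exists_smooth_kernel_frame {A : E → (F →L[ℝ] G)} {u₀ : E}
    (hA : ∀ᶠ u in 𝓝 u₀, ContDiffAt ℝ ∞ A u)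
    (hr : ∀ᶠ u in 𝓝 u₀, Module.finrank ℝ (LinearMap.ker (A u : F →ₗ[ℝ] G)) =
      Module.finrank ℝ (LinearMap.ker (A u₀ : F →ₗ[ℝ] G))) :
    ∃ R : E → (F →L[ℝ] F), (∀ᶠ u in 𝓝 u₀, ContDiffAt ℝ ∞ R u) ∧ R u₀ = 1 ∧
      ∀ᶠ u in 𝓝 u₀, Function.Injective (R u) ∧ (∀ x, A u₀ x = 0 → A u (R u x) = 0) ∧
        ∀ y, A u y = 0 → ∃ x, A u₀ x = 0 ∧ R u x = y := by
  obtain ⟨B, hB⟩ := exists_generalized_inverse (A u₀)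
  -- On `ker A(u)` this is `1 - B A(u₀)`, which has values in `ker A(u₀)` because `A(u₀) B A(u₀) =
  -- A(u₀)`. Near `u₀` it is invertible, and the inverse is the required family.
  set M : E → (F →L[ℝ] F) := fun u => 1 + B ∘L (A u - A u₀) with hM
  have hMs : ∀ᶠ u in 𝓝 u₀, ContDiffAt ℝ ∞ M u := by
    filter_upwards [hA] with u hu
    exact contDiffAt_const.add (contDiffAt_const.clm_comp (hu.sub contDiffAt_const))
  have hM0 : M u₀ = 1 := by simp [hM]
  have hMu := eventually_isUnit hMs.self_of_nhds.continuousAt (hM0 ▸ isUnit_one)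
  refine ⟨fun u => Ring.inverse (M u), ?_, by simp [hM0], ?_⟩
  · filter_upwards [hMs, hMu] with u h1 h2 using contDiffAt_inverse_clm h1 h2
  filter_upwards [hMu, hr] with u hu hru
  have hl : ∀ x, Ring.inverse (M u) (M u x) = x := fun x => by
    have := congrArg (fun L : F →L[ℝ] F => L x) (Ring.inverse_mul_cancel _ hu)
    simpa using this
  have hrr : ∀ x, M u (Ring.inverse (M u) x) = x := fun x => by
    have := congrArg (fun L : F →L[ℝ] F => L x) (Ring.mul_inverse_cancel _ hu)
    simpa using this
  have hmap : ∀ y ∈ LinearMap.ker (A u : F →ₗ[ℝ] G),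
      (M u : F →ₗ[ℝ] F) y ∈ LinearMap.ker (A u₀ : F →ₗ[ℝ] G) := by
    intro y hy
    have hy' : A u y = 0 := hy
    simp [hM, hy', hB]
  set φ := (M u : F →ₗ[ℝ] F).restrict hmap with hφ
  have hinj : Function.Injective φ := by
    intro x y hxy
    have h1 : M u x = M u y := congrArg Subtype.val hxy
    exact Subtype.ext ((Function.LeftInverse.injective hl) h1)
  have hsurj : Function.Surjective φ :=
    (LinearMap.injective_iff_surjective_of_finrank_eq_finrank hru).1 hinj
  refine ⟨Function.LeftInverse.injective hrr, fun x hx => ?_, fun y hy => ?_⟩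
  · obtain ⟨y, hy⟩ := hsurj ⟨x, hx⟩
    have : M u y = x := congrArg Subtype.val hy
    rw [← this, hl]; exact y.2
  · exact ⟨M u y, hmap y hy, hl y⟩

theorem exists_smooth_leftInverse {C : E → (F →L[ℝ] V)} {u₀ : E}
    (hC : ∀ᶠ u in 𝓝 u₀, ContDiffAt ℝ ∞ C u) (hi : Function.Injective (C u₀)) :
    ∃ L : E → (V →L[ℝ] F), (∀ᶠ u in 𝓝 u₀, ContDiffAt ℝ ∞ L u) ∧
      ∀ᶠ u in 𝓝 u₀, ∀ x, L u (C u x) = x := by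
  obtain ⟨p, hp⟩ := exists_continuous_leftInverse (C u₀) hi
  set M : E → (F →L[ℝ] F) := fun u => p ∘L C u with hM
  have hMs : ∀ᶠ u in 𝓝 u₀, ContDiffAt ℝ ∞ M u := by
    filter_upwards [hC] with u hu
    exact contDiffAt_const.clm_comp hu
  have hM0 : M u₀ = 1 := by ext x; simp [hM, hp]
  have hMu := eventually_isUnit hMs.self_of_nhds.continuousAt (hM0 ▸ isUnit_one)
  refine ⟨fun u => Ring.inverse (M u) ∘L p, ?_, ?_⟩
  · filter_upwards [hMs, hMu] with u h1 h2
    exact (contDiffAt_inverse_clm h1 h2).clm_comp contDiffAt_const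
  filter_upwards [hMu] with u hu x
  have := congrArg (fun L : F →L[ℝ] F => L x) (Ring.inverse_mul_cancel _ hu)
  simpa [hM] using this

/-- A smooth family of subspaces that contains the derivatives of its frame is constant. -/
theorem range_eventually_eq {B : E → (F →L[ℝ] V)} {u₀ : E}
    (hB : ∀ᶠ u in 𝓝 u₀, ContDiffAt ℝ ∞ B u) (hi : Function.Injective (B u₀))
    (hd : ∀ᶠ u in 𝓝 u₀, ∀ Z x, ∃ y, fderiv ℝ B u Z x = B u y) :
    ∀ᶠ u in 𝓝 u₀, LinearMap.range (B u : F →ₗ[ℝ] V) = LinearMap.range (B u₀ : F →ₗ[ℝ] V) := by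
  obtain ⟨p, hp⟩ := exists_continuous_leftInverse (B u₀) hi
  set M : E → (F →L[ℝ] F) := fun u => p ∘L B u with hM
  have hMs : ∀ᶠ u in 𝓝 u₀, ContDiffAt ℝ ∞ M u := by
    filter_upwards [hB] with u hu
    exact contDiffAt_const.clm_comp hu
  have hM0 : M u₀ = 1 := by ext x; simp [hM, hp]
  have hMu := eventually_isUnit hMs.self_of_nhds.continuousAt (hM0 ▸ isUnit_one)
  set I : E → (F →L[ℝ] F) := fun u => Ring.inverse (M u) with hI
  -- The frame is normalized so that `p N = 1`. Then `p` annihilates the derivative of `N`, which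
  -- takes values in the range of `B`. Since `p` is injective on that range, `N` is constant.
  set N : E → (F →L[ℝ] V) := fun u => B u ∘L I u with hN
  have hIs : ∀ᶠ u in 𝓝 u₀, ContDiffAt ℝ ∞ I u := by
    filter_upwards [hMs, hMu] with u h1 h2 using contDiffAt_inverse_clm h1 h2
  have hpN : ∀ᶠ u in 𝓝 u₀, p ∘L N u = 1 := by
    filter_upwards [hMu] with u hu
    exact Ring.mul_inverse_cancel _ hu
  have hD : ∀ᶠ u in 𝓝 u₀, DifferentiableAt ℝ N u ∧ fderiv ℝ N u = 0 := by
    filter_upwards [hB, hIs, hpN.eventually_nhds, hd, hMu] with u h1 h2 h3 h4 h5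
    have d1 := h1.differentiableAt (by simp)
    have d2 := h2.differentiableAt (by simp)
    have dN : DifferentiableAt ℝ N u := d1.clm_comp d2
    refine ⟨dN, ?_⟩
    have e1 : fderiv ℝ (fun v => p ∘L N v) u = 0 := by
      rw [Filter.EventuallyEq.fderiv_eq (f := fun _ => (1 : F →L[ℝ] F)) h3]; simp
    have e2 : ∀ Z, p ∘L (fderiv ℝ N u Z) = 0 := fun Z => by
      have := fderiv_clm_comp (c := fun _ => p) (d := N) (differentiableAt_const p) dN
      rw [e1] at this
      have := congrArg (fun L => L Z) this
      simpa using this.symm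
    ext Z x
    have e3 : fderiv ℝ N u Z = B u ∘L (fderiv ℝ I u Z) + (fderiv ℝ B u Z) ∘L I u := by
      have := fderiv_clm_comp d1 d2
      rw [hN, this]; simp
    obtain ⟨y, hy⟩ := h4 Z (I u x)
    have e4 : fderiv ℝ N u Z x = B u (fderiv ℝ I u Z x + y) := by
      rw [e3]; simp [hy]
    have e5 : M u (fderiv ℝ I u Z x + y) = 0 := by
      have := congrArg (fun L => L x) (e2 Z)
      simp only [ContinuousLinearMap.comp_apply, e4] at this
      simpa [hM] using this
    have e6 : fderiv ℝ I u Z x + y = 0 := by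
      have := congrArg (fun L : F →L[ℝ] F => L (fderiv ℝ I u Z x + y))
        (Ring.inverse_mul_cancel _ h5)
      change I u (M u _) = _ at this
      rw [e5] at this
      simpa using this.symm
    rw [e4, e6]; simp
  obtain ⟨ε, hε, hball⟩ := Metric.eventually_nhds_iff_ball.1 hD
  have hconst : ∀ u ∈ Metric.ball u₀ ε, N u = N u₀ := fun u hu =>
    IsOpen.is_const_of_fderiv_eq_zero (𝕜 := ℝ) Metric.isOpen_ball
      (convex_ball u₀ ε).isPreconnected
      (fun v hv => (hball v hv).1.differentiableWithinAt) (fun v hv => (hball v hv).2) hu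
      (Metric.mem_ball_self hε)
  have hrange : ∀ u, IsUnit (M u) →
      LinearMap.range (N u : F →ₗ[ℝ] V) = LinearMap.range (B u : F →ₗ[ℝ] V) := by
    intro u hu
    apply le_antisymm
    · rintro _ ⟨x, rfl⟩; exact ⟨I u x, rfl⟩
    · rintro _ ⟨x, rfl⟩
      refine ⟨M u x, ?_⟩
      have := congrArg (fun L : F →L[ℝ] F => L x) (Ring.inverse_mul_cancel _ hu)
      change I u (M u x) = x at this
      change B u (I u (M u x)) = B u x
      rw [this]
  filter_upwards [Metric.ball_mem_nhds u₀ hε, hMu] with u h1 h2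
  rw [← hrange u h2, hconst u h1, hrange u₀ hMu.self_of_nhds]

end LinearFamilies

/-! ### The constant subspace of an umbilical conullity, in coordinates -/

section Flat

open Filter Topology

variable {E V : Type*} [NormedAddCommGroup E] [NormedSpace ℝ E] [FiniteDimensional ℝ E]
  [NormedAddCommGroup V] [NormedSpace ℝ V] [FiniteDimensional ℝ V]

/-- The map `T ↦ d(T) f + f_* T`. -/
def conicMap (f : E → V) (d : E → (E →L[ℝ] ℝ)) (u : E) : E →L[ℝ] V :=
  (d u).smulRight (f u) + fderiv ℝ f u

/-- The span of the position vector and the tangent space. -/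
def tanSpan (f : E → V) (u : E) : Submodule ℝ V where
  carrier := {v | ∃ (a : ℝ) (X : E), v = a • f u + fderiv ℝ f u X}
  add_mem' := by
    rintro _ _ ⟨a, X, rfl⟩ ⟨b, Y, rfl⟩
    exact ⟨a + b, X + Y, by rw [map_add]; module⟩
  zero_mem' := ⟨0, 0, by simp⟩
  smul_mem' := by
    rintro c _ ⟨a, X, rfl⟩
    exact ⟨c * a, c • X, by rw [map_smul]; module⟩

/-- The span of the position vector and the image of a subspace of the tangent space. -/
def subSpan (f : E → V) (D : E → Submodule ℝ E) (u : E) : Submodule ℝ V where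
  carrier := {v | ∃ (a : ℝ), ∃ X ∈ D u, v = a • f u + fderiv ℝ f u X}
  add_mem' := by
    rintro _ _ ⟨a, X, hX, rfl⟩ ⟨b, Y, hY, rfl⟩
    exact ⟨a + b, X + Y, add_mem hX hY, by rw [map_add]; module⟩
  zero_mem' := ⟨0, 0, zero_mem _, by simp⟩
  smul_mem' := by
    rintro c _ ⟨a, X, hX, rfl⟩
    exact ⟨c * a, c • X, Submodule.smul_mem _ _ hX, by rw [map_smul]; module⟩

/-- The linear map whose kernel is the relative nullity with the coefficients of the second
derivative. -/
def nullityMap (f : E → V) (u : E) : (E × (E →L[ℝ] ℝ) × (E →L[ℝ] E)) →L[ℝ] (E →L[ℝ] V) :=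
  (fderiv ℝ (fderiv ℝ f) u) ∘L ContinuousLinearMap.fst ℝ E ((E →L[ℝ] ℝ) × (E →L[ℝ] E))
    - ((ContinuousLinearMap.smulRightL ℝ E V).flip (f u)) ∘L
        (ContinuousLinearMap.fst ℝ _ _ ∘L ContinuousLinearMap.snd ℝ E ((E →L[ℝ] ℝ) × (E →L[ℝ] E)))
    - (ContinuousLinearMap.compL ℝ E E V (fderiv ℝ f u)) ∘L
        (ContinuousLinearMap.snd ℝ _ _ ∘L ContinuousLinearMap.snd ℝ E ((E →L[ℝ] ℝ) × (E →L[ℝ] E)))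

theorem nullityMap_apply (f : E → V) (u : E) (x : E × (E →L[ℝ] ℝ) × (E →L[ℝ] E)) (Y : E) :
    nullityMap f u x Y =
      fderiv ℝ (fderiv ℝ f) u x.1 Y - x.2.1 Y • f u - fderiv ℝ f u (x.2.2 Y) := by
  simp [nullityMap]

theorem contDiffAt_nullityMap {f : E → V} {u : E} (hf : ContDiffAt ℝ ∞ f u) :
    ContDiffAt ℝ ∞ (nullityMap f) u := by
  have h1 : ContDiffAt ℝ ∞ (fderiv ℝ f) u := hf.fderiv_right le_rfl
  have h2 : ContDiffAt ℝ ∞ (fderiv ℝ (fderiv ℝ f)) u := h1.fderiv_right le_rfl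
  exact ((h2.clm_comp contDiffAt_const).sub
    ((ContDiffAt.clm_apply contDiffAt_const hf).clm_comp contDiffAt_const)).sub
    ((ContDiffAt.clm_apply contDiffAt_const h1).clm_comp contDiffAt_const)

theorem nullityMap_eq_zero_iff (f : E → V) (u : E) (x : E × (E →L[ℝ] ℝ) × (E →L[ℝ] E)) :
    nullityMap f u x = 0 ↔
      ∀ Y, fderiv ℝ (fderiv ℝ f) u x.1 Y = x.2.1 Y • f u + fderiv ℝ f u (x.2.2 Y) := by
  rw [ContinuousLinearMap.ext_iff]
  refine forall_congr' fun Y => ?_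
  rw [nullityMap_apply, sub_sub, zero_apply, sub_eq_zero]

theorem exists_coefficients {f : E → V} {u : E}
    (hinj : ∀ (a : ℝ) X, a • f u + fderiv ℝ f u X = 0 → a = 0 ∧ X = 0) (L : E →L[ℝ] V)
    (hL : ∀ Y, L Y ∈ tanSpan f u) :
    ∃ (α : E →L[ℝ] ℝ) (β : E →L[ℝ] E), ∀ Y, L Y = α Y • f u + fderiv ℝ f u (β Y) := by
  set C : (ℝ × E) →L[ℝ] V := ((ContinuousLinearMap.fst ℝ ℝ E).smulRight (f u)) +
    fderiv ℝ f u ∘L ContinuousLinearMap.snd ℝ ℝ E with hC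
  have hCi : Function.Injective C := by
    rw [injective_iff_map_eq_zero]
    intro x hx
    obtain ⟨h1, h2⟩ := hinj x.1 x.2 (by simpa [hC] using hx)
    exact Prod.ext h1 h2
  obtain ⟨p, hp⟩ := exists_continuous_leftInverse C hCi
  refine ⟨ContinuousLinearMap.fst ℝ ℝ E ∘L p ∘L L, ContinuousLinearMap.snd ℝ ℝ E ∘L p ∘L L,
    fun Y => ?_⟩
  obtain ⟨a, X, h⟩ := hL Y
  have : L Y = C (a, X) := by simp [hC, h]
  simp only [ContinuousLinearMap.comp_apply, this, hp]
  simp [hC]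

/-- The relative nullity distribution in coordinates is the projection of the kernel. -/
theorem finrank_ker_nullityMap {f : E → V} {u : E} {D : Submodule ℝ E}
    (hD : ∀ X, X ∈ D ↔ ∀ Y, fderiv ℝ (fderiv ℝ f) u X Y ∈ tanSpan f u)
    (hinj : ∀ (a : ℝ) X, a • f u + fderiv ℝ f u X = 0 → a = 0 ∧ X = 0) :
    Module.finrank ℝ (LinearMap.ker (nullityMap f u).toLinearMap) = Module.finrank ℝ D := by
  have hm : ∀ x ∈ LinearMap.ker (nullityMap f u).toLinearMap,
      LinearMap.fst ℝ E ((E →L[ℝ] ℝ) × (E →L[ℝ] E)) x ∈ D := by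
    intro x hx
    have hx' : nullityMap f u x = 0 := hx
    rw [nullityMap_eq_zero_iff] at hx'
    exact (hD _).2 fun Y => ⟨_, _, hx' Y⟩
  refine LinearEquiv.finrank_eq (LinearEquiv.ofBijective
    ((LinearMap.fst ℝ E ((E →L[ℝ] ℝ) × (E →L[ℝ] E))).restrict hm) ⟨?_, ?_⟩)
  · rw [injective_iff_map_eq_zero]
    rintro ⟨x, hx⟩ h0
    have h1 : x.1 = 0 := congrArg Subtype.val h0
    have hx' : nullityMap f u x = 0 := hx
    rw [nullityMap_eq_zero_iff] at hx'
    have h2 : ∀ Y, x.2.1 Y = 0 ∧ x.2.2 Y = 0 := fun Y => hinj _ _ (by rw [← hx' Y, h1]; simp)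
    refine Subtype.ext (Prod.ext h1 (Prod.ext ?_ ?_))
    · ext Y; exact (h2 Y).1
    · ext Y; rw [(h2 Y).2]; rfl
  · rintro ⟨X, hX⟩
    obtain ⟨α, β, h⟩ := exists_coefficients hinj (fderiv ℝ (fderiv ℝ f) u X) ((hD X).1 hX)
    exact ⟨⟨(X, α, β), (nullityMap_eq_zero_iff _ _ _).2 h⟩, rfl⟩

theorem fderiv_clm_apply_apply {F G : Type*} [NormedAddCommGroup F] [NormedSpace ℝ F]
    [NormedAddCommGroup G] [NormedSpace ℝ G] {c : E → F →L[ℝ] G} {x : E → F} {u : E}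
    (hc : DifferentiableAt ℝ c u) (hx : DifferentiableAt ℝ x u) (Z : E) :
    fderiv ℝ (fun v => c v (x v)) u Z = c u (fderiv ℝ x u Z) + fderiv ℝ c u Z (x u) := by
  rw [fderiv_clm_apply hc hx]; simp

theorem fderiv_smul_apply {a : E → ℝ} {x : E → V} {u : E}
    (ha : DifferentiableAt ℝ a u) (hx : DifferentiableAt ℝ x u) (Z : E) :
    fderiv ℝ (fun v => a v • x v) u Z = a u • fderiv ℝ x u Z + fderiv ℝ a u Z • x u := by
  rw [fderiv_fun_smul ha hx]; simp

theorem fderiv_symm_of_contDiffAt {w : E → V} {u : E} (hw : ContDiffAt ℝ ∞ w u) (Y Z : E) :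
    fderiv ℝ (fderiv ℝ w) u Y Z = fderiv ℝ (fderiv ℝ w) u Z Y :=
  (hw.isSymmSndFDerivAt (by
    rw [minSmoothness_of_isRCLikeNormedField]; exact WithTop.coe_le_coe.2 le_top)).eq Y Z

/-- The leaves of the relative nullity distribution are totally geodesic. -/
theorem nullity_totally_geodesic {f w : E → V} {α : E → E →L[ℝ] ℝ} {N : E → E →L[ℝ] E} {u : E}
    (hf : ContDiffAt ℝ ∞ f u) (hw : ContDiffAt ℝ ∞ w u) (hα : ContDiffAt ℝ ∞ α u)
    (hN : ContDiffAt ℝ ∞ N u)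
    (h : ∀ᶠ v in 𝓝 u, ∀ Y, fderiv ℝ w v Y = α v Y • f v + fderiv ℝ f v (N v Y)) {S : E}
    (hS : ∀ Y, fderiv ℝ (fderiv ℝ f) u S Y ∈ tanSpan f u) (Y : E) :
    fderiv ℝ (fderiv ℝ f) u (N u S) Y ∈ tanSpan f u := by
  have df := hf.differentiableAt (by simp)
  have h1 : ContDiffAt ℝ ∞ (fderiv ℝ f) u := hf.fderiv_right le_rfl
  have ddf := h1.differentiableAt (by simp)
  have dw : DifferentiableAt ℝ (fderiv ℝ w) u := ContDiffAt.differentiableAt (n := ∞) (hw.fderiv_right le_rfl) (by simp)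
  have dα := hα.differentiableAt (by simp)
  have dN := hN.differentiableAt (by simp)
  have key : ∀ X Z, fderiv ℝ (fderiv ℝ w) u X Z = (α u Z • fderiv ℝ f u X +
      fderiv ℝ α u X Z • f u) + (fderiv ℝ f u (fderiv ℝ N u X Z) +
      fderiv ℝ (fderiv ℝ f) u X (N u Z)) := by
    intro X Z
    have e1 : fderiv ℝ (fderiv ℝ w) u X Z = fderiv ℝ (fun v => fderiv ℝ w v Z) u X := by
      rw [fderiv_clm_apply_apply dw (differentiableAt_const Z)]; simp
    have e2 : fderiv ℝ (fun v => α v Z) u X = fderiv ℝ α u X Z := by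
      rw [fderiv_clm_apply_apply dα (differentiableAt_const Z)]; simp
    have e3 : fderiv ℝ (fun v => N v Z) u X = fderiv ℝ N u X Z := by
      rw [fderiv_clm_apply_apply dN (differentiableAt_const Z)]; simp
    have d1 : DifferentiableAt ℝ (fun v => α v Z) u := dα.clm_apply (differentiableAt_const Z)
    have d2 : DifferentiableAt ℝ (fun v => N v Z) u := dN.clm_apply (differentiableAt_const Z)
    rw [e1, Filter.EventuallyEq.fderiv_eq
      (f := fun v => α v Z • f v + fderiv ℝ f v (N v Z)) (h.mono fun v hv => hv Z),
      fderiv_fun_add (f := fun v => α v Z • f v) (d1.smul df) (ddf.clm_apply d2), add_apply,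
      fderiv_smul_apply d1 df, fderiv_clm_apply_apply ddf d2, e2, e3]
  -- This is the Codazzi equation: symmetry of the second derivative of `w` compares the second
  -- derivatives of `f` in the directions `(Y, N S)` and `(S, N Y)` up to tangential terms, and the
  -- latter is tangential because `S` is in the nullity.
  have hsym := fderiv_symm_of_contDiffAt hw Y S
  rw [key, key] at hsym
  rw [fderiv_symm_of_contDiffAt hf]
  have e : fderiv ℝ (fderiv ℝ f) u Y (N u S) =
      fderiv ℝ (fderiv ℝ f) u S (N u Y) + ((fderiv ℝ α u S Y - fderiv ℝ α u Y S) • f u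
        + fderiv ℝ f u (α u Y • S - α u S • Y + fderiv ℝ N u S Y - fderiv ℝ N u Y S)) := by
    simp only [map_add, map_sub, map_smul]
    linear_combination (norm := module) hsym
  rw [e]
  exact add_mem (hS _) ⟨_, _, rfl⟩

/-- If `c Z ≠ 0`, the hypothesis expresses every `Y` modulo `D u` as a multiple of `Z`, so that `D
u` would have codimension at most one. This is the only place in the constancy argument where `ν ≤ m
- 2` is used. -/
theorem coefficient_eq_zero {ν : ℕ} {f : E → V} {D : E → Submodule ℝ E} {u : E}
    (hinj : ∀ (a : ℝ) X, a • f u + fderiv ℝ f u X = 0 → a = 0 ∧ X = 0)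
    (hν : ν + 2 ≤ Module.finrank ℝ E) (hD : Module.finrank ℝ (D u) = ν) (c : E →L[ℝ] ℝ)
    (h : ∀ Y Z, c Z • fderiv ℝ f u Y - c Y • fderiv ℝ f u Z ∈ subSpan f D u) : c = 0 := by
  by_contra hc
  obtain ⟨Z, hZ⟩ : ∃ Z, c Z ≠ 0 := by
    by_contra! h0
    exact hc (ContinuousLinearMap.ext h0)
  have htop : D u ⊔ Submodule.span ℝ {Z} = ⊤ := by
    rw [eq_top_iff]
    intro Y _
    obtain ⟨a, X, hX, hXY⟩ := h Y Z
    have h1 := hinj a (X - (c Z • Y - c Y • Z)) (by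
      rw [map_sub, map_sub, map_smul, map_smul, hXY]; abel)
    have h2 : Y = (c Z)⁻¹ • X + ((c Z)⁻¹ * c Y) • Z := by
      rw [sub_eq_zero.1 h1.2, smul_sub, smul_smul, smul_smul, inv_mul_cancel₀ hZ]; module
    rw [h2]
    exact add_mem (Submodule.mem_sup_left (Submodule.smul_mem _ _ hX))
      (Submodule.mem_sup_right (Submodule.smul_mem _ _ (Submodule.mem_span_singleton_self Z)))
  have h3 := Submodule.finrank_add_le_finrank_add_finrank (D u) (Submodule.span ℝ {Z})
  rw [htop, finrank_top, hD] at h3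
  have h4 : Module.finrank ℝ (Submodule.span ℝ {Z}) ≤ 1 := by
    simpa using finrank_span_le_card (R := ℝ) ({Z} : Set E)
  omega

theorem subSpan_of_nullity {f : E → V} {D : E → Submodule ℝ E} {u : E} (a : ℝ) {X : E}
    (hX : X ∈ D u) : a • f u + fderiv ℝ f u X ∈ subSpan f D u := ⟨a, X, hX, rfl⟩

/-- If the conullity of `f` is umbilical with `⟨δ, T⟩ = d(T)`, the subspaces `{d(T) f + f_* T}` are
locally constant. -/
theorem map_conicMap_eventually_eq {ν : ℕ} {f : E → V} {d : E → (E →L[ℝ] ℝ)}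
    {D D' : E → Submodule ℝ E} {u₀ : E}
    (hf : ∀ᶠ u in 𝓝 u₀, ContDiffAt ℝ ∞ f u) (hd : ∀ᶠ u in 𝓝 u₀, ContDiffAt ℝ ∞ d u)
    (hD : ∀ᶠ u in 𝓝 u₀, ∀ X, X ∈ D u ↔ ∀ Y, fderiv ℝ (fderiv ℝ f) u X Y ∈ tanSpan f u)
    (hr : ∀ᶠ u in 𝓝 u₀, Module.finrank ℝ (D u) = ν) (hν : ν + 2 ≤ Module.finrank ℝ E)
    (hinj : ∀ᶠ u in 𝓝 u₀, ∀ (a : ℝ) X, a • f u + fderiv ℝ f u X = 0 → a = 0 ∧ X = 0)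
    (hD' : ∀ᶠ u in 𝓝 u₀, D u ⊔ D' u = ⊤)
    (humb : ∀ᶠ u in 𝓝 u₀, ∀ T : E → E, (∀ᶠ v in 𝓝 u, ContDiffAt ℝ ∞ T v) →
      (∀ᶠ v in 𝓝 u, T v ∈ D v) → ∀ X ∈ D' u,
        fderiv ℝ (fun v => fderiv ℝ f v (T v)) u X + d u (T u) • fderiv ℝ f u X ∈ subSpan f D u) :
    ∀ᶠ u in 𝓝 u₀, (D u).map (conicMap f d u).toLinearMap =
      (D u₀).map (conicMap f d u₀).toLinearMap := by
  have hker : ∀ᶠ u in 𝓝 u₀,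
      Module.finrank ℝ (LinearMap.ker (nullityMap f u).toLinearMap) = ν := by
    filter_upwards [hD, hr, hinj] with u h1 h2 h3
    rw [finrank_ker_nullityMap h1 h3, h2]
  -- The condition defining `D u` contains an existential quantifier. Adjoining the tangential
  -- coefficients as unknowns turns it into the kernel of a smooth family of constant rank, and
  -- provides smooth frames of `D` together with smooth coefficients.
  obtain ⟨R, hRs, hR0, hR⟩ := exists_smooth_kernel_frame (A := nullityMap f) (u₀ := u₀)
    (hf.mono fun u hu => contDiffAt_nullityMap hu)
    (hker.mono fun u hu => hu.trans hker.self_of_nhds.symm)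
  obtain ⟨r, J, hJi, hJ⟩ := exists_kernel_parametrization (nullityMap f u₀)
  have hJ0 : ∀ x, nullityMap f u₀ (J x) = 0 := fun x => (hJ _).2 ⟨x, rfl⟩
  set F := Fin r → ℝ
  set T : F → E → E := fun x u => (R u (J x)).1 with hT
  set N : F → E → (E →L[ℝ] E) := fun x u => (R u (J x)).2.2 + fderiv ℝ (T x) u with hN
  set w : F → E → V := fun x u => fderiv ℝ f u (T x u) with hw
  set B : E → (F →L[ℝ] V) := fun u => conicMap f d u ∘L ContinuousLinearMap.fst ℝ _ _ ∘L R u ∘L J with hB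
  have hBx : ∀ u x, B u x = d u (T x u) • f u + w x u := fun u x => by
    simp [hB, conicMap, hT, hw]
  have hTs : ∀ᶠ u in 𝓝 u₀, ∀ x, ContDiffAt ℝ ∞ (T x) u := by
    filter_upwards [hRs] with u hu x
    exact (hu.clm_apply contDiffAt_const).fst
  have hTD : ∀ᶠ u in 𝓝 u₀, ∀ x, T x u ∈ D u := by
    filter_upwards [hR, hD] with u h1 h2 x
    have := h1.2.1 _ (hJ0 x)
    rw [nullityMap_eq_zero_iff] at this
    exact (h2 _).2 fun Y => ⟨_, _, this Y⟩
  have hBs : ∀ᶠ u in 𝓝 u₀, ContDiffAt ℝ ∞ B u := by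
    filter_upwards [hf, hd, hRs] with u h1 h2 h3
    have h4 : ContDiffAt ℝ ∞ (conicMap f d) u :=
      (h2.smulRight h1).add (h1.fderiv_right le_rfl)
    exact h4.clm_comp (contDiffAt_const.clm_comp (h3.clm_comp contDiffAt_const))
  have hBr : ∀ᶠ u in 𝓝 u₀, LinearMap.range (B u).toLinearMap =
      (D u).map (conicMap f d u).toLinearMap := by
    filter_upwards [hR, hD, hinj, hTD] with u h1 h2 h3 h4
    apply le_antisymm
    · rintro _ ⟨x, rfl⟩
      exact ⟨T x u, h4 x, rfl⟩
    · rintro _ ⟨X, hX, rfl⟩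
      obtain ⟨α, β, h⟩ := exists_coefficients h3 (fderiv ℝ (fderiv ℝ f) u X) ((h2 X).1 hX)
      obtain ⟨x, hx, hxy⟩ := h1.2.2 (X, α, β) ((nullityMap_eq_zero_iff _ _ _).2 h)
      obtain ⟨z, rfl⟩ := (hJ x).1 hx
      refine ⟨z, ?_⟩
      change conicMap f d u (R u (J z)).1 = conicMap f d u X
      rw [hxy]
  have hw' : ∀ᶠ u in 𝓝 u₀, ∀ x Y, fderiv ℝ (w x) u Y =
      (R u (J x)).2.1 Y • f u + fderiv ℝ f u (N x u Y) := by
    filter_upwards [hf, hTs, hR] with u h1 h2 h3 x Y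
    have h4 := h3.2.1 _ (hJ0 x)
    rw [nullityMap_eq_zero_iff] at h4
    have d1 : DifferentiableAt ℝ (fderiv ℝ f) u := ContDiffAt.differentiableAt (n := ∞) (h1.fderiv_right le_rfl) (by simp)
    rw [hw, fderiv_clm_apply_apply d1 ((h2 x).differentiableAt (by simp)),
      fderiv_symm_of_contDiffAt h1, h4 Y]
    simp only [hN, add_apply, map_add]
    abel
  have hNs : ∀ᶠ u in 𝓝 u₀, ∀ x, ContDiffAt ℝ ∞ (N x) u := by
    filter_upwards [hRs, hTs] with u h1 h2 x
    exact ((h1.clm_apply contDiffAt_const).snd.snd).add ((h2 x).fderiv_right le_rfl)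
  have hws : ∀ᶠ u in 𝓝 u₀, ∀ x, ContDiffAt ℝ ∞ (w x) u := by
    filter_upwards [hf, hTs] with u h1 h2 x
    exact ContDiffAt.clm_apply (h1.fderiv_right le_rfl) (h2 x)
  -- The two directions are treated separately: along `D` the leaves are totally geodesic, and along
  -- `D'` the umbilicity cancels the component of the derivative tangent to the conullity.
  have hBd : ∀ᶠ u in 𝓝 u₀, ∀ Z x, fderiv ℝ B u Z x ∈ subSpan f D u := by
    filter_upwards [hf, hd, hTs.eventually_nhds, hTD.eventually_nhds, hw'.eventually_nhds, hNs, hws,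
      hRs, hBs, humb, hD', hD] with u h1 h2 h3 h4 h5 h6 h7 h8 h9 h10 h11 h12 Z x
    have e1 : ∀ Z, fderiv ℝ B u Z x = d u (T x u) • fderiv ℝ f u Z +
        fderiv ℝ (fun v => d v (T x v)) u Z • f u + fderiv ℝ (w x) u Z := by
      intro Z
      have q1 : fderiv ℝ B u Z x = fderiv ℝ (fun v => B v x) u Z := by
        rw [fderiv_clm_apply_apply (h9.differentiableAt (by simp)) (differentiableAt_const x)]
        simp
      have q2 : DifferentiableAt ℝ (fun v => d v (T x v)) u :=
        (h2.differentiableAt (by simp)).clm_apply ((h3.self_of_nhds x).differentiableAt (by simp))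
      have q3 := h1.differentiableAt (n := ∞) (by simp)
      rw [q1]
      simp only [hBx]
      rw [fderiv_fun_add (f := fun v => d v (T x v) • f v) (q2.smul q3)
        ((h7 x).differentiableAt (by simp)), add_apply, fderiv_smul_apply q2 q3]
    have hZ : Z ∈ D u ⊔ D' u := h11 ▸ Submodule.mem_top
    obtain ⟨S, hS, X, hX, rfl⟩ := Submodule.mem_sup.1 hZ
    rw [map_add, add_apply]
    refine add_mem ?_ ?_
    · rw [e1, h5.self_of_nhds x S]
      have hNS : N x u S ∈ D u := (h12 _).2 (nullity_totally_geodesic (w := w x)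
        (α := fun v => (R v (J x)).2.1) h1 (h7 x) ((h8.clm_apply contDiffAt_const).snd.fst) (h6 x)
        (h5.mono fun v hv => hv x) ((h12 S).1 hS))
      convert subSpan_of_nullity (f := f) (fderiv ℝ (fun v => d v (T x v)) u S + (R u (J x)).2.1 S)
        (add_mem (Submodule.smul_mem _ (d u (T x u)) hS) hNS) using 1
      rw [map_add, map_smul]
      module
    · have := h10 (T x) (h3.mono fun v hv => hv x) (h4.mono fun v hv => hv x) X hX
      rw [e1]
      have h' := add_mem this (subSpan_of_nullity (f := f)
        (fderiv ℝ (fun v => d v (T x v)) u X) (zero_mem (D u)))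
      convert h' using 1
      simp only [hw, map_zero]
      abel
  have hB0 : Function.Injective (B u₀) := by
    rw [injective_iff_map_eq_zero]
    intro x hx
    rw [hBx] at hx
    have h1 := hinj.self_of_nhds _ _ hx
    have h2 : (J x).1 = 0 := by
      have := h1.2
      simpa [hT, hR0] using this
    have h3 := (nullityMap_eq_zero_iff f u₀ (J x)).1 (hJ0 x)
    have h4 : ∀ Y, (J x).2.1 Y = 0 ∧ (J x).2.2 Y = 0 := fun Y =>
      hinj.self_of_nhds _ _ (by rw [← h3 Y, h2]; simp)
    refine hJi ((Prod.ext h2 (Prod.ext ?_ ?_) : J x = 0).trans (map_zero J).symm)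
    · ext Y; exact (h4 Y).1
    · ext Y; rw [(h4 Y).2]; rfl
  -- The span of `f` and `f_* D` is the direct sum of `ℝ f` and the range of `B`. A smooth left
  -- inverse of `C` yields smooth components, so that they can be differentiated again below.
  set C : E → ((ℝ × F) →L[ℝ] V) := fun u => (ContinuousLinearMap.fst ℝ ℝ F).smulRight (f u) +
    B u ∘L ContinuousLinearMap.snd ℝ ℝ F with hC
  have hCs : ∀ᶠ u in 𝓝 u₀, ContDiffAt ℝ ∞ C u := by
    filter_upwards [hf, hBs] with u h1 h2
    exact (contDiffAt_const.smulRight h1).add (h2.clm_comp contDiffAt_const)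
  have hC0 : Function.Injective (C u₀) := by
    rw [injective_iff_map_eq_zero]
    rintro ⟨a, x⟩ hx
    have hx' : (a + d u₀ (T x u₀)) • f u₀ + w x u₀ = 0 := by
      have : a • f u₀ + B u₀ x = 0 := by simpa [hC] using hx
      rw [hBx] at this
      rw [← this]; module
    have h1 := hinj.self_of_nhds _ _ hx'
    have h2 : B u₀ x = 0 := by simp [hBx, hw, h1.2]
    have h3 := hB0 (h2.trans (map_zero (B u₀)).symm)
    have h4 := h1.1
    rw [h1.2, map_zero, add_zero] at h4
    exact Prod.ext h4 h3
  obtain ⟨L, hLs, hL⟩ := exists_smooth_leftInverse hCs hC0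
  have hCr : ∀ᶠ u in 𝓝 u₀, ∀ v ∈ subSpan f D u, C u (L u v) = v := by
    filter_upwards [hL, hBr] with u h1 h2 v hv
    obtain ⟨a, X, hX, rfl⟩ := hv
    have : conicMap f d u X ∈ LinearMap.range (B u).toLinearMap := by
      rw [h2]; exact ⟨X, hX, rfl⟩
    obtain ⟨x, hx⟩ := this
    have e : a • f u + fderiv ℝ f u X = C u (a - d u X, x) := by
      have hx' : B u x = d u X • f u + fderiv ℝ f u X := hx
      simp only [hC, add_apply, ContinuousLinearMap.smulRight_apply, ContinuousLinearMap.coe_fst',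
        ContinuousLinearMap.comp_apply, ContinuousLinearMap.coe_snd', hx']
      module
    rw [e, h1]
  have hBsub : ∀ᶠ u in 𝓝 u₀, ∀ x, B u x ∈ subSpan f D u := by
    filter_upwards [hTD] with u h x
    rw [hBx]
    exact ⟨_, _, h x, rfl⟩
  have hBdr : ∀ᶠ u in 𝓝 u₀, ∀ Z x, fderiv ℝ B u Z x =
      (L u (fderiv ℝ B u Z x)).1 • f u + B u (L u (fderiv ℝ B u Z x)).2 := by
    filter_upwards [hCr, hBd] with u h1 h2 Z x
    conv_lhs => rw [← h1 _ (h2 Z x)]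
    simp [hC]
  -- The coefficient of `f` in the derivative of `B` is a one-form. Modulo the span of `f` and `f_*
  -- D`, the second derivative of `B x` is this one-form times `f_*`, so its symmetry leads to
  -- `coefficient_eq_zero`.
  have hom : ∀ᶠ u in 𝓝 u₀, ∀ Z x, (L u (fderiv ℝ B u Z x)).1 = 0 := by
    filter_upwards [hBdr.eventually_nhds, hBs.eventually_nhds, hLs, hBd, hBsub, hr, hinj, hf]
      with u h1 h2' h3 h4 h5 h6 h7 h8 Z x
    have h2 := h2'.self_of_nhds
    set c : E → (E →L[ℝ] ℝ × F) := fun v => L v ∘L (ContinuousLinearMap.apply ℝ V x ∘L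
      fderiv ℝ B v) with hc
    have hcs : ContDiffAt ℝ ∞ c u :=
      h3.clm_comp (contDiffAt_const.clm_comp (h2.fderiv_right le_rfl))
    have dc := hcs.differentiableAt (by simp)
    have hcv : ∀ v Z, c v Z = L v (fderiv ℝ B v Z x) := fun v Z => by simp [hc]
    have dB := h2.differentiableAt (by simp)
    have hb : ContDiffAt ℝ ∞ (fun v => B v x) u := h2.clm_apply contDiffAt_const
    have hq1 : ∀ᶠ v in 𝓝 u, ∀ Z, fderiv ℝ (fun v => B v x) v Z =
        (c v Z).1 • f v + B v (c v Z).2 := by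
      filter_upwards [h1, h2'] with v hv hv2 Z
      rw [fderiv_clm_apply_apply (hv2.differentiableAt (by simp)) (differentiableAt_const x)]
      simp only [fderiv_fun_const, Pi.zero_apply, zero_apply, map_zero, zero_add, hcv]
      exact hv Z x
    have key : ∀ Y Z, fderiv ℝ (fderiv ℝ (fun v => B v x)) u Y Z -
        (c u Z).1 • fderiv ℝ f u Y ∈ subSpan f D u := by
      intro Y Z
      have dcZ : DifferentiableAt ℝ (fun v => c v Z) u := dc.clm_apply (differentiableAt_const Z)
      have e1 : fderiv ℝ (fderiv ℝ (fun v => B v x)) u Y Z =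
          fderiv ℝ (fun v => fderiv ℝ (fun v => B v x) v Z) u Y := by
        rw [fderiv_clm_apply_apply (ContDiffAt.differentiableAt (n := ∞) (hb.fderiv_right le_rfl)
          (by simp)) (differentiableAt_const Z)]
        simp
      have df := h8.differentiableAt (n := ∞) (by simp)
      rw [e1, Filter.EventuallyEq.fderiv_eq (f := fun v => (c v Z).1 • f v + B v (c v Z).2)
        (hq1.mono fun v hv => hv Z), fderiv_fun_add (f := fun v => (c v Z).1 • f v)
        (dcZ.fst.smul df) (dB.clm_apply dcZ.snd), add_apply, fderiv_smul_apply dcZ.fst df,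
        fderiv_clm_apply_apply dB dcZ.snd]
      have := add_mem (subSpan_of_nullity (f := f) (fderiv ℝ (fun v => (c v Z).1) u Y)
        (zero_mem (D u))) (add_mem (h5 (fderiv ℝ (fun v => (c v Z).2) u Y)) (h4 Y (c u Z).2))
      convert this using 1
      rw [map_zero]
      abel
    have := coefficient_eq_zero h7 hν h6 (ContinuousLinearMap.fst ℝ ℝ F ∘L c u) (fun Y Z => by
      have h := sub_mem (key Z Y) (key Y Z)
      rw [fderiv_symm_of_contDiffAt hb] at h
      convert h using 1
      simp)
    have h := congrArg (fun l => l Z) this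
    simpa [hcv] using h
  have hfin := range_eventually_eq hBs hB0 (by
    filter_upwards [hBdr, hom] with u h1 h2 Z x
    refine ⟨(L u (fderiv ℝ B u Z x)).2, ?_⟩
    conv_lhs => rw [h1 Z x, h2 Z x]
    simp)
  filter_upwards [hfin, hBr] with u h1 h2
  rw [← h2, h1, hBr.self_of_nhds]

end Flat

/-! ### Lorentz space -/

section Lorentz

variable {n : ℕ}

theorem lor_comm (x y : Lor n) : lor x y = lor y x := by
  simp only [lor, mul_comm]

theorem lor_add_right (x y y' : Lor n) : lor x (y + y') = lor x y + lor x y' := by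
  rw [lor_comm, lor_add_left, lor_comm y, lor_comm y']

theorem lor_smul_right (a : ℝ) (x y : Lor n) : lor x (a • y) = a * lor x y := by
  rw [lor_comm, lor_smul_left, lor_comm]

theorem lor_zero_right (x : Lor n) : lor x 0 = 0 := by rw [lor_comm, lor_zero_left]

theorem lor_neg_left (x y : Lor n) : lor (-x) y = -lor x y := by
  simpa using lor_smul_left (-1) x y

theorem lor_neg_right (x y : Lor n) : lor x (-y) = -lor x y := by
  rw [lor_comm, lor_neg_left, lor_comm]

theorem lor_sub_left (x x' y : Lor n) : lor (x - x') y = lor x y - lor x' y := by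
  rw [sub_eq_add_neg, lor_add_left, lor_neg_left, sub_eq_add_neg]

theorem lor_sub_right (x y y' : Lor n) : lor x (y - y') = lor x y - lor x y' := by
  rw [lor_comm, lor_sub_left, lor_comm y, lor_comm y']

/-- The Lorentz product as a bilinear form. -/
def lorForm (n : ℕ) : LinearMap.BilinForm ℝ (Lor n) :=
  LinearMap.mk₂ ℝ lor lor_add_left lor_smul_left lor_add_right lor_smul_right

@[simp] theorem lorForm_apply (x y : Lor n) : lorForm n x y = lor x y := rfl

/-- The Lorentz product as a continuous bilinear map. -/
def lorL (n : ℕ) : Lor n →L[ℝ] Lor n →L[ℝ] ℝ := LinearMap.toContinuousBilinearMap (lorForm n)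

@[simp] theorem lorL_apply (x y : Lor n) : lorL n x y = lor x y := rfl

theorem lor_sum_right {ι : Type*} (s : Finset ι) (x : Lor n) (y : ι → Lor n) :
    lor x (∑ i ∈ s, y i) = ∑ i ∈ s, lor x (y i) := map_sum (lorForm n x) y s

theorem lorForm_isRefl : (lorForm n).IsRefl := fun x y h => by
  rw [lorForm_apply] at h ⊢; rw [lor_comm, h]

theorem lorForm_nondegenerate : (lorForm n).Nondegenerate := by
  refine (LinearMap.IsRefl.nondegenerate_iff_separatingLeft lorForm_isRefl).2 ?_
  intro x hx
  ext i
  refine Fin.cases ?_ (fun j => ?_) i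
  · have h := hx (EuclideanSpace.single 0 1)
    simpa [lor] using h
  · have h := hx (EuclideanSpace.single j.succ 1)
    simpa [lor, Pi.single_apply, (Fin.succ_ne_zero j).symm, Fin.succ_inj] using h

/-- The double orthogonal complement is the subspace itself, even if the Lorentz product degenerates
on it. -/
theorem mem_of_orthogonal {W : Submodule ℝ (Lor n)} {v : Lor n}
    (h : ∀ ξ, (∀ w ∈ W, lor ξ w = 0) → lor v ξ = 0) : v ∈ W := by
  rw [← LinearMap.BilinForm.orthogonal_orthogonal lorForm_nondegenerate lorForm_isRefl W]
  intro ξ hξ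
  change lor ξ v = 0
  rw [lor_comm]
  refine h ξ fun w hw => ?_
  rw [lor_comm]; exact hξ w hw

theorem Hyp.sq_eq {p : Lor n} (hp : p ∈ Hyp n) : p 0 ^ 2 = 1 + ∑ i : Fin n, p i.succ ^ 2 := by
  have := hp.1
  simp only [lor] at this
  simp only [sq]
  linarith

/-- Tangent vectors of hyperbolic space are spacelike. -/
theorem lor_self_pos {p w : Lor n} (hp : p ∈ Hyp n) (hw : lor w p = 0) (hw0 : w ≠ 0) :
    0 < lor w w := by
  have h1 : w 0 * p 0 = ∑ i : Fin n, w i.succ * p i.succ := by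
    simp only [lor] at hw; linarith
  -- Cauchy–Schwarz for the spatial parts; orthogonality to `p` bounds the time component of `w` by
  -- the spatial one, strictly because `p 0 ^ 2` exceeds the square of the spatial norm of `p` by
  -- one.
  have h2 := Finset.sum_mul_sq_le_sq_mul_sq Finset.univ (fun i : Fin n => w i.succ)
    (fun i => p i.succ)
  rw [← h1] at h2
  have h3 := Hyp.sq_eq hp
  have hs : lor w w = -(w 0) ^ 2 + ∑ i : Fin n, w i.succ ^ 2 := by
    simp only [lor, sq]
  set s := ∑ i : Fin n, w i.succ ^ 2 with hsdef
  set q := ∑ i : Fin n, p i.succ ^ 2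
  have hs0 : 0 ≤ s := Finset.sum_nonneg fun i _ => sq_nonneg _
  have hq0 : 0 ≤ q := Finset.sum_nonneg fun i _ => sq_nonneg _
  have h4 : w 0 ^ 2 * (1 + q) ≤ s * q := by rw [← h3, ← mul_pow]; exact h2
  rw [hs]
  rcases hs0.eq_or_lt with h | h
  · exfalso
    have h5 : w 0 ^ 2 * (1 + q) ≤ 0 := by rw [← h] at h4; linarith
    have h6 : w 0 = 0 := by
      by_contra hne
      have : 0 < w 0 ^ 2 := by positivity
      nlinarith
    apply hw0
    ext i
    refine Fin.cases h6 (fun j => ?_) i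
    have := (Finset.sum_eq_zero_iff_of_nonneg (fun i _ => sq_nonneg (w (Fin.succ i)))).1 h.symm j
      (Finset.mem_univ _)
    simpa using this
  · by_contra hcon
    have h5 : s ≤ w 0 ^ 2 := by linarith
    nlinarith

theorem lor_self_nonneg {p w : Lor n} (hp : p ∈ Hyp n) (hw : lor w p = 0) : 0 ≤ lor w w := by
  rcases eq_or_ne w 0 with rfl | h
  · rw [lor_zero_left]
  · exact (lor_self_pos hp hw h).le

theorem eq_zero_of_lor_self {p w : Lor n} (hp : p ∈ Hyp n) (hw : lor w p = 0)
    (h : lor w w = 0) : w = 0 := by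
  by_contra h0
  exact (lor_self_pos hp hw h0).ne' h

theorem contDiff_lor : ContDiff ℝ ∞ (fun x : Lor n × Lor n => lor x.1 x.2) :=
  (lorL n).isBoundedBilinearMap.contDiff

theorem fderiv_lor {E : Type*} [NormedAddCommGroup E] [NormedSpace ℝ E] {v w : E → Lor n} {u : E}
    (hv : DifferentiableAt ℝ v u) (hw : DifferentiableAt ℝ w u) (Z : E) :
    fderiv ℝ (fun x => lor (v x) (w x)) u Z =
      lor (fderiv ℝ v u Z) (w u) + lor (v u) (fderiv ℝ w u Z) := by
  have := ContinuousLinearMap.fderiv_of_bilinear (lorL n) hv hw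
  have h := congrArg (fun l => l Z) this
  simp only [lorL_apply] at h
  rw [h]
  simp [add_comm]

theorem deriv_lor {v w : ℝ → Lor n} {t : ℝ} (hv : DifferentiableAt ℝ v t)
    (hw : DifferentiableAt ℝ w t) :
    deriv (fun x => lor (v x) (w x)) t = lor (deriv v t) (w t) + lor (v t) (deriv w t) :=
  fderiv_lor hv hw 1

end Lorentz

/-! ### Calculus in a chart -/

section Charts

open Filter Topology

variable {n d : ℕ} {M : Type*} [TopologicalSpace M] [ChartedSpace (EuclideanSpace ℝ (Fin d)) M]
  [IsManifold (𝓡 d) ∞ M]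
  {V : Type*} [NormedAddCommGroup V] [NormedSpace ℝ V]

local notation "φ" => extChartAt (𝓡 d)

/-- The differential of the inverse of the chart at `p`. -/
def chartFrame (p : M) (w : EuclideanSpace ℝ (Fin d)) :
    EuclideanSpace ℝ (Fin d) →L[ℝ] TangentSpace (𝓡 d) ((φ p).symm w) :=
  mfderiv 𝓘(ℝ, EuclideanSpace ℝ (Fin d)) (𝓡 d) (φ p).symm w

theorem contMDiffAt_chart_symm {p : M} {w : EuclideanSpace ℝ (Fin d)} (hw : w ∈ (φ p).target) :
    ContMDiffAt 𝓘(ℝ, EuclideanSpace ℝ (Fin d)) (𝓡 d) ∞ (φ p).symm w :=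
  (contMDiffOn_extChartAt_symm p).contMDiffAt ((isOpen_extChartAt_target p).mem_nhds hw)

theorem isInvertible_chartFrame {p : M} {w : EuclideanSpace ℝ (Fin d)} (hw : w ∈ (φ p).target) :
    (chartFrame p w).IsInvertible := by
  have := isInvertible_mfderivWithin_extChartAt_symm (I := 𝓡 d) hw
  rw [ModelWithCorners.range_eq_univ, mfderivWithin_univ] at this
  exact this

theorem mfderiv_chartFrame {h : M → V} {p : M} {w : EuclideanSpace ℝ (Fin d)}
    (hw : w ∈ (φ p).target) (hh : MDifferentiableAt (𝓡 d) 𝓘(ℝ, V) h ((φ p).symm w))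
    (Z : EuclideanSpace ℝ (Fin d)) :
    mfderiv (𝓡 d) 𝓘(ℝ, V) h ((φ p).symm w) (chartFrame p w Z) =
      fderiv ℝ (h ∘ (φ p).symm) w Z := by
  rw [← mfderiv_eq_fderiv, mfderiv_comp w hh ((contMDiffAt_chart_symm hw).mdifferentiableAt
    (by simp))]
  rfl

theorem contDiffAt_comp_chart_symm {h : M → V} {p : M} {w : EuclideanSpace ℝ (Fin d)}
    (hw : w ∈ (φ p).target) (hh : ContMDiffAt (𝓡 d) 𝓘(ℝ, V) ∞ h ((φ p).symm w)) :
    ContDiffAt ℝ ∞ (h ∘ (φ p).symm) w :=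
  (ContMDiffAt.comp w hh (contMDiffAt_chart_symm hw)).contDiffAt

/-- The representation of a vector field in the chart at `p`. -/
def chartRep (p : M) (X : ∀ x : M, TangentSpace (𝓡 d) x) (w : EuclideanSpace ℝ (Fin d)) :
    EuclideanSpace ℝ (Fin d) :=
  VectorField.mpullback 𝓘(ℝ, EuclideanSpace ℝ (Fin d)) (𝓡 d) (φ p).symm X w

theorem chartFrame_chartRep {p : M} {w : EuclideanSpace ℝ (Fin d)}
    (hw : w ∈ (φ p).target) (X : ∀ x : M, TangentSpace (𝓡 d) x) :
    chartFrame p w (chartRep p X w) = X ((φ p).symm w) :=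
  (isInvertible_chartFrame hw).self_apply_inverse _

theorem contDiffAt_chartRep {p : M} {w : EuclideanSpace ℝ (Fin d)} (hw : w ∈ (φ p).target)
    {X : ∀ x : M, TangentSpace (𝓡 d) x} (hX : IsSmoothField X) :
    ContDiffAt ℝ ∞ (chartRep p X) w :=
  contMDiffAt_vectorSpace_iff_contDiffAt.1
    (ContMDiffAt.mpullback_vectorField_preimage (n := ∞) (hX _) (contMDiffAt_chart_symm hw)
      (isInvertible_chartFrame hw) le_rfl)

theorem chartRep_mlieBracket {p : M} {w : EuclideanSpace ℝ (Fin d)} (hw : w ∈ (φ p).target)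
    {X Y : ∀ x : M, TangentSpace (𝓡 d) x} (hX : IsSmoothField X) (hY : IsSmoothField Y) :
    chartRep p (VectorField.mlieBracket (𝓡 d) X Y) w =
      VectorField.lieBracket ℝ (chartRep p X) (chartRep p Y) w := by
  have : IsManifold (𝓡 d) (minSmoothness ℝ 2) M := IsManifold.of_le (n := ∞) (by
    rw [minSmoothness_of_isRCLikeNormedField]; exact WithTop.coe_le_coe.2 le_top)
  rw [chartRep, VectorField.mpullback_mlieBracket (n := ∞) ((hX _).mdifferentiableAt (by simp))
    ((hY _).mdifferentiableAt (by simp)) (contMDiffAt_chart_symm hw) (by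
    rw [minSmoothness_of_isRCLikeNormedField]; exact WithTop.coe_le_coe.2 le_top)]
  rw [← VectorField.mlieBracketWithin_univ, VectorField.mlieBracketWithin_eq_lieBracketWithin]
  exact congrFun (VectorField.lieBracketWithin_univ (𝕜 := ℝ) (V := chartRep p X)
    (W := chartRep p Y)) w

theorem push_chartFrame {h : M → Lor n} {p : M} {w : EuclideanSpace ℝ (Fin d)}
    (hw : w ∈ (φ p).target) (hh : MDifferentiableAt (𝓡 d) 𝓘(ℝ, Lor n) h ((φ p).symm w))
    (Z : EuclideanSpace ℝ (Fin d)) :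
    push h ((φ p).symm w) (chartFrame p w Z) = fderiv ℝ (h ∘ (φ p).symm) w Z :=
  mfderiv_chartFrame hw hh Z

theorem push_field_comp {h : M → Lor n} (hh : ContMDiff (𝓡 d) 𝓘(ℝ, Lor n) ∞ h) {p : M}
    {w : EuclideanSpace ℝ (Fin d)} (hw : w ∈ (φ p).target)
    (Y : ∀ x : M, TangentSpace (𝓡 d) x) :
    push h ((φ p).symm w) (Y ((φ p).symm w)) =
      fderiv ℝ (h ∘ (φ p).symm) w (chartRep p Y w) := by
  rw [← push_chartFrame hw ((hh _).mdifferentiableAt (by simp)), chartFrame_chartRep hw]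

theorem contMDiff_push_field {h : M → Lor n} (hh : ContMDiff (𝓡 d) 𝓘(ℝ, Lor n) ∞ h)
    {Y : ∀ x : M, TangentSpace (𝓡 d) x} (hY : IsSmoothField Y) :
    ContMDiff (𝓡 d) 𝓘(ℝ, Lor n) ∞ (fun x => push h x (Y x)) := by
  intro p
  have hp : φ p p ∈ (φ p).target := mem_extChartAt_target p
  have h1 : ContDiffAt ℝ ∞ (fun w => fderiv ℝ (h ∘ (φ p).symm) w (chartRep p Y w)) (φ p p) :=
    ContDiffAt.clm_apply ((contDiffAt_comp_chart_symm hp (hh _)).fderiv_right le_rfl)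
      (contDiffAt_chartRep hp hY)
  have h2 : ContMDiffAt (𝓡 d) 𝓘(ℝ, EuclideanSpace ℝ (Fin d)) ∞ (φ p) p := contMDiffAt_extChartAt
  refine (ContMDiffAt.comp p h1.contMDiffAt h2).congr_of_eventuallyEq ?_
  filter_upwards [extChartAt_source_mem_nhds (I := 𝓡 d) p] with x hx
  have := push_field_comp hh ((φ p).map_source hx) Y
  rw [(φ p).left_inv hx] at this
  exact this

/-- A vector field that is smooth near a point in a chart extends to a global one, up to
multiplication with a cutoff function. -/
theorem exists_field_extension [T2Space M] {p : M} {w₀ : EuclideanSpace ℝ (Fin d)}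
    (hw₀ : w₀ ∈ (φ p).target)
    {Y : EuclideanSpace ℝ (Fin d) → EuclideanSpace ℝ (Fin d)}
    {P : EuclideanSpace ℝ (Fin d) → Prop}
    (hY : ∀ᶠ w in 𝓝 w₀, ContDiffAt ℝ ∞ Y w ∧ P w) :
    ∃ Z : ∀ x : M, TangentSpace (𝓡 d) x, IsSmoothField Z ∧
      (∀ᶠ w in 𝓝 w₀, chartRep p Z w = Y w) ∧ (∀ x, x ∉ (φ p).source → Z x = 0) ∧
      ∀ w ∈ (φ p).target, Z ((φ p).symm w) = 0 ∨
        P w ∧ ∃ c : ℝ, Z ((φ p).symm w) = c • chartFrame p w (Y w) := by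
  set x₀ := (φ p).symm w₀ with hx₀
  have hs : x₀ ∈ (φ p).source := (φ p).map_target hw₀
  obtain ⟨W, hWY, hWo, hW0⟩ := eventually_nhds_iff.1 hY
  have hcont : ContinuousAt (φ p) x₀ := continuousAt_extChartAt' hs
  have hO : (φ p).source ∩ (φ p) ⁻¹' W ∈ 𝓝 x₀ := by
    refine inter_mem (extChartAt_source_mem_nhds' hs) (hcont.preimage_mem_nhds ?_)
    rw [hx₀, (φ p).right_inv hw₀]
    exact hWo.mem_nhds hW0
  obtain ⟨χ, -, hχ⟩ := (SmoothBumpFunction.nhds_basis_tsupport (I := 𝓡 d) x₀).mem_iff.1 hO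
  have hOo : IsOpen ((φ p).source ∩ (φ p) ⁻¹' W) :=
    (continuousOn_extChartAt p).isOpen_inter_preimage (isOpen_extChartAt_source p) hWo
  set Z₀ : ∀ x : M, TangentSpace (𝓡 d) x :=
    VectorField.mpullback (𝓡 d) 𝓘(ℝ, EuclideanSpace ℝ (Fin d)) (φ p) Y with hZ₀
  have hZ₀s : ContMDiffOn (𝓡 d) (𝓡 d).tangent ∞
      (fun x => (⟨x, Z₀ x⟩ : TangentBundle (𝓡 d) M)) ((φ p).source ∩ (φ p) ⁻¹' W) := by
    intro x hx
    refine ContMDiffAt.contMDiffWithinAt ?_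
    refine ContMDiffAt.mpullback_vectorField_preimage (n := ∞) ?_ ?_
      (isInvertible_mfderiv_extChartAt hx.1) le_rfl
    · exact contMDiffAt_vectorSpace_iff_contDiffAt.2 (hWY _ hx.2).1
    · exact contMDiffAt_extChartAt' (by simpa using hx.1)
  have hZw : ∀ w ∈ (φ p).target, Z₀ ((φ p).symm w) = chartFrame p w (Y w) := by
    intro w hw
    have hinv : mfderiv (𝓡 d) 𝓘(ℝ, EuclideanSpace ℝ (Fin d)) (φ p) ((φ p).symm w) ∘L
        chartFrame p w = ContinuousLinearMap.id ℝ _ := by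
      have := mfderiv_extChartAt_comp_mfderivWithin_extChartAt_symm (I := 𝓡 d) hw
      rw [ModelWithCorners.range_eq_univ, mfderivWithin_univ] at this
      exact this
    have h2 : mfderiv (𝓡 d) 𝓘(ℝ, EuclideanSpace ℝ (Fin d)) (φ p) ((φ p).symm w)
        (chartFrame p w (Y w)) = Y w := congrArg (fun l => l (Y w)) hinv
    have h3 : Z₀ ((φ p).symm w) = (mfderiv (𝓡 d) 𝓘(ℝ, EuclideanSpace ℝ (Fin d)) (φ p)
        ((φ p).symm w)).inverse (Y (φ p ((φ p).symm w))) := rfl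
    have h4 := (isInvertible_mfderiv_extChartAt (I := 𝓡 d)
      ((φ p).map_target hw)).inverse_apply_self (chartFrame p w (Y w))
    rw [h2] at h4
    rw [h3, (φ p).right_inv hw]
    exact h4
  refine ⟨(χ : M → ℝ) • Z₀, ?_, ?_, ?_, ?_⟩
  · have := ContMDiffOn.smul_section_of_tsupport (V := TangentSpace (𝓡 d)) (n := ∞)
      (s := Z₀) (χ.contMDiff.contMDiffOn (s := (φ p).source ∩ (φ p) ⁻¹' W)) hOo hχ hZ₀s
    exact this
  · have h1 : ∀ᶠ w in 𝓝 w₀, χ ((φ p).symm w) = 1 :=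
      (contMDiffAt_chart_symm hw₀).continuousAt.eventually χ.eventuallyEq_one
    filter_upwards [h1, (isOpen_extChartAt_target (I := 𝓡 d) p).mem_nhds hw₀] with w hw1 hw2
    have h3 := chartFrame_chartRep hw2 ((χ : M → ℝ) • Z₀)
    have h4 : ((χ : M → ℝ) • Z₀) ((φ p).symm w) = chartFrame p w (Y w) := by
      rw [← hZw w hw2]
      change χ _ • Z₀ _ = _
      rw [hw1, one_smul]
    exact (isInvertible_chartFrame hw2).injective (h3.trans h4)
  · intro x hx
    have : χ x = 0 := by
      by_contra h
      exact hx (hχ (subset_tsupport _ h)).1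
    change χ x • Z₀ x = 0
    rw [this, zero_smul]
  · intro w hw
    by_cases h : χ ((φ p).symm w) = 0
    · left
      change χ _ • Z₀ _ = 0
      rw [h, zero_smul]
    · right
      have := (hχ (subset_tsupport _ h)).2
      rw [Set.mem_preimage, (φ p).right_inv hw] at this
      refine ⟨(hWY w this).2, χ ((φ p).symm w), ?_⟩
      rw [← hZw w hw]; rfl

end Charts

/-! ### The constant subspace of an umbilical conullity -/

section Nullity

open Filter Topology

variable {n d : ℕ} {M : Type*} [TopologicalSpace M] [ChartedSpace (EuclideanSpace ℝ (Fin d)) M]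
  [IsManifold (𝓡 d) ∞ M]

local notation "φ" => extChartAt (𝓡 d)

variable {f : M → Lor n}

theorem lor_push_self (hf : IsHypImmersion d f) (x : M) (X : TangentSpace (𝓡 d) x) :
    lor (push f x X) (f x) = 0 := by
  have hs : MDifferentiableAt (𝓡 d) 𝓘(ℝ, Lor n) f x := (hf.smooth x).mdifferentiableAt (by simp)
  have h1 : HasMFDerivAt (𝓡 d) 𝓘(ℝ, ℝ) (fun y => lor (f y) (f y)) x
      ((fderiv ℝ (fun v : Lor n => lor v v) (f x)).comp (mfderiv (𝓡 d) 𝓘(ℝ, Lor n) f x)) := by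
    have h2 : DifferentiableAt ℝ (fun v : Lor n => lor v v) (f x) :=
      (contDiff_lor.comp (contDiff_id.prodMk contDiff_id)).differentiable (by simp) _
    exact HasMFDerivAt.comp x h2.hasFDerivAt.hasMFDerivAt hs.hasMFDerivAt
  have h3 : HasMFDerivAt (𝓡 d) 𝓘(ℝ, ℝ) (fun y => lor (f y) (f y)) x
      (0 : TangentSpace (𝓡 d) x →L[ℝ] ℝ) := by
    have : (fun y => lor (f y) (f y)) = fun _ => (-1 : ℝ) := funext fun y => (hf.mem y).1
    rw [this]; exact hasMFDerivAt_const _ _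
  have h4 := congrArg (fun l => l X) (hasMFDerivAt_unique h1 h3)
  have h5 : fderiv ℝ (fun v : Lor n => lor v v) (f x) (push f x X) = 0 := h4
  rw [fderiv_lor (v := fun v => v) (w := fun v => v) differentiableAt_id differentiableAt_id] at h5
  simp only [fderiv_fun_id, ContinuousLinearMap.coe_id', id] at h5
  rw [lor_comm (f x)] at h5
  linarith

theorem smul_add_push_eq_zero (hf : IsHypImmersion d f) {x : M} {a : ℝ}
    {X : TangentSpace (𝓡 d) x} (h : a • f x + push f x X = 0) : a = 0 ∧ X = 0 := by
  have h1 := congrArg (fun v => lor v (f x)) h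
  simp only [lor_add_left, lor_smul_left, lor_push_self hf, (hf.mem x).1, lor_zero_left] at h1
  have ha : a = 0 := by linarith
  refine ⟨ha, hf.injective_push x ?_⟩
  rw [push_zero, ← h, ha, zero_smul, zero_add]

/-- The representation of the immersion in the chart at `p`. -/
abbrev chartMap (f : M → Lor n) (p : M) : EuclideanSpace ℝ (Fin d) → Lor n := f ∘ (φ p).symm

theorem contDiffAt_chartMap (hf : IsHypImmersion d f) {p : M} {w : EuclideanSpace ℝ (Fin d)}
    (hw : w ∈ (φ p).target) : ContDiffAt ℝ ∞ (chartMap f p) w :=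
  contDiffAt_comp_chart_symm hw (hf.smooth _)

theorem push_chart (hf : IsHypImmersion d f) {p : M} {w : EuclideanSpace ℝ (Fin d)}
    (hw : w ∈ (φ p).target) (Z : EuclideanSpace ℝ (Fin d)) :
    push f ((φ p).symm w) (chartFrame p w Z) = fderiv ℝ (chartMap f p) w Z :=
  push_chartFrame hw ((hf.smooth _).mdifferentiableAt (by simp)) Z

theorem lor_fderiv_chartMap (hf : IsHypImmersion d f) {p : M} {w : EuclideanSpace ℝ (Fin d)}
    (hw : w ∈ (φ p).target) (Z : EuclideanSpace ℝ (Fin d)) :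
    lor (fderiv ℝ (chartMap f p) w Z) (chartMap f p w) = 0 := by
  rw [← push_chart hf hw]; exact lor_push_self hf _ _

theorem chartMap_independent (hf : IsHypImmersion d f) {p : M} {w : EuclideanSpace ℝ (Fin d)}
    (hw : w ∈ (φ p).target) (a : ℝ) (X : EuclideanSpace ℝ (Fin d))
    (h : a • chartMap f p w + fderiv ℝ (chartMap f p) w X = 0) : a = 0 ∧ X = 0 := by
  rw [← push_chart hf hw] at h
  obtain ⟨h1, h2⟩ := smul_add_push_eq_zero hf h
  exact ⟨h1, (isInvertible_chartFrame hw).injective (h2.trans (map_zero _).symm)⟩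

theorem push_push_field (hf : IsHypImmersion d f) {p : M} {w : EuclideanSpace ℝ (Fin d)}
    (hw : w ∈ (φ p).target) {Y : ∀ x : M, TangentSpace (𝓡 d) x} (hY : IsSmoothField Y)
    (Z : EuclideanSpace ℝ (Fin d)) :
    push (fun y => push f y (Y y)) ((φ p).symm w) (chartFrame p w Z) =
      fderiv ℝ (fun v => fderiv ℝ (chartMap f p) v (chartRep p Y v)) w Z := by
  rw [push_chartFrame hw ((contMDiff_push_field hf.smooth hY _).mdifferentiableAt (by simp))]
  congr 1
  refine Filter.EventuallyEq.fderiv_eq ?_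
  filter_upwards [(isOpen_extChartAt_target (I := 𝓡 d) p).mem_nhds hw] with v hv
  exact push_field_comp hf.smooth hv Y

theorem push_push_field' (hf : IsHypImmersion d f) {p : M} {w : EuclideanSpace ℝ (Fin d)}
    (hw : w ∈ (φ p).target) {Y : ∀ x : M, TangentSpace (𝓡 d) x} (hY : IsSmoothField Y)
    (Z : EuclideanSpace ℝ (Fin d)) :
    push (fun y => push f y (Y y)) ((φ p).symm w) (chartFrame p w Z) =
      fderiv ℝ (chartMap f p) w (fderiv ℝ (chartRep p Y) w Z) +
      fderiv ℝ (fderiv ℝ (chartMap f p)) w Z (chartRep p Y w) := by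
  rw [push_push_field hf hw hY, fderiv_clm_apply_apply (ContDiffAt.differentiableAt (n := ∞)
    ((contDiffAt_chartMap hf hw).fderiv_right le_rfl) (by simp))
    ((contDiffAt_chartRep hw hY).differentiableAt (by simp))]

/-- The relative nullity in the chart at `p`. -/
def chartNullity (f : M → Lor n) (p : M) (w : EuclideanSpace ℝ (Fin d)) :
    Submodule ℝ (EuclideanSpace ℝ (Fin d)) :=
  (relNullity f ((φ p).symm w)).comap (chartFrame p w).toLinearMap

/-- Normal vectors are the vectors orthogonal to `f` and `f_* T M`, so by nondegeneracy having no
normal component means lying in `tanSpan`. Constant coordinate fields have to be extended to global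
smooth fields, since these are the test fields in `relNullity`. -/
theorem mem_chartNullity [T2Space M] (hf : IsHypImmersion d f) {p : M}
    {w : EuclideanSpace ℝ (Fin d)} (hw : w ∈ (φ p).target) (X : EuclideanSpace ℝ (Fin d)) :
    X ∈ chartNullity f p w ↔
      ∀ Y, fderiv ℝ (fderiv ℝ (chartMap f p)) w X Y ∈ tanSpan (chartMap f p) w := by
  have hnorm : ∀ ξ, ξ ∈ normalSpace (d := d) f ((φ p).symm w) ↔
      ∀ v ∈ tanSpan (chartMap f p) w, lor ξ v = 0 := by
    intro ξ
    constructor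
    · rintro ⟨h1, h2⟩ _ ⟨a, Z, rfl⟩
      rw [lor_add_right, lor_smul_right, ← push_chart hf hw, h2]
      simp only [Function.comp_apply, h1]; ring
    · intro h
      refine ⟨h _ ⟨1, 0, by simp⟩, fun Z => ?_⟩
      obtain ⟨Z, rfl⟩ := (isInvertible_chartFrame hw).surjective Z
      rw [push_chart hf hw]
      exact h _ ⟨0, Z, by simp⟩
  have hsff : ∀ (Y : ∀ x : M, TangentSpace (𝓡 d) x), IsSmoothField Y →
      ∀ ξ ∈ normalSpace (d := d) f ((φ p).symm w),
      sff f ((φ p).symm w) (chartFrame p w X) Y ξ =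
        lor (fderiv ℝ (fderiv ℝ (chartMap f p)) w X (chartRep p Y w)) ξ := by
    intro Y hY ξ hξ
    have h1 := (hnorm ξ).1 hξ
    have h2 : lor (f ((φ p).symm w)) ξ = 0 := by rw [lor_comm]; exact h1 _ ⟨1, 0, by simp⟩
    have h3 : ∀ Z, lor (fderiv ℝ (chartMap f p) w Z) ξ = 0 := fun Z => by
      rw [lor_comm]; exact h1 _ ⟨0, Z, by simp⟩
    rw [sff, covAlong, lor_add_left, lor_smul_left, h2, push_push_field' hf hw hY, lor_add_left,
      h3]
    ring
  constructor
  · intro hX Y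
    refine mem_of_orthogonal fun ξ hξ => ?_
    obtain ⟨Z, hZ, hZY, -⟩ := exists_field_extension hw (Y := fun _ => Y) (P := fun _ => True)
      (Eventually.of_forall fun v => ⟨contDiffAt_const, trivial⟩)
    have h1 := hX Z hZ ξ ((hnorm ξ).2 hξ)
    have h2 := hsff Z hZ ξ ((hnorm ξ).2 hξ)
    rw [hZY.self_of_nhds] at h2
    exact h2.symm.trans h1
  · intro h Y hY ξ hξ
    refine (hsff Y hY ξ hξ).trans ?_
    rw [lor_comm]
    exact (hnorm ξ).1 hξ _ (h _)

/-- The right-hand side is metric by the product rule and torsion-free because `f_* [X, Y]` is the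
commutator of the derivatives of `f_* Y` and `f_* X`. Substituting both facts collapses the Koszul
formula. -/
theorem leviCivita_eq {g : RiemMetric d M} (hf : IsIsometricImmersion g f)
    {X Y Z : ∀ x : M, TangentSpace (𝓡 d) x} (hX : IsSmoothField X) (hY : IsSmoothField Y)
    (hZ : IsSmoothField Z) (x : M) :
    leviCivita g X Y Z x = lor (push (fun y => push f y (Y y)) x (X x)) (push f x (Z x)) := by
  have hf' := hf.toIsHypImmersion
  have hp : φ x x ∈ (φ x).target := mem_extChartAt_target x
  have hx : (φ x).symm (φ x x) = x := extChartAt_to_inv x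
  have hD' : ∀ y, (φ x).symm (φ x x) = y → ∀ A B C : ∀ x : M, TangentSpace (𝓡 d) x,
      IsSmoothField B → IsSmoothField C →
      mfderiv (𝓡 d) 𝓘(ℝ, ℝ) (fun y => g.inner y (B y) (C y)) y (A y) =
        lor (push (fun y => push f y (B y)) y (A y)) (push f y (C y)) +
        lor (push f y (B y)) (push (fun y => push f y (C y)) y (A y)) := by
    rintro _ rfl A B C hB hC
    have e : (fun y => g.inner y (B y) (C y)) =
        fun y => lor (push f y (B y)) (push f y (C y)) := funext fun y => hf.isometric y _ _
    have sB := contMDiff_push_field hf'.smooth hB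
    have sC := contMDiff_push_field hf'.smooth hC
    have hs : ContMDiff (𝓡 d) 𝓘(ℝ, ℝ) ∞
        (fun y => lor (push f y (B y)) (push f y (C y))) :=
      contDiff_lor.contMDiff.comp (sB.prodMk_space sC)
    have h1 := mfderiv_chartFrame (p := x) hp ((hs _).mdifferentiableAt (by simp))
      (chartRep x A (φ x x))
    rw [chartFrame_chartRep hp] at h1
    have h2 := fderiv_lor
      ((contDiffAt_comp_chart_symm hp (sB _)).differentiableAt (by simp))
      ((contDiffAt_comp_chart_symm hp (sC _)).differentiableAt (by simp)) (chartRep x A (φ x x))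
    rw [← push_chartFrame hp ((sB _).mdifferentiableAt (by simp)),
      ← push_chartFrame hp ((sC _).mdifferentiableAt (by simp)), chartFrame_chartRep hp] at h2
    rw [e]
    exact h1.trans h2
  have hB' : ∀ y, (φ x).symm (φ x x) = y → ∀ A B : ∀ x : M, TangentSpace (𝓡 d) x,
      IsSmoothField A → IsSmoothField B →
      push f y (VectorField.mlieBracket (𝓡 d) A B y) =
        push (fun y => push f y (B y)) y (A y) - push (fun y => push f y (A y)) y (B y) := by
    rintro _ rfl A B hA hB
    have h1 := push_field_comp hf'.smooth hp (VectorField.mlieBracket (𝓡 d) A B)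
    have h2 := push_push_field' hf' hp hB (chartRep x A (φ x x))
    have h3 := push_push_field' hf' hp hA (chartRep x B (φ x x))
    rw [chartFrame_chartRep hp] at h2 h3
    rw [chartRep_mlieBracket hp hA hB, VectorField.lieBracket, map_sub] at h1
    rw [fderiv_symm_of_contDiffAt (contDiffAt_chartMap hf' hp)] at h3
    rw [h1, h2, h3]; abel
  have hD := hD' x hx
  have hB := hB' x hx
  simp only [leviCivita]
  rw [hD X Y Z hY hZ, hD Y X Z hX hZ, hD Z X Y hX hY, hf.isometric, hf.isometric, hf.isometric]
  simp only [indInner]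
  rw [hB X Y hX hY, hB X Z hX hZ, hB Y Z hY hZ]
  simp only [lor_sub_left]
  rw [lor_comm (push f x (Y x)), lor_comm (push f x (X x)), lor_comm (push f x (X x))]
  ring

end Nullity

/-! ### Smooth frames of the relative nullity, in coordinates -/

section FlatFrame

open Filter Topology

variable {E V : Type*} [NormedAddCommGroup E] [NormedSpace ℝ E] [FiniteDimensional ℝ E]
  [NormedAddCommGroup V] [NormedSpace ℝ V] [FiniteDimensional ℝ V]

theorem exists_smooth_nullity_frame {ν : ℕ} {f : E → V} {D : E → Submodule ℝ E} {u₀ : E}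
    (hf : ∀ᶠ u in 𝓝 u₀, ContDiffAt ℝ ∞ f u)
    (hD : ∀ᶠ u in 𝓝 u₀, ∀ X, X ∈ D u ↔ ∀ Y, fderiv ℝ (fderiv ℝ f) u X Y ∈ tanSpan f u)
    (hr : ∀ᶠ u in 𝓝 u₀, Module.finrank ℝ (D u) = ν)
    (hinj : ∀ᶠ u in 𝓝 u₀, ∀ (a : ℝ) X, a • f u + fderiv ℝ f u X = 0 → a = 0 ∧ X = 0) :
    ∃ (r : ℕ) (T : E → ((Fin r → ℝ) →L[ℝ] E)), (∀ᶠ u in 𝓝 u₀, ContDiffAt ℝ ∞ T u) ∧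
      ∀ᶠ u in 𝓝 u₀, ∀ X, X ∈ D u ↔ ∃ x, T u x = X := by
  have hker : ∀ᶠ u in 𝓝 u₀,
      Module.finrank ℝ (LinearMap.ker (nullityMap f u).toLinearMap) = ν := by
    filter_upwards [hD, hr, hinj] with u h1 h2 h3
    rw [finrank_ker_nullityMap h1 h3, h2]
  obtain ⟨R, hRs, -, hR⟩ := exists_smooth_kernel_frame (A := nullityMap f) (u₀ := u₀)
    (hf.mono fun u hu => contDiffAt_nullityMap hu)
    (hker.mono fun u hu => hu.trans hker.self_of_nhds.symm)
  obtain ⟨r, J, -, hJ⟩ := exists_kernel_parametrization (nullityMap f u₀)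
  refine ⟨r, fun u => ContinuousLinearMap.fst ℝ _ _ ∘L R u ∘L J, ?_, ?_⟩
  · filter_upwards [hRs] with u h3
    exact contDiffAt_const.clm_comp (h3.clm_comp contDiffAt_const)
  · filter_upwards [hR, hD, hinj] with u h1 h2 h3 X
    constructor
    · intro hX
      obtain ⟨α, β, h⟩ := exists_coefficients h3 (fderiv ℝ (fderiv ℝ f) u X) ((h2 X).1 hX)
      obtain ⟨x, hx, hxy⟩ := h1.2.2 (X, α, β) ((nullityMap_eq_zero_iff _ _ _).2 h)
      obtain ⟨z, rfl⟩ := (hJ x).1 hx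
      exact ⟨z, by simp [hxy]⟩
    · rintro ⟨x, rfl⟩
      have := h1.2.1 _ ((hJ _).2 ⟨x, rfl⟩)
      rw [nullityMap_eq_zero_iff] at this
      exact (h2 _).2 fun Y => ⟨_, _, this Y⟩

end FlatFrame

/-! ### The conullity, its umbilicity, and local constancy of the conic subspace -/

section Nullity

open Filter Topology

variable {n d : ℕ} {M : Type*} [TopologicalSpace M] [ChartedSpace (EuclideanSpace ℝ (Fin d)) M]
  [IsManifold (𝓡 d) ∞ M]

local notation "φ" => extChartAt (𝓡 d)

variable {f : M → Lor n}

/-- The conullity in the chart at `p`. -/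
def chartConullity (f : M → Lor n) (p : M) (w : EuclideanSpace ℝ (Fin d)) :
    Submodule ℝ (EuclideanSpace ℝ (Fin d)) where
  carrier := {X | ∀ T ∈ chartNullity f p w,
    lor (fderiv ℝ (chartMap f p) w X) (fderiv ℝ (chartMap f p) w T) = 0}
  add_mem' := fun {a b} ha hb T hT => by
    rw [map_add, lor_add_left, ha T hT, hb T hT, add_zero]
  zero_mem' := fun T _ => by rw [map_zero, lor_zero_left]
  smul_mem' := fun c a ha T hT => by rw [map_smul, lor_smul_left, ha T hT, mul_zero]

theorem lor_fderiv_self_eq_zero (hf : IsHypImmersion d f) {p : M} {w : EuclideanSpace ℝ (Fin d)}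
    (hw : w ∈ (φ p).target) {X : EuclideanSpace ℝ (Fin d)}
    (h : lor (fderiv ℝ (chartMap f p) w X) (fderiv ℝ (chartMap f p) w X) = 0) : X = 0 := by
  have h1 := eq_zero_of_lor_self (hf.mem ((φ p).symm w)) (lor_fderiv_chartMap hf hw X) h
  exact (chartMap_independent hf hw 0 X (by rw [h1]; simp)).2

/-- The induced product is definite, so its restriction to any subspace is nondegenerate. -/
theorem isCompl_chartConullity (hf : IsHypImmersion d f) {p : M} {w : EuclideanSpace ℝ (Fin d)}
    (hw : w ∈ (φ p).target) : IsCompl (chartNullity f p w) (chartConullity f p w) := by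
  set B : LinearMap.BilinForm ℝ (EuclideanSpace ℝ (Fin d)) :=
    (lorForm n).comp (fderiv ℝ (chartMap f p) w).toLinearMap
      (fderiv ℝ (chartMap f p) w).toLinearMap with hB
  have hBa : ∀ X Y, B X Y = lor (fderiv ℝ (chartMap f p) w X) (fderiv ℝ (chartMap f p) w Y) :=
    fun X Y => rfl
  have hrefl : B.IsRefl := fun X Y h => by rw [hBa] at h ⊢; rw [lor_comm, h]
  have hnd : (B.restrict (chartNullity f p w)).Nondegenerate := by
    refine (LinearMap.IsRefl.nondegenerate_iff_separatingLeft
      (B := B.restrict (chartNullity f p w)) (fun X Y h => hrefl _ _ h)).2 ?_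
    intro X hX
    exact Subtype.ext (lor_fderiv_self_eq_zero hf hw (hX X))
  have h := LinearMap.BilinForm.isCompl_orthogonal_of_restrict_nondegenerate hrefl hnd
  convert h using 1
  ext X
  constructor
  · intro hX T hT
    exact hrefl _ _ (hX T hT)
  · intro hX T hT
    exact hrefl _ _ (hX T hT)

theorem finrank_chartNullity {p : M} {w : EuclideanSpace ℝ (Fin d)} (hw : w ∈ (φ p).target) :
    Module.finrank ℝ (chartNullity f p w) =
      Module.finrank ℝ (relNullity (d := d) f ((φ p).symm w)) := by
  obtain ⟨e, he⟩ := isInvertible_chartFrame hw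
  have h : chartNullity f p w =
      (relNullity (d := d) f ((φ p).symm w)).map e.symm.toLinearEquiv.toLinearMap := by
    ext X
    constructor
    · intro hX
      refine ⟨chartFrame p w X, hX, ?_⟩
      rw [← he]; exact e.symm_apply_apply X
    · rintro ⟨Y, hY, rfl⟩
      have : chartFrame p w (e.symm Y) = Y := by rw [← he]; exact e.apply_symm_apply Y
      change chartFrame p w (e.symm Y) ∈ relNullity f ((φ p).symm w)
      rwa [this]
  rw [h]
  exact LinearEquiv.finrank_map_eq e.symm.toLinearEquiv _

variable [T2Space M]

/-- Vectors of the conullity extend to smooth local sections. -/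
theorem exists_chartConullity_extension (hf : IsHypImmersion d f) {ν : ℕ}
    (hnull : ∀ x : M, Module.finrank ℝ (relNullity (d := d) f x) = ν) {p : M}
    {w : EuclideanSpace ℝ (Fin d)} (hw : w ∈ (φ p).target) {X : EuclideanSpace ℝ (Fin d)}
    (hX : X ∈ chartConullity f p w) :
    ∃ Y : EuclideanSpace ℝ (Fin d) → EuclideanSpace ℝ (Fin d), Y w = X ∧
      ∀ᶠ v in 𝓝 w, ContDiffAt ℝ ∞ Y v ∧ Y v ∈ chartConullity f p v := by
  have htarget := (isOpen_extChartAt_target (I := 𝓡 d) p).mem_nhds hw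
  have hfs : ∀ᶠ v in 𝓝 w, ContDiffAt ℝ ∞ (chartMap f p) v := by
    filter_upwards [htarget] with v hv using contDiffAt_chartMap hf hv
  obtain ⟨r, T, hTs, hT⟩ := exists_smooth_nullity_frame (ν := ν) (D := chartNullity f p) hfs
    (by filter_upwards [htarget] with v hv using mem_chartNullity hf hv)
    (by filter_upwards [htarget] with v hv using (finrank_chartNullity hv).trans (hnull _))
    (by filter_upwards [htarget] with v hv using chartMap_independent hf hv)
  -- The conullity is the kernel of the pairing with a smooth frame of the nullity. Its dimension is
  -- constantly `d - ν`, so it has smooth frames as well.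
  set A : EuclideanSpace ℝ (Fin d) → (EuclideanSpace ℝ (Fin d) →L[ℝ] ((Fin r → ℝ) →L[ℝ] ℝ)) :=
    fun v => ((ContinuousLinearMap.compL ℝ (Fin r → ℝ) (Lor n) ℝ).flip
      (fderiv ℝ (chartMap f p) v ∘L T v)) ∘L (lorL n ∘L fderiv ℝ (chartMap f p) v) with hA
  have hAa : ∀ v Z x, A v Z x =
      lor (fderiv ℝ (chartMap f p) v Z) (fderiv ℝ (chartMap f p) v (T v x)) := fun v Z x => by
    simp [hA]
  have hAs : ∀ᶠ v in 𝓝 w, ContDiffAt ℝ ∞ A v := by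
    filter_upwards [hfs, hTs] with v h1 h2
    have h3 : ContDiffAt ℝ ∞ (fderiv ℝ (chartMap f p)) v := h1.fderiv_right le_rfl
    exact (contDiffAt_const.clm_apply (h3.clm_comp h2)).clm_comp (contDiffAt_const.clm_comp h3)
  have hAk : ∀ᶠ v in 𝓝 w, ∀ Z, A v Z = 0 ↔ Z ∈ chartConullity f p v := by
    filter_upwards [hT] with v h1 Z
    constructor
    · intro h S hS
      obtain ⟨x, rfl⟩ := (h1 S).1 hS
      rw [← hAa, h]; rfl
    · intro h
      ext x
      rw [hAa]
      exact h _ ((h1 _).2 ⟨x, rfl⟩)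
  have hrank : ∀ᶠ v in 𝓝 w, Module.finrank ℝ (LinearMap.ker (A v).toLinearMap) = d - ν := by
    filter_upwards [hAk, htarget] with v h1 hv
    have h2 : LinearMap.ker (A v).toLinearMap = chartConullity f p v := by
      ext Z; exact h1 Z
    have h3 := Submodule.finrank_add_eq_of_isCompl (isCompl_chartConullity hf hv)
    rw [finrank_chartNullity hv, hnull, finrank_euclideanSpace_fin] at h3
    rw [h2]; omega
  obtain ⟨R, hRs, hR0, hR⟩ := exists_smooth_kernel_frame hAs
    (hrank.mono fun v hv => hv.trans hrank.self_of_nhds.symm)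
  refine ⟨fun v => R v X, by simp [hR0], ?_⟩
  filter_upwards [hRs, hR, hAk] with v h1 h2 h3
  exact ⟨h1.clm_apply contDiffAt_const,
    (h3 _).1 (h2.2.1 X ((hAk.self_of_nhds X).2 hX))⟩

/-- In a chart, the second derivative of the immersion reads off the umbilicity of the conullity. -/
theorem lor_fderiv_of_umbilical {g : RiemMetric d M} (hf : IsIsometricImmersion g f) {ν : ℕ}
    (hnull : ∀ x : M, Module.finrank ℝ (relNullity (d := d) f x) = ν)
    {δ : ∀ x : M, TangentSpace (𝓡 d) x}
    (humb : ∀ X Y T : ∀ x : M, TangentSpace (𝓡 d) x,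
      IsOrthSection g (relNullity f) X → IsOrthSection g (relNullity f) Y →
        IsSection (relNullity f) T →
        ∀ x, leviCivita g X Y T x = g.inner x (X x) (Y x) * g.inner x (δ x) (T x)) {p : M}
    {w : EuclideanSpace ℝ (Fin d)} (hw : w ∈ (φ p).target)
    {T : EuclideanSpace ℝ (Fin d) → EuclideanSpace ℝ (Fin d)}
    (hT : ∀ᶠ v in 𝓝 w, ContDiffAt ℝ ∞ T v) (hTD : ∀ᶠ v in 𝓝 w, T v ∈ chartNullity f p v)
    {X Y : EuclideanSpace ℝ (Fin d)} (hX : X ∈ chartConullity f p w)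
    (hY : Y ∈ chartConullity f p w) :
    lor (fderiv ℝ (fun v => fderiv ℝ (chartMap f p) v (T v)) w X) (fderiv ℝ (chartMap f p) w Y) =
      -(lor (fderiv ℝ (chartMap f p) w X) (fderiv ℝ (chartMap f p) w Y) *
        lor (fderiv ℝ (chartMap f p) w (chartRep p δ w)) (fderiv ℝ (chartMap f p) w (T w))) := by
  have hf' := hf.toIsHypImmersion
  obtain ⟨T', hT's, hT'w, hT'0, hT'⟩ := exists_field_extension hw (hT.and hTD)
  have hext : ∀ Z ∈ chartConullity f p w, ∃ (Z' : EuclideanSpace ℝ (Fin d) →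
      EuclideanSpace ℝ (Fin d)) (Z'' : ∀ x : M, TangentSpace (𝓡 d) x), Z' w = Z ∧
      (∀ᶠ v in 𝓝 w, ContDiffAt ℝ ∞ Z' v ∧ Z' v ∈ chartConullity f p v) ∧
      IsOrthSection g (relNullity f) Z'' ∧ ∀ᶠ v in 𝓝 w, chartRep p Z'' v = Z' v := by
    intro Z hZ
    obtain ⟨Z', h1, h2⟩ := exists_chartConullity_extension hf' hnull hw hZ
    obtain ⟨Z'', h3, h4, h5, h6⟩ := exists_field_extension hw h2
    refine ⟨Z', Z'', h1, h2, ⟨h3, fun x S hS => ?_⟩, h4⟩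
    by_cases hx : x ∈ (φ p).source
    · obtain ⟨v, hv, rfl⟩ : ∃ v ∈ (φ p).target, (φ p).symm v = x :=
        ⟨φ p x, (φ p).map_source hx, (φ p).left_inv hx⟩
      rcases h6 v hv with h | ⟨h7, c, h8⟩
      · rw [h, map_zero]; rfl
      · obtain ⟨S, rfl⟩ := (isInvertible_chartFrame hv).surjective S
        rw [h8, hf.isometric]
        simp only [indInner]
        rw [push_smul, push_chart hf' hv, push_chart hf' hv, lor_smul_left, h7 S hS, mul_zero]
    · rw [h5 x hx, map_zero]; rfl
  obtain ⟨X', X'', hX1, hX2, hX3, hX4⟩ := hext X hX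
  obtain ⟨Y', Y'', hY1, hY2, hY3, hY4⟩ := hext Y hY
  have hTsec : IsSection (relNullity f) T' := by
    refine ⟨hT's, fun x => ?_⟩
    by_cases hx : x ∈ (φ p).source
    · obtain ⟨v, hv, rfl⟩ : ∃ v ∈ (φ p).target, (φ p).symm v = x :=
        ⟨φ p x, (φ p).map_source hx, (φ p).left_inv hx⟩
      rcases hT' v hv with h | ⟨h7, c, h8⟩
      · rw [h]; exact zero_mem _
      · rw [h8]; exact Submodule.smul_mem _ _ h7
    · rw [hT'0 x hx]; exact zero_mem _
  have h1 := humb X'' Y'' T' hX3 hY3 hTsec ((φ p).symm w)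
  rw [leviCivita_eq hf hX3.1 hY3.1 hT's, hf.isometric, hf.isometric] at h1
  simp only [indInner] at h1
  rw [← chartFrame_chartRep hw X'', ← chartFrame_chartRep hw Y'', ← chartFrame_chartRep hw T',
    ← chartFrame_chartRep hw δ, push_push_field hf' hw hY3.1, push_chart hf' hw,
    push_chart hf' hw, push_chart hf' hw, push_chart hf' hw, hX4.self_of_nhds, hX1,
    hT'w.self_of_nhds, hY4.self_of_nhds, hY1] at h1
  have h2 : fderiv ℝ (fun v => fderiv ℝ (chartMap f p) v (chartRep p Y'' v)) w =
      fderiv ℝ (fun v => fderiv ℝ (chartMap f p) v (Y' v)) w :=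
    Filter.EventuallyEq.fderiv_eq (hY4.mono fun v hv => by simp only [hv])
  rw [h2] at h1
  have hfd : DifferentiableAt ℝ (fderiv ℝ (chartMap f p)) w := ContDiffAt.differentiableAt
    (n := ∞) ((contDiffAt_chartMap hf' hw).fderiv_right le_rfl) (by simp)
  -- Differentiating the orthogonality of `Y'` and `T` moves the derivative from `Y'` to `T`; this
  -- accounts for the sign in the conclusion.
  have h3 : fderiv ℝ (fun v => lor (fderiv ℝ (chartMap f p) v (Y' v))
      (fderiv ℝ (chartMap f p) v (T v))) w X = 0 := by
    rw [Filter.EventuallyEq.fderiv_eq (f := fun _ => (0 : ℝ))]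
    · simp
    · filter_upwards [hY2, hTD] with v h4 h5 using h4.2 _ h5
  rw [fderiv_lor (hfd.clm_apply (hY2.self_of_nhds.1.differentiableAt (by simp)))
    (hfd.clm_apply (hT.self_of_nhds.differentiableAt (by simp))), hY1, h1] at h3
  rw [lor_comm]
  linarith

/-- The map `T ↦ ⟨δ, T⟩ f + f_* T`. -/
def conicLin (f : M → Lor n) (δ : ∀ x : M, TangentSpace (𝓡 d) x) (x : M) :
    TangentSpace (𝓡 d) x →ₗ[ℝ] Lor n where
  toFun T := lor (push f x (δ x)) (push f x T) • f x + push f x T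
  map_add' S T := by rw [push_add, lor_add_right]; module
  map_smul' a T := by rw [push_smul, lor_smul_right, RingHom.id_apply]; module

/-- The subspace `{⟨δ, T⟩ f + f_* T | T ∈ 𝒟(x)}` of Lorentz space. -/
def conicSpace (f : M → Lor n) (δ : ∀ x : M, TangentSpace (𝓡 d) x) (x : M) :
    Submodule ℝ (Lor n) := (relNullity (d := d) f x).map (conicLin f δ x)

theorem mem_conicSpace {δ : ∀ x : M, TangentSpace (𝓡 d) x} {x : M} {v : Lor n} :
    v ∈ conicSpace f δ x ↔ ∃ T ∈ relNullity (d := d) f x,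
      lor (push f x (δ x)) (push f x T) • f x + push f x T = v := Submodule.mem_map

/-- This is the coordinate result in the chart at `p`, with the functional `T ↦ ⟨δ, T⟩`. What
remains to be checked is its umbilicity hypothesis. -/
theorem conicSpace_eventually_eq {g : RiemMetric d M} (hf : IsIsometricImmersion g f) {ν : ℕ}
    (hν : ν + 2 ≤ d) (hnull : ∀ x : M, Module.finrank ℝ (relNullity (d := d) f x) = ν)
    {δ : ∀ x : M, TangentSpace (𝓡 d) x} (hδ : IsSmoothField δ)
    (humb : ∀ X Y T : ∀ x : M, TangentSpace (𝓡 d) x,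
      IsOrthSection g (relNullity f) X → IsOrthSection g (relNullity f) Y →
        IsSection (relNullity f) T →
        ∀ x, leviCivita g X Y T x = g.inner x (X x) (Y x) * g.inner x (δ x) (T x)) (p : M) :
    ∀ᶠ x in 𝓝 p, conicSpace f δ x = conicSpace f δ p := by
  have hf' := hf.toIsHypImmersion
  have hp : φ p p ∈ (φ p).target := mem_extChartAt_target p
  have htarget := (isOpen_extChartAt_target (I := 𝓡 d) p).mem_nhds hp
  set dd : EuclideanSpace ℝ (Fin d) → (EuclideanSpace ℝ (Fin d) →L[ℝ] ℝ) := fun w =>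
    lorL n (fderiv ℝ (chartMap f p) w (chartRep p δ w)) ∘L fderiv ℝ (chartMap f p) w with hdd
  have hdda : ∀ w T, dd w T = lor (fderiv ℝ (chartMap f p) w (chartRep p δ w))
    (fderiv ℝ (chartMap f p) w T) := fun w T => rfl
  have key := map_conicMap_eventually_eq (ν := ν) (f := chartMap f p) (d := dd)
    (D := chartNullity f p) (D' := chartConullity f p) (u₀ := φ p p)
    (by filter_upwards [htarget] with v hv using contDiffAt_chartMap hf' hv)
    (by
      filter_upwards [htarget] with v hv
      have h3 : ContDiffAt ℝ ∞ (fderiv ℝ (chartMap f p)) v :=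
        (contDiffAt_chartMap hf' hv).fderiv_right le_rfl
      exact (contDiffAt_const.clm_apply (h3.clm_apply (contDiffAt_chartRep hv hδ))).clm_comp h3)
    (by filter_upwards [htarget] with v hv using mem_chartNullity hf' hv)
    (by filter_upwards [htarget] with v hv using (finrank_chartNullity hv).trans (hnull _))
    (by rw [finrank_euclideanSpace_fin]; exact hν)
    (by filter_upwards [htarget] with v hv using chartMap_independent hf' hv)
    (by filter_upwards [htarget] with v hv using (isCompl_chartConullity hf' hv).sup_eq_top)
    (by
      filter_upwards [htarget] with w hw T hT hTD X hX
      have hs := contDiffAt_chartMap hf' hw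
      have d1 : DifferentiableAt ℝ (fderiv ℝ (chartMap f p)) w :=
        ContDiffAt.differentiableAt (n := ∞) (hs.fderiv_right le_rfl) (by simp)
      have h1 := (mem_chartNullity hf' hw (T w)).1 hTD.self_of_nhds X
      rw [fderiv_symm_of_contDiffAt hs] at h1
      have h2 : fderiv ℝ (fun v => fderiv ℝ (chartMap f p) v (T v)) w X +
          dd w (T w) • fderiv ℝ (chartMap f p) w X ∈ tanSpan (chartMap f p) w := by
        rw [fderiv_clm_apply_apply d1 (hT.self_of_nhds.differentiableAt (by simp))]
        refine add_mem (add_mem ⟨0, _, by rw [zero_smul, zero_add]⟩ h1)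
          (Submodule.smul_mem _ _ ⟨0, X, by rw [zero_smul, zero_add]⟩)
      obtain ⟨a, Z, hZ⟩ := h2
      refine ⟨a, Z, ?_, hZ⟩
      -- The vector is tangential, modulo `f`, because `T w` is in the nullity. Umbilicity says that
      -- its tangential part `Z` is orthogonal to the conullity, hence `Z` is in the nullity.
      have h3 : ∀ Y ∈ chartConullity f p w,
          lor (fderiv ℝ (chartMap f p) w Z) (fderiv ℝ (chartMap f p) w Y) = 0 := by
        intro Y hY
        have h4 := congrArg (fun v => lor v (fderiv ℝ (chartMap f p) w Y)) hZ
        simp only [lor_add_left, lor_smul_left] at h4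
        rw [lor_fderiv_of_umbilical hf hnull humb hw hT hTD hX hY, hdda,
          lor_comm (chartMap f p w), lor_fderiv_chartMap hf' hw] at h4
        linarith
      have hZt : Z ∈ chartNullity f p w ⊔ chartConullity f p w :=
        (isCompl_chartConullity hf' hw).sup_eq_top ▸ Submodule.mem_top
      obtain ⟨S, hS, Y, hY, rfl⟩ := Submodule.mem_sup.1 hZt
      have h5 := h3 Y hY
      rw [map_add, lor_add_left, lor_comm, hY S hS, zero_add] at h5
      rw [lor_fderiv_self_eq_zero hf' hw h5, add_zero]
      exact hS)
  have hmap : ∀ w ∈ (φ p).target, (chartNullity f p w).map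
      (conicMap (chartMap f p) dd w).toLinearMap = conicSpace f δ ((φ p).symm w) := by
    intro w hw
    ext v
    rw [mem_conicSpace]
    have hc : ∀ Z, conicMap (chartMap f p) dd w Z = lor (push f ((φ p).symm w)
        (δ ((φ p).symm w))) (push f ((φ p).symm w) (chartFrame p w Z)) • f ((φ p).symm w) +
        push f ((φ p).symm w) (chartFrame p w Z) := by
      intro Z
      rw [push_chart hf' hw, ← chartFrame_chartRep hw δ, push_chart hf' hw]
      rfl
    constructor
    · rintro ⟨Z, hZ, rfl⟩
      exact ⟨_, hZ, (hc Z).symm⟩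
    · rintro ⟨T, hT, rfl⟩
      obtain ⟨Z, rfl⟩ := (isInvertible_chartFrame hw).surjective T
      exact ⟨Z, hT, hc Z⟩
  have hcont : ContinuousAt (φ p) p := continuousAt_extChartAt p
  filter_upwards [hcont.eventually key, extChartAt_source_mem_nhds (I := 𝓡 d) p] with x h1 h2
  rw [hmap _ ((φ p).map_source h2), hmap _ hp, (φ p).left_inv h2, extChartAt_to_inv] at h1
  exact h1

theorem finrank_conicSpace (hf : IsHypImmersion d f) (δ : ∀ x : M, TangentSpace (𝓡 d) x) (x : M) :
    Module.finrank ℝ (conicSpace f δ x) = Module.finrank ℝ (relNullity (d := d) f x) := by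
  have hi : Function.Injective (conicLin f δ x) := by
    rw [injective_iff_map_eq_zero]
    intro T hT
    exact (smul_add_push_eq_zero hf hT).2
  exact (LinearEquiv.finrank_eq (Submodule.equivMapOfInjective _ hi (relNullity f x))).symm

theorem notMem_conicSpace (hf : IsHypImmersion d f) (δ : ∀ x : M, TangentSpace (𝓡 d) x) (x : M) :
    f x ∉ conicSpace f δ x := by
  rw [mem_conicSpace]
  rintro ⟨T, -, hT⟩
  have hT' : lor (push f x (δ x)) (push f x T) • f x + push f x T = f x := hT
  obtain ⟨h1, h2⟩ := smul_add_push_eq_zero hf (x := x)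
    (a := lor (push f x (δ x)) (push f x T) - 1) (X := T) (by
      rw [sub_smul, one_smul, sub_add_eq_add_sub, hT', sub_self])
  rw [h2, push_zero, lor_zero_right] at h1
  norm_num at h1

/-- Once the conic subspace is constant, this recovers the whole distribution from it. The converse
direction holds because `f` and `f_* T M` are independent, so the tangential part of an element of
the conic subspace is unique. -/
theorem mem_relNullity_iff (hf : IsHypImmersion d f) (δ : ∀ x : M, TangentSpace (𝓡 d) x) (x : M)
    (X : TangentSpace (𝓡 d) x) :
    X ∈ relNullity f x ↔ ∃ a : ℝ, push f x X + a • f x ∈ conicSpace f δ x := by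
  constructor
  · intro hX
    exact ⟨lor (push f x (δ x)) (push f x X), mem_conicSpace.2 ⟨X, hX, add_comm _ _⟩⟩
  · rintro ⟨a, h⟩
    obtain ⟨T, hT, h⟩ := mem_conicSpace.1 h
    have h' : lor (push f x (δ x)) (push f x T) • f x + push f x T = push f x X + a • f x := h
    obtain ⟨-, h2⟩ := smul_add_push_eq_zero hf (x := x)
      (a := lor (push f x (δ x)) (push f x T) - a) (X := T + (-1 : ℝ) • X) (by
        rw [push_add, push_smul]
        linear_combination (norm := module) h')
    have h3 : X = T := by
      rw [neg_one_smul, ← sub_eq_add_neg, sub_eq_zero] at h2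
      exact h2.symm
    rwa [h3]

end Nullity

/-! ### The entire functions `cosh √q` and `sinh √q / √q` -/

section HyperbolicFunctions

open Filter Topology

/-- The ratio of consecutive coefficients is at most `1 / (k + 1)`, so the radius of convergence is
infinite. Working with entire functions of `‖t‖²` avoids the singularity of the norm at the origin.
-/
theorem contDiff_ofScalarsSum {c : ℕ → ℝ} (h0 : ∀ k, 0 < c k)
    (h : ∀ k, c (k + 1) * (k + 1) ≤ c k) :
    ContDiff ℝ ∞ (FormalMultilinearSeries.ofScalarsSum c : ℝ → ℝ) := by
  have hr : (FormalMultilinearSeries.ofScalars ℝ c).radius = ⊤ := by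
    refine FormalMultilinearSeries.ofScalars_radius_eq_top_of_tendsto ℝ c
      (Eventually.of_forall fun k => (h0 k).ne') ?_
    refine squeeze_zero (fun k => by positivity) (fun k => ?_)
      (tendsto_one_div_add_atTop_nhds_zero_nat (𝕜 := ℝ))
    rw [Real.norm_of_nonneg (h0 _).le, Real.norm_of_nonneg (h0 _).le,
      div_le_div_iff₀ (h0 k) (by positivity)]
    simpa using h k
  have hb := (FormalMultilinearSeries.ofScalars ℝ c).hasFPowerSeriesOnBall (by rw [hr]; simp)
  have ha := hb.analyticOnNhd
  rw [hr] at ha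
  have : AnalyticOnNhd ℝ (FormalMultilinearSeries.ofScalarsSum c : ℝ → ℝ) Set.univ :=
    fun x _ => ha x (by simp)
  exact this.contDiff

theorem hasSum_ofScalarsSum {c : ℕ → ℝ} {x s : ℝ} (h : HasSum (fun k => c k * x ^ k) s) :
    FormalMultilinearSeries.ofScalarsSum c x = s := by
  rw [FormalMultilinearSeries.ofScalars_sum_eq]
  simpa using h.tsum_eq

/-- The smooth function with `hyC (r ^ 2) = cosh r`. -/
def hyC : ℝ → ℝ := FormalMultilinearSeries.ofScalarsSum fun k => 1 / ((2 * k).factorial : ℝ)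

/-- The smooth function with `r * hyS (r ^ 2) = sinh r`. -/
def hyS : ℝ → ℝ := FormalMultilinearSeries.ofScalarsSum fun k => 1 / ((2 * k + 1).factorial : ℝ)

theorem contDiff_hyC : ContDiff ℝ ∞ hyC := by
  refine contDiff_ofScalarsSum (fun k => by positivity) fun k => ?_
  rw [show 2 * (k + 1) = 2 * k + 1 + 1 by ring, Nat.factorial_succ, Nat.factorial_succ]
  push_cast
  have : (0 : ℝ) < (2 * k).factorial := by positivity
  rw [div_mul_eq_mul_div, div_le_div_iff₀ (by positivity) this]
  have hk : (0 : ℝ) ≤ k := by positivity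
  nlinarith [mul_nonneg hk this.le, mul_nonneg (mul_nonneg hk hk) this.le]

theorem contDiff_hyS : ContDiff ℝ ∞ hyS := by
  refine contDiff_ofScalarsSum (fun k => by positivity) fun k => ?_
  rw [show 2 * (k + 1) + 1 = 2 * k + 1 + 1 + 1 by ring, Nat.factorial_succ (2 * k + 1 + 1),
    Nat.factorial_succ (2 * k + 1)]
  push_cast
  have : (0 : ℝ) < (2 * k + 1).factorial := by positivity
  rw [div_mul_eq_mul_div, div_le_div_iff₀ (by positivity) this]
  have hk : (0 : ℝ) ≤ k := by positivity
  nlinarith [mul_nonneg hk this.le, mul_nonneg (mul_nonneg hk hk) this.le]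

theorem hyC_sq (r : ℝ) : hyC (r ^ 2) = Real.cosh r := by
  refine hasSum_ofScalarsSum ?_
  convert Real.hasSum_cosh r using 2 with k
  rw [← pow_mul]; ring

theorem hyS_sq (r : ℝ) : r * hyS (r ^ 2) = Real.sinh r := by
  rcases eq_or_ne r 0 with rfl | hr
  · simp
  have : hyS (r ^ 2) = Real.sinh r / r := by
    refine hasSum_ofScalarsSum ?_
    have e : (fun k : ℕ => 1 / ((2 * k + 1).factorial : ℝ) * (r ^ 2) ^ k) =
        fun k : ℕ => r ^ (2 * k + 1) / ((2 * k + 1).factorial : ℝ) / r := by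
      funext k
      rw [← pow_mul, pow_succ]; field_simp
    rw [e]
    exact (Real.hasSum_sinh r).div_const r
  rw [this]; field_simp

theorem hyS_zero : hyS 0 = 1 := by
  simp [hyS, FormalMultilinearSeries.ofScalarsSum_zero]

theorem hyC_zero : hyC 0 = 1 := by simpa using hyC_sq 0

theorem hyS_pos {q : ℝ} (hq : 0 ≤ q) : 0 < hyS q := by
  rcases hq.eq_or_lt with rfl | hq
  · simp [hyS_zero]
  have h := hyS_sq (√q)
  rw [Real.sq_sqrt hq.le] at h
  have h1 := Real.sinh_pos_iff.2 (Real.sqrt_pos.2 hq)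
  rw [← h] at h1
  exact (mul_pos_iff_of_pos_left (Real.sqrt_pos.2 hq)).1 h1

theorem hyC_sq_sub {q : ℝ} (hq : 0 ≤ q) : hyC q ^ 2 - q * hyS q ^ 2 = 1 := by
  have h1 := hyS_sq (√q)
  have h2 := hyC_sq (√q)
  rw [Real.sq_sqrt hq] at h1 h2
  rw [h2]
  have := Real.cosh_sq_sub_sinh_sq (√q)
  rw [← h1, mul_pow, Real.sq_sqrt hq] at this
  exact this

theorem one_le_hyC {q : ℝ} (hq : 0 ≤ q) : 1 ≤ hyC q := by
  have h2 := hyC_sq (√q)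
  rw [Real.sq_sqrt hq] at h2
  rw [h2]; exact Real.one_le_cosh _

theorem deriv_hyC {q : ℝ} (hq : 0 < q) : 2 * deriv hyC q = hyS q := by
  have hr := Real.sqrt_pos.2 hq
  have h1 : HasDerivAt (fun r : ℝ => hyC (r ^ 2)) (deriv hyC ((√q) ^ 2) * (2 * √q)) (√q) := by
    have := (contDiff_hyC.differentiable (by simp)).differentiableAt (x := (√q) ^ 2)
    have h := HasDerivAt.comp (h₂ := hyC) (h := fun r : ℝ => r ^ 2) (√q) this.hasDerivAt
      (hasDerivAt_pow 2 (√q))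
    simpa [Function.comp_def] using h
  have h2 : HasDerivAt (fun r : ℝ => hyC (r ^ 2)) (Real.sinh (√q)) (√q) := by
    simp only [hyC_sq]; exact Real.hasDerivAt_cosh _
  have h3 := h1.unique h2
  rw [← hyS_sq, Real.sq_sqrt hq.le] at h3
  have : √q * (2 * deriv hyC q - hyS q) = 0 := by linear_combination h3
  rcases mul_eq_zero.1 this with h | h
  · exact absurd h hr.ne'
  · linarith

theorem deriv_hyS {q : ℝ} (hq : 0 ≤ q) : 2 * q * deriv hyS q + hyS q = hyC q := by
  have h1 : HasDerivAt (fun r : ℝ => r * hyS (r ^ 2))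
      (1 * hyS ((√q) ^ 2) + √q * (deriv hyS ((√q) ^ 2) * (2 * √q))) (√q) := by
    have := (contDiff_hyS.differentiable (by simp)).differentiableAt (x := (√q) ^ 2)
    have h := HasDerivAt.comp (h₂ := hyS) (h := fun r : ℝ => r ^ 2) (√q) this.hasDerivAt
      (hasDerivAt_pow 2 (√q))
    have := HasDerivAt.fun_mul (hasDerivAt_id' (√q)) h
    simpa [Function.comp_def] using this
  have h2 : HasDerivAt (fun r : ℝ => r * hyS (r ^ 2)) (Real.cosh (√q)) (√q) := by
    simp only [hyS_sq]; exact Real.hasDerivAt_sinh _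
  have h3 := h1.unique h2
  rw [← hyC_sq, Real.sq_sqrt hq] at h3
  have h4 := Real.sq_sqrt hq
  linear_combination h3 - 2 * deriv hyS q * h4

end HyperbolicFunctions

/-! ### Cones over the models -/

section ConeAlgebra

variable {n ν : ℕ}

local notation "⟪" x ", " y "⟫" => inner ℝ x y

/-- At `q = 0` the quotient in `hexp` has the value `0 / 0 = 0`, whereas `hyS 0 = 1`; the two agree
only because they multiply `w = 0`. In Lorentz space this vanishing has to be assumed, since `w`
could be null. -/
theorem hexp_eq {p w : Lor n} {q : ℝ} (h : lor w w = q) (hq : 0 ≤ q) (h0 : q = 0 → w = 0) :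
    hexp p w = hyC q • p + hyS q • w := by
  rw [hexp, h]
  have h1 := hyS_sq (√q)
  have h2 := hyC_sq (√q)
  rw [Real.sq_sqrt hq] at h1 h2
  rw [h2]
  congr 1
  rcases eq_or_ne q 0 with hq0 | hq0
  · simp [h0 hq0]
  · rw [← h1, mul_div_cancel_left₀]
    exact fun h => hq0 ((Real.sqrt_eq_zero hq).1 h)

theorem lor_mul_self_lt {p y : Lor n} (hp : p ∈ Hyp n) (hy : y ∈ Hyp n) : lor p y < 0 := by
  have h2 := Finset.sum_mul_sq_le_sq_mul_sq Finset.univ (fun i : Fin n => p i.succ)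
    (fun i => y i.succ)
  have hp2 := Hyp.sq_eq hp
  have hy2 := Hyp.sq_eq hy
  have hpy := mul_pos hp.2 hy.2
  have h : (∑ i : Fin n, p i.succ * y i.succ) < p 0 * y 0 := by
    refine lt_of_pow_lt_pow_left₀ 2 hpy.le (lt_of_le_of_lt h2 ?_)
    rw [mul_pow, hp2, hy2]
    have : 0 ≤ ∑ i : Fin n, p i.succ ^ 2 := Finset.sum_nonneg fun i _ => sq_nonneg _
    have : 0 ≤ ∑ i : Fin n, y i.succ ^ 2 := Finset.sum_nonneg fun i _ => sq_nonneg _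
    nlinarith
  simp only [lor]; linarith

/-- The two sheets of the hyperboloid are distinguished by the sign of the product with a point of
the upper one. This test replaces the explicit time coordinate in all later constructions. -/
theorem mem_Hyp_of_lor_neg {p y : Lor n} (hp : p ∈ Hyp n) (hy : lor y y = -1)
    (h : lor p y < 0) : y ∈ Hyp n := by
  refine ⟨hy, ?_⟩
  rcases lt_trichotomy (y 0) 0 with h0 | h0 | h0
  · have : -y ∈ Hyp n := ⟨by rw [lor_neg_left, lor_neg_right, neg_neg, hy], by simpa using h0⟩
    have := lor_mul_self_lt hp this
    rw [lor_neg_right] at this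
    linarith
  · exfalso
    have : 0 ≤ ∑ i : Fin n, y i.succ * y i.succ := Finset.sum_nonneg fun i _ => mul_self_nonneg _
    simp only [lor, h0] at hy
    linarith
  · exact h0

/-- The functions `φ(t) = cosh ‖t‖ + (sinh ‖t‖ / ‖t‖) ⟨a, t⟩`. -/
def coneFactor (a t : EuclideanSpace ℝ (Fin ν)) : ℝ := hyC (‖t‖ ^ 2) + hyS (‖t‖ ^ 2) * ⟪a, t⟫

/-- The height functions of a point of a generalized cone: `Θ(t) = cosh ‖t‖ a + (sinh ‖t‖ / ‖t‖) t`. -/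
def heights (a t : EuclideanSpace ℝ (Fin ν)) : EuclideanSpace ℝ (Fin ν) :=
  hyC (‖t‖ ^ 2) • a + hyS (‖t‖ ^ 2) • t

/-- A linear parametrization `κ` of a subspace of Lorentz space which turns into an orthonormal frame
`κ t + ⟨a, t⟩ z` after projection to the tangent space at `z`. -/
def IsConeFrame (a : EuclideanSpace ℝ (Fin ν)) (κ : EuclideanSpace ℝ (Fin ν) →L[ℝ] Lor n) : Prop :=
  ∀ s t, lor (κ s) (κ t) = ⟪s, t⟫ - ⟪a, s⟫ * ⟪a, t⟫

/-- The umbilical submanifold `{z ∈ ℍⁿ | ⟨z, κ t⟩ = ⟨a, t⟩ for all t}`. -/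
def umbSet (a : EuclideanSpace ℝ (Fin ν)) (κ : EuclideanSpace ℝ (Fin ν) →L[ℝ] Lor n) :
    Set (Lor n) := {z | z ∈ Hyp n ∧ ∀ t, lor z (κ t) = ⟪a, t⟫}

/-- The normal frame of `umbSet a κ`. -/
def normalVec (a : EuclideanSpace ℝ (Fin ν)) (κ : EuclideanSpace ℝ (Fin ν) →L[ℝ] Lor n) (z : Lor n)
    (t : EuclideanSpace ℝ (Fin ν)) : Lor n := κ t + ⟪a, t⟫ • z

/-- The generalized cone map. -/
def coneMap (a : EuclideanSpace ℝ (Fin ν)) (κ : EuclideanSpace ℝ (Fin ν) →L[ℝ] Lor n) (z : Lor n)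
    (t : EuclideanSpace ℝ (Fin ν)) : Lor n := coneFactor a t • z + hyS (‖t‖ ^ 2) • κ t

variable {a : EuclideanSpace ℝ (Fin ν)} {κ : EuclideanSpace ℝ (Fin ν) →L[ℝ] Lor n} {z : Lor n}

theorem lor_normalVec (hκ : IsConeFrame a κ) (hz : z ∈ umbSet a κ) (s t : EuclideanSpace ℝ (Fin ν)) :
    lor (normalVec a κ z s) (normalVec a κ z t) = ⟪s, t⟫ := by
  simp only [normalVec, lor_add_left, lor_add_right, lor_smul_left, lor_smul_right, hκ s t,
    hz.1.1, hz.2, lor_comm _ z]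
  ring

theorem lor_normalVec_base (hz : z ∈ umbSet a κ) (t : EuclideanSpace ℝ (Fin ν)) :
    lor (normalVec a κ z t) z = 0 := by
  rw [normalVec, lor_add_left, lor_smul_left, hz.1.1, lor_comm, hz.2]
  ring

theorem coneMap_eq (z : Lor n) (t : EuclideanSpace ℝ (Fin ν)) :
    coneMap a κ z t = hyC (‖t‖ ^ 2) • z + hyS (‖t‖ ^ 2) • normalVec a κ z t := by
  simp only [coneMap, normalVec, coneFactor]; module

theorem hexp_normalVec (hκ : IsConeFrame a κ) (hz : z ∈ umbSet a κ)
    (t : EuclideanSpace ℝ (Fin ν)) : hexp z (normalVec a κ z t) = coneMap a κ z t := by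
  rw [coneMap_eq]
  refine hexp_eq (by rw [lor_normalVec hκ hz, real_inner_self_eq_norm_sq]) (sq_nonneg _) fun h => ?_
  have : t = 0 := by simpa using h
  simp [this, normalVec]

theorem lor_coneMap (hκ : IsConeFrame a κ) (hz : z ∈ umbSet a κ) (s t : EuclideanSpace ℝ (Fin ν)) :
    lor (coneMap a κ z t) (κ s) = ⟪heights a t, s⟫ := by
  simp only [coneMap, lor_add_left, lor_smul_left, hz.2, hκ t s, heights, inner_add_left,
    real_inner_smul_left, coneFactor]
  ring

/-- Recognizing points of the generalized cone by their heights. -/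
theorem mem_umbSet_of_heights (hκ : IsConeFrame a κ) {y : Lor n} (hy : y ∈ Hyp n)
    {t : EuclideanSpace ℝ (Fin ν)} (h : ∀ s, lor y (κ s) = ⟪heights a t, s⟫)
    (hφ : coneFactor a t ≠ 0) :
    (coneFactor a t)⁻¹ • (y - hyS (‖t‖ ^ 2) • κ t) ∈ umbSet a κ := by
  set C := hyC (‖t‖ ^ 2) with hC
  set S := hyS (‖t‖ ^ 2) with hS
  set b := ⟪a, t⟫ with hb
  -- This identity, together with the prescribed heights, gives every product needed for the
  -- recovered base point.
  have hCS : C ^ 2 - ‖t‖ ^ 2 * S ^ 2 = 1 := hyC_sq_sub (sq_nonneg ‖t‖)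
  have hφe : coneFactor a t = C + S * b := rfl
  have h1 : lor y (κ t) = C * b + S * ‖t‖ ^ 2 := by
    rw [h t, heights, inner_add_left, real_inner_smul_left, real_inner_smul_left,
      real_inner_self_eq_norm_sq]
  have h2 : lor (κ t) (κ t) = ‖t‖ ^ 2 - b ^ 2 := by
    rw [hκ t t, real_inner_self_eq_norm_sq]; ring
  refine ⟨mem_Hyp_of_lor_neg hy ?_ ?_, fun s => ?_⟩
  · simp only [lor_smul_left, lor_smul_right, lor_sub_left, lor_sub_right, hy.1, lor_comm _ y, h1, h2]
    have : -1 - S * (C * b + S * ‖t‖ ^ 2) - S * (C * b + S * ‖t‖ ^ 2 - S * (‖t‖ ^ 2 - b ^ 2)) =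
        -(C + S * b) ^ 2 := by linear_combination hCS
    have h3 : (coneFactor a t)⁻¹ * coneFactor a t = 1 := inv_mul_cancel₀ hφ
    rw [← hφe] at this
    linear_combination (coneFactor a t)⁻¹ ^ 2 * this -
      ((coneFactor a t)⁻¹ * coneFactor a t + 1) * h3
  · simp only [lor_smul_right, lor_sub_right, hy.1, h1]
    have : -1 - S * (C * b + S * ‖t‖ ^ 2) = -C * (C + S * b) := by linear_combination hCS
    rw [this, hφe]
    rw [hφe] at hφ
    have : (C + S * b)⁻¹ * (-C * (C + S * b)) = -C := by field_simp
    rw [this]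
    have := one_le_hyC (sq_nonneg ‖t‖)
    linarith
  · rw [lor_smul_left, lor_sub_left, lor_smul_left, h s, hκ t s, heights, inner_add_left,
      real_inner_smul_left, real_inner_smul_left, ← hC, ← hS, ← hb, hφe]
    rw [hφe] at hφ
    have : C * ⟪a, s⟫ + S * ⟪t, s⟫ - S * (⟪t, s⟫ - b * ⟪a, s⟫) = (C + S * b) * ⟪a, s⟫ := by ring
    rw [this]
    field_simp

theorem coneMap_recover {y : Lor n} {t : EuclideanSpace ℝ (Fin ν)} (hφ : coneFactor a t ≠ 0) :
    coneMap a κ ((coneFactor a t)⁻¹ • (y - hyS (‖t‖ ^ 2) • κ t)) t = y := by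
  rw [coneMap, smul_smul, mul_inv_cancel₀ hφ, one_smul, sub_add_cancel]

theorem injective_coneFrame (hκ : IsConeFrame a κ) {q : Lor n} (hq : q ∈ umbSet a κ) :
    Function.Injective κ := by
  rw [injective_iff_map_eq_zero]
  intro t ht
  have h1 := hκ t t
  have h2 := hq.2 t
  rw [ht, lor_zero_right] at h2
  rw [ht, lor_zero_left, ← h2, real_inner_self_eq_norm_sq] at h1
  simpa using h1.symm

theorem contDiff_coneFactor (a : EuclideanSpace ℝ (Fin ν)) : ContDiff ℝ ∞ (coneFactor a) := by
  unfold coneFactor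
  exact (contDiff_hyC.comp (contDiff_norm_sq ℝ)).add
    ((contDiff_hyS.comp (contDiff_norm_sq ℝ)).mul (contDiff_const.inner ℝ contDiff_id))

theorem contDiff_hyS_norm : ContDiff ℝ ∞ fun t : EuclideanSpace ℝ (Fin ν) => hyS (‖t‖ ^ 2) :=
  contDiff_hyS.comp (contDiff_norm_sq ℝ)

theorem contDiff_heights (a : EuclideanSpace ℝ (Fin ν)) : ContDiff ℝ ∞ (heights a) := by
  unfold heights
  exact ((contDiff_hyC.comp (contDiff_norm_sq ℝ)).smul contDiff_const).add
    (contDiff_hyS_norm.smul contDiff_id)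

/-- Pairing the derivative in direction `s` with `t` gives `⟪t, s⟫` times the cone factor, by the
differential equations for `hyC` and `hyS`. If the derivative vanishes, so does `⟪t, s⟫`, and only
`hyS (‖t‖ ^ 2) • s` is left. -/
theorem injective_fderiv_heights {a t : EuclideanSpace ℝ (Fin ν)} (h : coneFactor a t ≠ 0) :
    Function.Injective (fderiv ℝ (heights a) t) := by
  rw [injective_iff_map_eq_zero]
  intro s hs
  have hN : HasFDerivAt (fun t : EuclideanSpace ℝ (Fin ν) => ‖t‖ ^ 2) (2 • innerSL ℝ t) t :=
    (hasStrictFDerivAt_norm_sq t).hasFDerivAt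
  have hC := ((contDiff_hyC.differentiable (by simp)).differentiableAt
    (x := ‖t‖ ^ 2)).hasDerivAt.comp_hasFDerivAt t hN
  have hS := ((contDiff_hyS.differentiable (by simp)).differentiableAt
    (x := ‖t‖ ^ 2)).hasDerivAt.comp_hasFDerivAt t hN
  have hT := (hC.smul (hasFDerivAt_const a t)).add (hS.smul (hasFDerivAt_id t))
  have hT' : HasFDerivAt (heights a) _ t := hT
  rw [hT'.fderiv] at hs
  set C' := deriv hyC (‖t‖ ^ 2)
  set S' := deriv hyS (‖t‖ ^ 2)
  have hs' : (2 * C' * ⟪t, s⟫) • a + (hyS (‖t‖ ^ 2) • s + (2 * S' * ⟪t, s⟫) • t) = 0 := by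
    rw [← hs]
    simp [mul_assoc, mul_left_comm]
  have hl : ⟪t, s⟫ = 0 := by
    rcases eq_or_ne t 0 with rfl | ht
    · simp
    have hq : 0 < ‖t‖ ^ 2 := by positivity
    have h1 := congrArg (fun v => ⟪v, t⟫) hs'
    simp only [inner_add_left, real_inner_smul_left, inner_zero_left,
      real_inner_self_eq_norm_sq, real_inner_comm t s] at h1
    have h2 := deriv_hyC hq
    have h3 := deriv_hyS hq.le
    have : ⟪t, s⟫ * coneFactor a t = 0 := by
      rw [coneFactor, ← h3, ← h2]
      rw [← h2] at h1 
      linear_combination h1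
    exact (mul_eq_zero.1 this).resolve_right h
  rw [hl] at hs'
  simpa [(hyS_pos (sq_nonneg ‖t‖)).ne'] using hs'

end ConeAlgebra

/-! ### Inverting the height functions -/

section HeightsInverse

open Filter Topology

variable {n ν : ℕ}

local notation "⟪" x ", " y "⟫" => inner ℝ x y

theorem exists_heights_inverse {a t₀ : EuclideanSpace ℝ (Fin ν)} (h : coneFactor a t₀ ≠ 0) :
    ∃ (W : Set (EuclideanSpace ℝ (Fin ν))) (T : EuclideanSpace ℝ (Fin ν) → EuclideanSpace ℝ (Fin ν)),
      IsOpen W ∧ heights a t₀ ∈ W ∧ T (heights a t₀) = t₀ ∧ ContDiffOn ℝ ∞ T W ∧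
      ∀ τ ∈ W, heights a (T τ) = τ ∧ coneFactor a (T τ) ≠ 0 := by
  have hder : ∀ t, coneFactor a t ≠ 0 → ∃ L : EuclideanSpace ℝ (Fin ν) ≃L[ℝ]
      EuclideanSpace ℝ (Fin ν), HasFDerivAt (heights a) (L : _ →L[ℝ] _) t := by
    intro t ht
    refine ⟨(LinearEquiv.ofInjectiveEndo (fderiv ℝ (heights a) t : _ →ₗ[ℝ] _)
      (injective_fderiv_heights ht)).toContinuousLinearEquiv, ?_⟩
    have := ((contDiff_heights a).differentiable (by simp)).differentiableAt (x := t)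
    exact this.hasFDerivAt
  obtain ⟨L, hL⟩ := hder t₀ h
  let e := (contDiff_heights a).contDiffAt.toOpenPartialHomeomorph (heights a) hL (by simp)
  have he : ∀ t, e t = heights a t := fun t => rfl
  have hopen : IsOpen {t | coneFactor a t ≠ 0} :=
    isOpen_ne.preimage (contDiff_coneFactor a).continuous
  let e' := e.restrOpen _ hopen
  have ht₀ : t₀ ∈ e'.source :=
    ⟨(contDiff_heights a).contDiffAt.mem_toOpenPartialHomeomorph_source hL (by simp), h⟩
  refine ⟨e'.target, e'.symm, e'.open_target, e'.map_source ht₀, e'.left_inv ht₀, ?_, ?_⟩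
  · intro τ hτ
    obtain ⟨L', hL'⟩ := hder (e'.symm τ) (e'.map_target hτ).2
    exact (e'.contDiffAt_symm hτ hL' (contDiff_heights a).contDiffAt).contDiffWithinAt
  · intro τ hτ
    exact ⟨e'.right_inv hτ, (e'.map_target hτ).2⟩

theorem norm_mul_hyS_lt (t : EuclideanSpace ℝ (Fin ν)) :
    ‖hyS (‖t‖ ^ 2) • t‖ < hyC (‖t‖ ^ 2) := by
  have h1 := hyC_sq_sub (sq_nonneg ‖t‖)
  have h2 := one_le_hyC (sq_nonneg ‖t‖)
  refine lt_of_pow_lt_pow_left₀ 2 (by linarith) ?_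
  rw [norm_smul, mul_pow, Real.norm_eq_abs, sq_abs]
  linarith

/-- By Cauchy–Schwarz the second summand is at least `-sinh ‖t‖`, which is greater than `-cosh ‖t‖`.
-/
theorem coneFactor_pos {a : EuclideanSpace ℝ (Fin ν)} (ha : ‖a‖ ≤ 1)
    (t : EuclideanSpace ℝ (Fin ν)) : 0 < coneFactor a t := by
  have h1 := norm_mul_hyS_lt t
  have h2 := abs_real_inner_le_norm a (hyS (‖t‖ ^ 2) • t)
  have h3 : ‖a‖ * ‖hyS (‖t‖ ^ 2) • t‖ ≤ ‖hyS (‖t‖ ^ 2) • t‖ :=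
    mul_le_of_le_one_left (norm_nonneg _) ha
  have h4 := neg_abs_le ⟪a, hyS (‖t‖ ^ 2) • t⟫
  rw [coneFactor, ← real_inner_smul_right]
  linarith

theorem injective_hyS_smul :
    Function.Injective fun t : EuclideanSpace ℝ (Fin ν) => hyS (‖t‖ ^ 2) • t := by
  intro t t' h
  have hn : ∀ t : EuclideanSpace ℝ (Fin ν), ‖hyS (‖t‖ ^ 2) • t‖ = Real.sinh ‖t‖ := by
    intro t
    rw [norm_smul, Real.norm_of_nonneg (hyS_pos (sq_nonneg _)).le, mul_comm, hyS_sq]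
  have h1 : ‖t‖ = ‖t'‖ := Real.sinh_injective (by rw [← hn, ← hn]; exact congrArg norm h)
  simp only [h1] at h
  exact smul_right_injective _ (hyS_pos (sq_nonneg ‖t'‖)).ne' h

/-- The points `(cosh ‖t‖, (sinh ‖t‖ / ‖t‖) t)` form the upper sheet of a hyperboloid, and the
heights project it along the direction `(1, -a)`. For `‖a‖ ≤ 1` this direction is timelike or null,
and such a line meets the sheet at most once. -/
theorem injective_heights {a : EuclideanSpace ℝ (Fin ν)} (ha : ‖a‖ ≤ 1) :
    Function.Injective (heights a) := by
  have key : ∀ t t', heights a t = heights a t' → hyC (‖t‖ ^ 2) ≤ hyC (‖t'‖ ^ 2) := by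
    intro t t' h
    by_contra! hlt
    set s := hyS (‖t‖ ^ 2) • t with hs
    set s' := hyS (‖t'‖ ^ 2) • t' with hs'
    set C := hyC (‖t‖ ^ 2)
    set C' := hyC (‖t'‖ ^ 2)
    have e1 : C ^ 2 - ‖s‖ ^ 2 = 1 := by
      rw [hs, norm_smul, mul_pow, Real.norm_eq_abs, sq_abs, mul_comm (_ ^ 2)]
      exact hyC_sq_sub (sq_nonneg ‖t‖)
    have e2 : C' ^ 2 - ‖s'‖ ^ 2 = 1 := by
      rw [hs', norm_smul, mul_pow, Real.norm_eq_abs, sq_abs, mul_comm (_ ^ 2)]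
      exact hyC_sq_sub (sq_nonneg ‖t'‖)
    have e3 := norm_mul_hyS_lt t
    have e4 := norm_mul_hyS_lt t'
    have e5 : s' - s = (C - C') • a := by
      have : C • a + s = C' • a + s' := h
      rw [sub_smul, sub_eq_sub_iff_add_eq_add, add_comm, ← this, add_comm]
    have e6 : ‖s' - s‖ ≤ C - C' := by
      rw [e5, norm_smul, Real.norm_of_nonneg (by linarith)]
      exact mul_le_of_le_one_right (by linarith) ha
    have e7 : ‖s‖ - ‖s'‖ ≤ ‖s' - s‖ := by rw [norm_sub_rev]; exact norm_sub_norm_le s s'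
    change ‖s‖ < C at e3
    change ‖s'‖ < C' at e4
    nlinarith [norm_nonneg s, norm_nonneg s']
  intro t t' h
  have hC := le_antisymm (key t t' h) (key t' t h.symm)
  refine injective_hyS_smul ?_
  simp only [heights, hC] at h
  exact add_left_cancel h

theorem exists_hyS_smul (s : EuclideanSpace ℝ (Fin ν)) :
    ∃ t : EuclideanSpace ℝ (Fin ν), hyS (‖t‖ ^ 2) • t = s := by
  rcases eq_or_ne s 0 with rfl | hs
  · exact ⟨0, by simp⟩
  have hs' : 0 < ‖s‖ := norm_pos_iff.2 hs
  refine ⟨(Real.arsinh ‖s‖ / ‖s‖) • s, ?_⟩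
  have h0 : 0 < Real.arsinh ‖s‖ := Real.arsinh_pos_iff.2 hs'
  have hn : ‖(Real.arsinh ‖s‖ / ‖s‖) • s‖ = Real.arsinh ‖s‖ := by
    rw [norm_smul, Real.norm_of_nonneg (by positivity)]; field_simp
  have h1 := hyS_sq (Real.arsinh ‖s‖)
  rw [Real.sinh_arsinh] at h1
  rw [hn, smul_smul]
  have : hyS (Real.arsinh ‖s‖ ^ 2) * (Real.arsinh ‖s‖ / ‖s‖) = 1 := by
    rw [← mul_div_assoc, mul_comm, h1, div_self hs'.ne']
  rw [this, one_smul]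

/-- With `C = cosh ‖t‖` the equation requires `‖τ - C • a‖² = C² - 1`, a quadratic equation for `C`.
In the null case it degenerates to a linear one, whose solution is positive exactly if `⟪a, τ⟫` is.
-/
theorem exists_heights_eq {a : EuclideanSpace ℝ (Fin ν)} (ha : ‖a‖ ≤ 1)
    {τ : EuclideanSpace ℝ (Fin ν)} (hτ : ‖a‖ = 1 → 0 < ⟪a, τ⟫) : ∃ t, heights a t = τ := by
  set A := ⟪a, τ⟫ with hA
  set c := ‖a‖ ^ 2 - 1 with hc
  set N := 1 + ‖τ‖ ^ 2 with hN
  have hN0 : 1 ≤ N := by have := sq_nonneg ‖τ‖; linarith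
  have hc0 : c ≤ 0 := by
    have := norm_nonneg a
    nlinarith
  set f := √(A ^ 2 - c * N) with hf
  have hf2 : f ^ 2 = A ^ 2 - c * N := Real.sq_sqrt (by nlinarith [sq_nonneg A])
  have hf0 : 0 ≤ f := Real.sqrt_nonneg _
  have hAf : 0 < A + f := by
    rcases ha.eq_or_lt with h1 | h1
    · have := hτ h1; linarith
    · have hc' : c < 0 := by
        have := norm_nonneg a
        nlinarith
      have : |A| < f := lt_of_pow_lt_pow_left₀ 2 hf0 (by rw [sq_abs, hf2]; nlinarith)
      have := neg_abs_le A
      linarith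
  -- The root of `c C² - 2 A C + N = 0` is written with the square root in the denominator, so that
  -- the formula also covers `c = 0`.
  set C := N / (A + f) with hC
  have hC0 : 0 < C := by positivity
  have h1 : C * (A + f) = N := by rw [hC]; field_simp
  have h2 : -c * C = f - A := by
    have : (A + f) * (-c * C - (f - A)) = 0 := by linear_combination (-c) * h1 - hf2
    rcases mul_eq_zero.1 this with h | h <;> linarith
  obtain ⟨t, ht⟩ := exists_hyS_smul (τ - C • a)
  refine ⟨t, ?_⟩
  have h3 : ‖τ - C • a‖ ^ 2 = C ^ 2 - 1 := by
    rw [norm_sub_sq_real, norm_smul, mul_pow, Real.norm_eq_abs, sq_abs, real_inner_smul_right,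
      real_inner_comm, ← hA]
    linear_combination (-C) * h2 - h1
  have h4 : hyC (‖t‖ ^ 2) = C := by
    have h5 := hyC_sq_sub (sq_nonneg ‖t‖)
    have h6 : ‖t‖ ^ 2 * hyS (‖t‖ ^ 2) ^ 2 = C ^ 2 - 1 := by
      rw [← h3, ← ht, norm_smul, mul_pow, Real.norm_eq_abs, sq_abs, mul_comm]
    have h7 := one_le_hyC (sq_nonneg ‖t‖)
    exact (pow_left_inj₀ (by linarith) hC0.le two_ne_zero).1 (by linarith)
  rw [heights, h4, ht]; simp

theorem exists_smooth_heights_inverse {a : EuclideanSpace ℝ (Fin ν)} (ha : ‖a‖ ≤ 1) :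
    ∃ T : EuclideanSpace ℝ (Fin ν) → EuclideanSpace ℝ (Fin ν),
      (∀ t, T (heights a t) = t) ∧ ∀ t, ContDiffAt ℝ ∞ T (heights a t) := by
  obtain ⟨T, hT⟩ := (injective_heights ha).hasLeftInverse
  refine ⟨T, hT, fun t => ?_⟩
  obtain ⟨W, T', hW, htW, -, hT', h⟩ := exists_heights_inverse (coneFactor_pos ha t).ne'
  refine (hT'.contDiffAt (hW.mem_nhds htW)).congr_of_eventuallyEq ?_
  filter_upwards [hW.mem_nhds htW] with τ hτ
  conv_lhs => rw [← (h τ hτ).1]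
  exact hT _

/-- The product of a nonzero null vector with a point of hyperbolic space has the sign opposite to
its time component, by Cauchy–Schwarz. In the horospherical case this places all heights of `f` in
the image of the height map. -/
theorem lor_null_pos {q y N : Lor n} (hq : q ∈ Hyp n) (hy : y ∈ Hyp n) (hN : lor N N = 0)
    (h : 0 < lor q N) : 0 < lor y N := by
  have hN2 : N 0 ^ 2 = ∑ i : Fin n, N i.succ ^ 2 := by
    simp only [lor] at hN; simp only [sq]; linarith
  have hN0 : N 0 ≠ 0 := by
    intro h0
    rw [h0] at hN2
    have h1 : ∀ i : Fin n, N i.succ = 0 := by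
      have := (Finset.sum_eq_zero_iff_of_nonneg (fun i _ => sq_nonneg (N (Fin.succ i)))).1
        (show ∑ i : Fin n, N i.succ ^ 2 = 0 by rw [← hN2]; ring)
      intro i
      simpa using this i (Finset.mem_univ i)
    simp [lor, h0, h1] at h
  have key : ∀ p ∈ Hyp n, |∑ i : Fin n, p i.succ * N i.succ| < p 0 * |N 0| := by
    intro p hp
    have h2 := Finset.sum_mul_sq_le_sq_mul_sq Finset.univ (fun i : Fin n => p i.succ)
      (fun i => N i.succ)
    have h3 := Hyp.sq_eq hp
    refine lt_of_pow_lt_pow_left₀ 2 (mul_nonneg hp.2.le (abs_nonneg _)) ?_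
    rw [sq_abs, mul_pow, sq_abs, h3]
    have : 0 < N 0 ^ 2 := by positivity
    rw [← hN2] at h2
    linarith
  have h1 := abs_lt.1 (key q hq)
  have h2 := abs_lt.1 (key y hy)
  rcases lt_or_gt_of_ne hN0 with h0 | h0
  · rw [abs_of_neg h0] at h2
    simp only [lor]; linarith
  · rw [abs_of_pos h0] at h1
    simp only [lor] at h; linarith

end HeightsInverse

/-! ### Orthonormal parametrizations -/

section ConeFrames

variable {n ν : ℕ}

local notation "⟪" x ", " y "⟫" => inner ℝ x y

theorem exists_orthonormal_parametrization {V : Type*} [NormedAddCommGroup V] [NormedSpace ℝ V]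
    [FiniteDimensional ℝ V] (B : LinearMap.BilinForm ℝ V) (hB : ∀ x y, B x y = B y x)
    (W : Submodule ℝ V) (hpos : ∀ w ∈ W, w ≠ 0 → 0 < B w w) {r : ℕ}
    (hr : Module.finrank ℝ W = r) :
    ∃ κ : EuclideanSpace ℝ (Fin r) →L[ℝ] V, (LinearMap.range κ.toLinearMap = W) ∧
      ∀ s t, B (κ s) (κ t) = ⟪s, t⟫ := by
  subst hr
  obtain ⟨v, hv⟩ := LinearMap.BilinForm.exists_orthogonal_basis (B := B.restrict W)
    ⟨fun x y => hB x y⟩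
  have hvpos : ∀ i, 0 < B (v i) (v i) := fun i =>
    hpos _ (v i).2 fun h => v.ne_zero i (Subtype.ext h)
  have hvo : ∀ i j, i ≠ j → B (v i) (v j) = 0 := fun i j hij => hv hij
  let κ' : EuclideanSpace ℝ (Fin (Module.finrank ℝ W)) →ₗ[ℝ] V :=
    ∑ i, ((EuclideanSpace.proj i : _ →L[ℝ] ℝ) : _ →ₗ[ℝ] ℝ).smulRight
      ((√(B (v i) (v i)))⁻¹ • (v i : V))
  have hκ' : ∀ t, κ' t = ∑ i, t i • (√(B (v i) (v i)))⁻¹ • (v i : V) := fun t => by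
    simp [κ']
  have hin : ∀ s t, B (κ' s) (κ' t) = ⟪s, t⟫ := by
    intro s t
    rw [hκ', hκ', PiLp.inner_apply]
    simp only [map_sum, LinearMap.sum_apply, map_smul, LinearMap.smul_apply, smul_eq_mul]
    refine Finset.sum_congr rfl fun i _ => ?_
    rw [Finset.sum_eq_single i]
    · have h1 := Real.mul_self_sqrt (hvpos i).le
      have h2 := (Real.sqrt_pos.2 (hvpos i)).ne'
      set b := √(B (v i) (v i))
      rw [← h1]
      have h3 : b⁻¹ * b = 1 := inv_mul_cancel₀ h2
      simp only [RCLike.inner_apply, conj_trivial]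
      linear_combination (s i * t i * (b⁻¹ * b + 1)) * h3
    · intro j _ hj
      simp [hvo j i hj]
    · simp
  have hinj : Function.Injective κ' := by
    rw [injective_iff_map_eq_zero]
    intro t ht
    have := hin t t
    rw [ht] at this
    simpa using this.symm
  have hle : LinearMap.range κ' ≤ W := by
    rintro _ ⟨t, rfl⟩
    rw [hκ']
    exact W.sum_mem fun i _ => W.smul_mem _ (W.smul_mem _ (v i).2)
  refine ⟨LinearMap.toContinuousLinearMap κ', ?_, hin⟩
  refine Submodule.eq_of_le_of_finrank_eq hle ?_
  rw [show (LinearMap.toContinuousLinearMap κ').toLinearMap = κ' from rfl,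
    LinearMap.finrank_range_of_inj hinj]
  simp

/-- The form `⟨x,y⟩ + ⟨q,x⟩⟨q,y⟩` is the product of the projections to the spacelike hyperplane
`q^⊥`. It is positive definite on `K` because `q ∉ K`, and `κ` is an orthonormal parametrization for
it. No assumption on the causal type of `K` is needed. -/
theorem exists_coneFrame {K : Submodule ℝ (Lor n)} {q : Lor n} (hq : q ∈ Hyp n) (hqK : q ∉ K)
    (hK : Module.finrank ℝ K = ν) :
    ∃ (a : EuclideanSpace ℝ (Fin ν)) (κ : EuclideanSpace ℝ (Fin ν) →L[ℝ] Lor n),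
      IsConeFrame a κ ∧ q ∈ umbSet a κ ∧ LinearMap.range κ.toLinearMap = K := by
  let B : LinearMap.BilinForm ℝ (Lor n) :=
    lorForm n + LinearMap.BilinForm.linMulLin (lorForm n q) (lorForm n q)
  have hBe : ∀ x y, B x y = lor x y + lor q x * lor q y := fun x y => by
    simp [B]
  obtain ⟨κ, hr, hκ⟩ := exists_orthonormal_parametrization B
    (fun x y => by rw [hBe, hBe, lor_comm, mul_comm]) K (fun w hw hw0 => by
      have h1 : lor (w + lor q w • q) q = 0 := by
        rw [lor_add_left, lor_smul_left, hq.1, lor_comm w]; ring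
      have h2 : w + lor q w • q ≠ 0 := by
        intro h
        rcases eq_or_ne (lor q w) 0 with h0 | h0
        · rw [h0, zero_smul, add_zero] at h; exact hw0 h
        · refine hqK ?_
          have : lor q w • q ∈ K := by
            rw [eq_neg_of_add_eq_zero_right h]; exact K.neg_mem hw
          exact (K.smul_mem_iff h0).1 this
      have h3 := lor_self_pos hq h1 h2
      simp only [lor_add_left, lor_add_right, lor_smul_left, lor_smul_right, hq.1,
        lor_comm w q] at h3
      rw [hBe]; linarith) hK
  let a : EuclideanSpace ℝ (Fin ν) := (InnerProductSpace.toDual ℝ _).symm ((lorL n q).comp κ)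
  have ha : ∀ t, ⟪a, t⟫ = lor q (κ t) := fun t => by
    simp [a]
  refine ⟨a, κ, fun s t => ?_, ⟨hq, fun t => (ha t).symm⟩, hr⟩
  rw [ha, ha, ← hκ, hBe]; ring

/-- The vector `a` vanishes exactly if the base point is orthogonal to `K`, and then the umbilical
submanifold would be totally geodesic, with `c = -1`. So `p` itself is the base point unless it is
orthogonal to `K`; in that case the base point is moved within the leaf through `p`. -/
theorem exists_coneFrame_through {K : Submodule ℝ (Lor n)} {p : Lor n} (hp : p ∈ Hyp n)
    (hpK : p ∉ K) (hK : Module.finrank ℝ K = ν) (hν : 1 ≤ ν) :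
    ∃ (a : EuclideanSpace ℝ (Fin ν)) (κ : EuclideanSpace ℝ (Fin ν) →L[ℝ] Lor n) (q : Lor n)
      (t₀ : EuclideanSpace ℝ (Fin ν)), IsConeFrame a κ ∧ q ∈ umbSet a κ ∧
      LinearMap.range κ.toLinearMap = K ∧ a ≠ 0 ∧ coneMap a κ q t₀ = p ∧ coneFactor a t₀ ≠ 0 := by
  by_cases hperp : ∃ k ∈ K, lor p k ≠ 0
  · obtain ⟨k, hk, hpk⟩ := hperp
    obtain ⟨a, κ, hκ, hq, hr⟩ := exists_coneFrame hp hpK hK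
    refine ⟨a, κ, p, 0, hκ, hq, hr, ?_, ?_, ?_⟩
    · rintro rfl
      rw [← hr] at hk
      obtain ⟨t, rfl⟩ := hk
      exact hpk (by simpa using hq.2 t)
    · simp [coneMap, coneFactor, hyC_zero]
    · simp [coneFactor, hyC_zero]
  · push Not at hperp
    obtain ⟨k, hk, hkk⟩ : ∃ k ∈ K, lor k k = 1 := by
      have : Nontrivial K := Module.nontrivial_of_finrank_pos (R := ℝ) (by omega)
      obtain ⟨k, hk0⟩ := exists_ne (0 : K)
      have h1 := lor_self_pos hp (by rw [lor_comm]; exact hperp k k.2) fun h => hk0 (Subtype.ext h)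
      refine ⟨(√(lor (k : Lor n) k))⁻¹ • k, K.smul_mem _ k.2, ?_⟩
      rw [lor_smul_left, lor_smul_right]
      have h2 := Real.mul_self_sqrt h1.le
      have h3 : (√(lor (k : Lor n) k))⁻¹ * √(lor (k : Lor n) k) = 1 :=
        inv_mul_cancel₀ (Real.sqrt_pos.2 h1).ne'
      linear_combination (-(√(lor (k : Lor n) k))⁻¹ ^ 2) * h2 +
        ((√(lor (k : Lor n) k))⁻¹ * √(lor (k : Lor n) k) + 1) * h3
    have hpk := hperp k hk
    have hcs := Real.cosh_sq_sub_sinh_sq 1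
    have hc0 := Real.cosh_pos 1
    -- The point at distance one from `p` on the geodesic with direction `k ∈ K`. It is no longer
    -- orthogonal to `K`, and `p` is reached from it by going back.
    set q : Lor n := Real.cosh 1 • p + Real.sinh 1 • k with hqdef
    have hpq : lor p q = -Real.cosh 1 := by
      rw [hqdef, lor_add_right, lor_smul_right, lor_smul_right, hpk, hp.1]; ring
    have hqk : lor q k = Real.sinh 1 := by
      rw [hqdef, lor_add_left, lor_smul_left, lor_smul_left, hpk, hkk]; ring
    have hqq : q ∈ Hyp n := by
      refine mem_Hyp_of_lor_neg hp ?_ (by linarith)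
      have e : lor (Real.cosh 1 • p + Real.sinh 1 • k) q = -1 := by
        rw [lor_add_left, lor_smul_left, lor_smul_left, hpq, lor_comm k q, hqk]
        linear_combination -hcs
      exact e
    have hqK : q ∉ K := fun h => by
      have := hperp q h
      linarith
    obtain ⟨a, κ, hκ, hq, hr⟩ := exists_coneFrame hqq hqK hK
    obtain ⟨t, ht⟩ : ∃ t, κ t = k := by rw [← hr] at hk; exact hk
    have hat : ⟪a, t⟫ = Real.sinh 1 := by rw [← hq.2, ht, hqk]
    have htt : ‖t‖ ^ 2 = Real.cosh 1 ^ 2 := by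
      have := hκ t t
      rw [ht, hkk, hat, real_inner_self_eq_norm_sq] at this
      linarith
    -- The fibre coordinate of `p` over `q` must have length one; `‖t‖ = cosh 1` is the length of
    -- the projection of `k` to the tangent space at `q`.
    have hn : ‖(-(Real.cosh 1)⁻¹) • t‖ ^ 2 = 1 ^ 2 := by
      rw [norm_smul, mul_pow, htt, norm_neg, norm_inv, Real.norm_of_nonneg hc0.le, ← mul_pow,
        inv_mul_cancel₀ hc0.ne']
    have hC := hyC_sq 1
    have hS := hyS_sq 1
    rw [one_mul] at hS
    have hφ : coneFactor a ((-(Real.cosh 1)⁻¹) • t) = (Real.cosh 1)⁻¹ := by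
      rw [coneFactor, hn, hC, hS, real_inner_smul_right, hat]
      field_simp
      linarith
    refine ⟨a, κ, q, (-(Real.cosh 1)⁻¹) • t, hκ, hq, hr, ?_, ?_, ?_⟩
    · rintro rfl
      rw [inner_zero_left] at hat
      exact (Real.sinh_pos_iff.2 one_pos).ne hat
    · rw [coneMap, hφ, hn, hS, map_smul, ht, hqdef, smul_add, smul_smul, smul_smul, smul_smul,
        inv_mul_cancel₀ hc0.ne', one_smul, add_assoc, ← add_smul]
      have : (Real.cosh 1)⁻¹ * Real.sinh 1 + Real.sinh 1 * -(Real.cosh 1)⁻¹ = 0 := by ring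
      rw [this, zero_smul, add_zero]
    · rw [hφ]; exact inv_ne_zero hc0.ne'

end ConeFrames

/-! ### Immersions into vector spaces -/

section VectorImmersions

open Filter Topology

variable {d : ℕ} {Q : Type*} [TopologicalSpace Q] [ChartedSpace (EuclideanSpace ℝ (Fin d)) Q]
  [IsManifold (𝓡 d) ∞ Q] {V : Type*} [NormedAddCommGroup V] [NormedSpace ℝ V]
  [FiniteDimensional ℝ V]

local notation "φ" => extChartAt (𝓡 d)

/-- A linear left inverse of the differential turns `i`, in the chart at `y₀`, into a map with
identity differential, to which the inverse function theorem applies. -/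
theorem exists_smooth_local_leftInverse {i : Q → V} {y₀ : Q}
    (hi : ContMDiffAt (𝓡 d) 𝓘(ℝ, V) ∞ i y₀)
    (hinj : Function.Injective (mfderiv (𝓡 d) 𝓘(ℝ, V) i y₀)) :
    ∃ L : V → EuclideanSpace ℝ (Fin d), ContDiffAt ℝ ∞ L (i y₀) ∧
      ∀ᶠ y in 𝓝 y₀, L (i y) = φ y₀ y := by
  set w₀ := φ y₀ y₀ with hw₀d
  have hw₀ : w₀ ∈ (φ y₀).target := mem_extChartAt_target y₀
  have hy : (φ y₀).symm w₀ = y₀ := extChartAt_to_inv y₀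
  have hi' : ContMDiffAt (𝓡 d) 𝓘(ℝ, V) ∞ i ((φ y₀).symm w₀) := by rw [hy]; exact hi
  have hh := contDiffAt_comp_chart_symm hw₀ hi'
  have hA : Function.Injective (fderiv ℝ (i ∘ (φ y₀).symm) w₀) := by
    have hc : Function.Injective (mfderiv (𝓡 d) 𝓘(ℝ, V) i ((φ y₀).symm w₀)) := by
      rw [hy]; exact hinj
    intro Z Z' h
    rw [← mfderiv_chartFrame hw₀ (hi'.mdifferentiableAt (by simp)),
      ← mfderiv_chartFrame hw₀ (hi'.mdifferentiableAt (by simp))] at h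
    exact (isInvertible_chartFrame hw₀).injective (hc h)
  obtain ⟨B, hB⟩ := exists_continuous_leftInverse _ hA
  have hk : ContDiffAt ℝ ∞ (B ∘ (i ∘ (φ y₀).symm)) w₀ := B.contDiff.contDiffAt.comp w₀ hh
  have hd : HasFDerivAt (B ∘ (i ∘ (φ y₀).symm))
      ((ContinuousLinearEquiv.refl ℝ (EuclideanSpace ℝ (Fin d)) :
        EuclideanSpace ℝ (Fin d) →L[ℝ] EuclideanSpace ℝ (Fin d))) w₀ := by
    have h1 := B.hasFDerivAt.comp w₀ (hh.differentiableAt (by simp)).hasFDerivAt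
    have h2 : B ∘L fderiv ℝ (i ∘ (φ y₀).symm) w₀ =
        (ContinuousLinearEquiv.refl ℝ (EuclideanSpace ℝ (Fin d)) :
          EuclideanSpace ℝ (Fin d) →L[ℝ] EuclideanSpace ℝ (Fin d)) := by
      ext1 x; exact hB x
    rw [h2] at h1
    exact h1
  let e := hk.toOpenPartialHomeomorph _ hd (by simp)
  have hes : w₀ ∈ e.source := hk.mem_toOpenPartialHomeomorph_source hd (by simp)
  refine ⟨e.symm ∘ B, ?_, ?_⟩
  · have h1 : ContDiffAt ℝ ∞ e.symm (e w₀) := hk.to_localInverse hd (by simp)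
    have h2 : e w₀ = B (i y₀) := by
      change B (i ((φ y₀).symm w₀)) = _
      rw [hy]
    rw [h2] at h1
    exact h1.comp _ B.contDiff.contDiffAt
  · have h1 : ∀ᶠ y in 𝓝 y₀, φ y₀ y ∈ e.source :=
      (continuousAt_extChartAt y₀).eventually (e.open_source.mem_nhds hes)
    filter_upwards [h1, extChartAt_source_mem_nhds (I := 𝓡 d) y₀] with y h1 h2
    have h3 : e (φ y₀ y) = B (i y) := by
      change B (i ((φ y₀).symm (φ y₀ y))) = _
      rw [(φ y₀).left_inv h2]
    change e.symm (B (i y)) = _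
    rw [← h3, e.left_inv h1]

/-- A continuous lift of a smooth map through an immersion is smooth. -/
theorem contMDiffAt_of_comp_immersion {E' H' N : Type*} [NormedAddCommGroup E'] [NormedSpace ℝ E']
    [TopologicalSpace H'] {J : ModelWithCorners ℝ E' H'} [TopologicalSpace N] [ChartedSpace H' N]
    {i : Q → V} {h : N → Q} {x₀ : N} (hi : ContMDiffAt (𝓡 d) 𝓘(ℝ, V) ∞ i (h x₀))
    (hinj : Function.Injective (mfderiv (𝓡 d) 𝓘(ℝ, V) i (h x₀)))
    (hc : ContinuousAt h x₀) (hs : ContMDiffAt J 𝓘(ℝ, V) ∞ (i ∘ h) x₀) :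
    ContMDiffAt J (𝓡 d) ∞ h x₀ := by
  obtain ⟨L, hL, hLe⟩ := exists_smooth_local_leftInverse hi hinj
  rw [contMDiffAt_iff_target]
  refine ⟨hc, ?_⟩
  have h1 : ContMDiffAt J 𝓘(ℝ, EuclideanSpace ℝ (Fin d)) ∞ (L ∘ (i ∘ h)) x₀ :=
    ContMDiffAt.comp x₀ hL.contMDiffAt hs
  refine h1.congr_of_eventuallyEq ?_
  filter_upwards [hc.eventually hLe] with x hx
  exact hx.symm

end VectorImmersions

/-! ### The metric induced by an immersion into hyperbolic space -/

section InducedMetric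

open Filter Topology

variable {n k : ℕ} {S : Type*} [TopologicalSpace S] [ChartedSpace (EuclideanSpace ℝ (Fin k)) S]
  [IsManifold (𝓡 k) ∞ S]

/-- The pullback of the Lorentz product under a linear map. -/
def lorPullback {E : Type*} [NormedAddCommGroup E] [NormedSpace ℝ E] (A : E →L[ℝ] Lor n) :
    E →L[ℝ] E →L[ℝ] ℝ := (lorL n).bilinearComp A A

theorem contDiff_lorPullback {E : Type*} [NormedAddCommGroup E] [NormedSpace ℝ E]
    [FiniteDimensional ℝ E] : ContDiff ℝ ∞ (lorPullback (n := n) (E := E)) := by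
  refine contDiff_clm_apply_iff.2 fun v => contDiff_clm_apply_iff.2 fun w => ?_
  exact contDiff_lor.comp ((contDiff_id.clm_apply contDiff_const).prodMk
    (contDiff_id.clm_apply contDiff_const))

/-- The form has a positive minimum on the compact unit sphere, which bounds the norm on its unit
ball. -/
theorem isVonNBounded_of_pos {E : Type*} [NormedAddCommGroup E] [NormedSpace ℝ E]
    [FiniteDimensional ℝ E] (B : E →L[ℝ] E →L[ℝ] ℝ) (hB : ∀ v, v ≠ 0 → 0 < B v v) :
    Bornology.IsVonNBounded ℝ {v | B v v < 1} := by
  rcases (Metric.sphere (0 : E) 1).eq_empty_or_nonempty with h | h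
  · refine (Bornology.isVonNBounded_singleton (𝕜 := ℝ) (0 : E)).subset fun v _ => ?_
    by_contra hv
    have : (‖v‖⁻¹ • v) ∈ Metric.sphere (0 : E) 1 := by
      have hv' : ‖v‖ ≠ 0 := norm_ne_zero_iff.2 hv
      simp [norm_smul, hv']
    rw [h] at this
    exact this
  · obtain ⟨e, he, hmin⟩ := (isCompact_sphere (0 : E) 1).exists_isMinOn h
      (f := fun v => B v v) (B.continuous.clm_apply continuous_id).continuousOn
    have he1 : ‖e‖ = 1 := by simpa using he
    have hm : 0 < B e e := hB e (by rintro rfl; simp at he1)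
    refine (NormedSpace.isVonNBounded_closedBall ℝ E (√(B e e)⁻¹)).subset fun v hv => ?_
    rw [mem_closedBall_zero_iff]
    refine Real.le_sqrt_of_sq_le ?_
    rcases eq_or_ne v 0 with rfl | hv0
    · simpa using hm.le
    have hv' : 0 < ‖v‖ := norm_pos_iff.2 hv0
    have h1 : B e e ≤ B (‖v‖⁻¹ • v) (‖v‖⁻¹ • v) := hmin (by simp [norm_smul, hv'.ne'])
    simp only [map_smul, smul_apply, smul_eq_mul] at h1
    have h2 : B v v < 1 := hv
    rw [le_inv_comm₀ (by positivity) hm]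
    calc B e e ≤ (‖v‖ ^ 2)⁻¹ * B v v := by rw [← inv_pow, sq, mul_assoc]; exact h1
      _ ≤ (‖v‖ ^ 2)⁻¹ * 1 := by gcongr
      _ = _ := mul_one _

theorem exists_induced_metric {h : S → Lor n} (hh : IsHypImmersion k h) :
    ∃ g : RiemMetric k S, IsIsometricImmersion g h := by
  let B : ∀ x : S, TangentSpace (𝓡 k) x →L[ℝ] TangentSpace (𝓡 k) x →L[ℝ] ℝ := fun x =>
    lorPullback (E := EuclideanSpace ℝ (Fin k)) (mfderiv (𝓡 k) 𝓘(ℝ, Lor n) h x)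
  have hB : ∀ x (X Y : TangentSpace (𝓡 k) x), B x X Y = lor (push h x X) (push h x Y) :=
    fun x X Y => rfl
  have hpos : ∀ x (X : TangentSpace (𝓡 k) x), X ≠ 0 → 0 < B x X X := by
    intro x X hX
    rw [hB]
    refine lor_self_pos (hh.mem x) (lor_push_self hh x X) fun h0 => hX ?_
    exact hh.injective_push x (h0.trans (push_zero h x).symm)
  refine ⟨⟨B, fun x X Y => ?_, hpos, fun x => ?_, fun x₀ => ?_⟩, hh, fun x X Y => rfl⟩
  · exact lor_comm _ _
  · exact isVonNBounded_of_pos (E := EuclideanSpace ℝ (Fin k)) (B x) (hpos x)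
  · rw [Bundle.contMDiffAt_section]
    have hD : ContMDiffAt (𝓡 k) 𝓘(ℝ, EuclideanSpace ℝ (Fin k) →L[ℝ] Lor n) ∞
        (inTangentCoordinates (𝓡 k) 𝓘(ℝ, Lor n) id h (mfderiv (𝓡 k) 𝓘(ℝ, Lor n) h) x₀) x₀ :=
      (hh.smooth x₀).mfderiv_const le_rfl
    have h1 := ContMDiffAt.comp x₀ (contDiff_lorPullback (n := n)
      (E := EuclideanSpace ℝ (Fin k))).contDiffAt.contMDiffAt hD
    refine h1.congr_of_eventuallyEq ?_
    filter_upwards [(trivializationAt (EuclideanSpace ℝ (Fin k)) (TangentSpace (𝓡 k)) x₀).open_baseSet.mem_nhds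
      (FiberBundle.mem_baseSet_trivializationAt' x₀)] with x hx
    have hx' : x ∈ (chartAt (EuclideanSpace ℝ (Fin k)) x₀).source ∩
        (Bundle.Trivial.trivialization S ℝ).baseSet := ⟨hx, Set.mem_univ _⟩
    ext v w
    simp [hom_trivializationAt_apply, ContinuousLinearMap.inCoordinates, inTangentCoordinates, B,
      Bundle.Trivialization.linearMapAt_apply]
    exact congrArg (fun l : EuclideanSpace ℝ (Fin k) →L[ℝ] ℝ => l w) (if_pos hx')

end InducedMetric

/-! ### Models of umbilical submanifolds -/

section Models

open Filter Topology

variable {n ν d : ℕ} {Q : Type*} [TopologicalSpace Q] [ChartedSpace (EuclideanSpace ℝ (Fin d)) Q]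
  [IsManifold (𝓡 d) ∞ Q] {a : EuclideanSpace ℝ (Fin ν)} {κ : EuclideanSpace ℝ (Fin ν) →L[ℝ] Lor n}
  {i : Q → Lor n}

local notation "⟪" x ", " y "⟫" => inner ℝ x y

theorem push_lor_eq {v w : Q → Lor n} {y : Q} (hv : ContMDiff (𝓡 d) 𝓘(ℝ, Lor n) ∞ v)
    (hw : ContMDiff (𝓡 d) 𝓘(ℝ, Lor n) ∞ w) {c : ℝ} (h : ∀ y, lor (v y) (w y) = c)
    (X : TangentSpace (𝓡 d) y) :
    lor (push v y X) (w y) + lor (v y) (push w y X) = 0 := by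
  have hw₀ : extChartAt (𝓡 d) y y ∈ (extChartAt (𝓡 d) y).target := mem_extChartAt_target y
  have key : ∀ X : TangentSpace (𝓡 d) ((extChartAt (𝓡 d) y).symm (extChartAt (𝓡 d) y y)),
      lor (push v _ X) (w ((extChartAt (𝓡 d) y).symm (extChartAt (𝓡 d) y y))) +
        lor (v ((extChartAt (𝓡 d) y).symm (extChartAt (𝓡 d) y y))) (push w _ X) = 0 := by
    intro X
    obtain ⟨Z, rfl⟩ := (isInvertible_chartFrame hw₀).surjective X
    have e1 := contDiffAt_comp_chart_symm hw₀ (hv _)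
    have e2 := contDiffAt_comp_chart_symm hw₀ (hw _)
    rw [push_chartFrame hw₀ ((hv _).mdifferentiableAt (by simp)),
      push_chartFrame hw₀ ((hw _).mdifferentiableAt (by simp))]
    have e3 := fderiv_lor (e1.differentiableAt (by simp)) (e2.differentiableAt (by simp)) Z
    simp only [Function.comp_apply, h, fderiv_fun_const] at e3
    simpa using e3.symm
  rw [extChartAt_to_inv] at key
  exact key X

theorem lor_push_coneFrame (hi : IsHypImmersion d i) (hr : ∀ y, i y ∈ umbSet a κ) (y : Q)
    (X : TangentSpace (𝓡 d) y) (t : EuclideanSpace ℝ (Fin ν)) : lor (push i y X) (κ t) = 0 := by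
  have := push_lor_eq (c := ⟪a, t⟫) hi.smooth (contMDiff_const (c := κ t))
    (fun y => (hr y).2 t) X
  have h3 : push (d := d) (fun _ : Q => κ t) y X = 0 := by
    rw [push, mfderiv_const]; rfl
  rwa [h3, lor_zero_right, add_zero] at this

theorem normalVec_mem (hi : IsHypImmersion d i) (hr : ∀ y, i y ∈ umbSet a κ) (y : Q)
    (t : EuclideanSpace ℝ (Fin ν)) : normalVec a κ (i y) t ∈ normalSpace (d := d) i y := by
  refine ⟨lor_normalVec_base (hr y) t, fun X => ?_⟩
  rw [normalVec, lor_add_left, lor_smul_left, lor_comm, lor_push_coneFrame hi hr, lor_comm,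
    lor_push_self hi]
  ring

/-- The vectors `normalVec a κ (i y) t` form a ν-dimensional subspace of the normal space, which
itself has dimension `n + 1 - (1 + d) = ν`. -/
theorem exists_normalVec_eq (hκ : IsConeFrame a κ) (hd : d + ν = n) (hi : IsHypImmersion d i)
    (hr : ∀ y, i y ∈ umbSet a κ) {y : Q} {ξ : Lor n} (hξ : ξ ∈ normalSpace (d := d) i y) :
    ∃ t, normalVec a κ (i y) t = ξ := by
  let J : ℝ × TangentSpace (𝓡 d) y →ₗ[ℝ] Lor n :=
    (LinearMap.toSpanSingleton ℝ _ (i y)).coprod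
      (mfderiv (𝓡 d) 𝓘(ℝ, Lor n) i y).toLinearMap
  have hJ : ∀ r X, J (r, X) = r • i y + push i y X := fun r X => by
    rfl
  have hJi : Function.Injective J := by
    rw [injective_iff_map_eq_zero]
    rintro ⟨r, X⟩ h
    rw [hJ] at h
    obtain ⟨h1, h2⟩ := smul_add_push_eq_zero hi h
    exact Prod.ext h1 h2
  have hns : normalSpace (d := d) i y = (lorForm n).orthogonal (LinearMap.range J) := by
    ext ξ
    constructor
    · rintro hξ _ ⟨⟨r, X⟩, rfl⟩
      change lor (J (r, X)) ξ = 0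
      rw [hJ, lor_add_left, lor_smul_left, lor_comm, hξ.1, lor_comm, hξ.2]; ring
    · intro hξ
      refine ⟨?_, fun X => ?_⟩
      · have : lor (J (1, 0)) ξ = 0 := hξ _ ⟨_, rfl⟩
        rw [hJ, push_zero, one_smul, add_zero] at this
        rw [lor_comm, this]
      · have : lor (J (0, X)) ξ = 0 := hξ _ ⟨_, rfl⟩
        rw [hJ, zero_smul, zero_add] at this
        rw [lor_comm, this]
  have hdim : Module.finrank ℝ (normalSpace (d := d) i y) = ν := by
    rw [hns, LinearMap.BilinForm.finrank_orthogonal lorForm_nondegenerate,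
      LinearMap.finrank_range_of_inj hJi]
    have : Module.finrank ℝ (ℝ × TangentSpace (𝓡 d) y) = 1 + d := by
      change Module.finrank ℝ (ℝ × EuclideanSpace ℝ (Fin d)) = 1 + d
      simp
    rw [this]
    simp; omega
  let N : EuclideanSpace ℝ (Fin ν) →ₗ[ℝ] Lor n :=
    κ.toLinearMap + (innerSL ℝ a).toLinearMap.smulRight (i y)
  have hN : ∀ t, N t = normalVec a κ (i y) t := fun t => by simp [N, normalVec]
  have hNi : Function.Injective N := by
    rw [injective_iff_map_eq_zero]
    intro t h
    have := lor_normalVec hκ (hr y) t t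
    rw [← hN, h, lor_zero_left] at this
    simpa using this.symm
  have hle : LinearMap.range N ≤ normalSpace (d := d) i y := by
    rintro _ ⟨t, rfl⟩
    rw [hN]; exact normalVec_mem hi hr y t
  have heq := Submodule.eq_of_le_of_finrank_eq hle
    (by rw [LinearMap.finrank_range_of_inj hNi, hdim]; simp)
  rw [← heq] at hξ
  obtain ⟨t, ht⟩ := hξ
  exact ⟨t, by rw [← hN, ht]⟩

/-- A normal vector is `κ t + ⟪a, t⟫ z`, where `κ t` is constant and orthogonal to all tangent
vectors. Only the position vector contributes to the second fundamental form, namely `-⟪a, t⟫ ⟨X,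
Y⟩`; hence the mean curvature vector belongs to `-a`. -/
theorem umbilical_of_mem_umbSet (hκ : IsConeFrame a κ) (hd : d + ν = n) (hi : IsHypImmersion d i)
    (hr : ∀ y, i y ∈ umbSet a κ) (y : Q) :
    ∃ H ∈ normalSpace (d := d) i y, lor H H = ‖a‖ ^ 2 - 1 + 1 ∧
      ∀ (X : TangentSpace (𝓡 d) y) (Y : ∀ z : Q, TangentSpace (𝓡 d) z), IsSmoothField Y →
        ∀ ξ ∈ normalSpace (d := d) i y, sff i y X Y ξ = indInner i y X (Y y) * lor H ξ := by
  have hneg : ∀ t, normalVec a κ (i y) (-t) = -normalVec a κ (i y) t := fun t => by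
    simp only [normalVec, map_neg, inner_neg_right]; module
  refine ⟨normalVec a κ (i y) (-a), normalVec_mem hi hr y _, ?_, ?_⟩
  · rw [lor_normalVec hκ (hr y), inner_neg_neg, real_inner_self_eq_norm_sq]; ring
  · intro X Y hY ξ hξ
    obtain ⟨t, rfl⟩ := exists_normalVec_eq hκ hd hi hr hξ
    have hYs := contMDiff_push_field hi.smooth hY
    have h1 := push_lor_eq (c := 0) (y := y) hYs hi.smooth
      (fun z => lor_push_self hi z (Y z)) X
    have h2 := push_lor_eq (c := 0) (y := y) hYs (contMDiff_const (c := κ t))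
      (fun z => lor_push_coneFrame hi hr z (Y z) t) X
    have h3 : push (d := d) (fun _ : Q => κ t) y X = 0 := by
      rw [push, mfderiv_const]; rfl
    rw [h3, lor_zero_right, add_zero] at h2
    rw [lor_normalVec hκ (hr y), inner_neg_left, indInner, sff, covAlong, lor_add_left,
      lor_smul_left, lor_comm (i y), lor_normalVec_base (hr y), normalVec, lor_add_right,
      lor_smul_right, h2]
    rw [lor_comm (push i y X)]
    linear_combination ⟪a, t⟫ * h1

end Models

/-! ### Complete simply connected umbilical submanifolds -/

/-- The sine function of constant curvature `k` and its primitive. They describe the geodesics of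
all the umbilical submanifolds at once, without separating hyperbolic, flat and spherical ones. -/
theorem exists_generalized_sine (k : ℝ) : ∃ S C : ℝ → ℝ, ContDiff ℝ ∞ S ∧ ContDiff ℝ ∞ C ∧
    (∀ τ, HasDerivAt C (S τ) τ) ∧ (∀ τ, HasDerivAt S (1 - k * C τ) τ) ∧ S 0 = 0 ∧ C 0 = 0 ∧
    (∀ τ, S τ ^ 2 + k * C τ ^ 2 = 2 * C τ) ∧ ∀ τ, 0 ≤ C τ := by
  rcases lt_trichotomy k 0 with hk | rfl | hk
  · obtain ⟨r, hr, rfl⟩ : ∃ r : ℝ, 0 < r ∧ k = -r ^ 2 :=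
      ⟨√(-k), Real.sqrt_pos.2 (by linarith), by rw [Real.sq_sqrt (by linarith)]; ring⟩
    refine ⟨fun τ => Real.sinh (r * τ) / r, fun τ => (Real.cosh (r * τ) - 1) / r ^ 2,
      (Real.contDiff_sinh.comp (contDiff_const.mul contDiff_id)).div_const _,
      ((Real.contDiff_cosh.comp (contDiff_const.mul contDiff_id)).sub contDiff_const).div_const _,
      fun τ => ?_, fun τ => ?_, by simp, by simp, fun τ => ?_, fun τ => ?_⟩
    · have := (((Real.hasDerivAt_cosh (r * τ)).comp τ ((hasDerivAt_id' τ).const_mul r)).sub_const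
        1).div_const (r ^ 2)
      exact this.congr_deriv (by field_simp)
    · have := ((Real.hasDerivAt_sinh (r * τ)).comp τ ((hasDerivAt_id' τ).const_mul r)).div_const r
      exact this.congr_deriv (by field_simp; ring)
    · have := Real.cosh_sq (r * τ)
      field_simp
      linear_combination -this
    · have := Real.one_le_cosh (r * τ)
      have : 0 ≤ Real.cosh (r * τ) - 1 := by linarith
      positivity
  · refine ⟨fun τ => τ, fun τ => τ ^ 2 / 2, contDiff_id, (contDiff_id.pow 2).div_const _,
      fun τ => ?_, fun τ => ?_, rfl, by simp, fun τ => by ring, fun τ => by positivity⟩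
    · have := (hasDerivAt_pow 2 τ).div_const 2
      exact this.congr_deriv (by simp)
    · simpa using hasDerivAt_id' τ
  · obtain ⟨r, hr, rfl⟩ : ∃ r : ℝ, 0 < r ∧ k = r ^ 2 :=
      ⟨√k, Real.sqrt_pos.2 hk, by rw [Real.sq_sqrt hk.le]⟩
    refine ⟨fun τ => Real.sin (r * τ) / r, fun τ => (1 - Real.cos (r * τ)) / r ^ 2,
      (Real.contDiff_sin.comp (contDiff_const.mul contDiff_id)).div_const _,
      (contDiff_const.sub (Real.contDiff_cos.comp (contDiff_const.mul contDiff_id))).div_const _,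
      fun τ => ?_, fun τ => ?_, by simp, by simp, fun τ => ?_, fun τ => ?_⟩
    · have := (((Real.hasDerivAt_cos (r * τ)).comp τ ((hasDerivAt_id' τ).const_mul r)).const_sub
        1).div_const (r ^ 2)
      exact this.congr_deriv (by field_simp)
    · have := ((Real.hasDerivAt_sin (r * τ)).comp τ ((hasDerivAt_id' τ).const_mul r)).div_const r
      exact this.congr_deriv (by field_simp; ring)
    · have := Real.sin_sq_add_cos_sq (r * τ)
      field_simp
      linear_combination this
    · have := Real.cos_le_one (r * τ)
      have : 0 ≤ 1 - Real.cos (r * τ) := by linarith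
      positivity

section Models

open Filter Topology

variable {n ν d : ℕ} {Q : Type*} [TopologicalSpace Q] [ChartedSpace (EuclideanSpace ℝ (Fin d)) Q]
  [IsManifold (𝓡 d) ∞ Q] {a : EuclideanSpace ℝ (Fin ν)} {κ : EuclideanSpace ℝ (Fin ν) →L[ℝ] Lor n}
  {i : Q → Lor n}

local notation "⟪" x ", " y "⟫" => inner ℝ x y

/-- Smooth maps into `umbSet a κ` factor through a parametrization by an embedding. -/
theorem exists_smooth_lift {E' H' N : Type*} [NormedAddCommGroup E'] [NormedSpace ℝ E']
    [TopologicalSpace H'] {J : ModelWithCorners ℝ E' H'} [TopologicalSpace N] [ChartedSpace H' N]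
    (hi : IsHypImmersion d i) (hr : Set.range i = umbSet a κ) (he : Topology.IsEmbedding i)
    {h : N → Lor n} (hh : ContMDiff J 𝓘(ℝ, Lor n) ∞ h) (hm : ∀ x, h x ∈ umbSet a κ) :
    ∃ g : N → Q, ContMDiff J (𝓡 d) ∞ g ∧ i ∘ g = h := by
  have : ∀ x, ∃ y, i y = h x := fun x => by have := hm x; rwa [← hr] at this
  choose g hg using this
  have hg' : i ∘ g = h := funext hg
  have hc : Continuous g := by rw [he.continuous_iff, hg']; exact hh.continuous
  refine ⟨g, fun x => ?_, hg'⟩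
  exact contMDiffAt_of_comp_immersion (hi.smooth _) (hi.injective_push _) hc.continuousAt
    (by rw [hg']; exact hh x)

/-- The geodesics are explicit curves in Lorentz space whose acceleration is a combination of the
position and `κ a`, hence normal. They stay in `umbSet a κ` for all times and lift smoothly through
the embedding. -/
theorem leavesComplete_of_range (hκ : IsConeFrame a κ) (hi : IsHypImmersion d i)
    (hr : Set.range i = umbSet a κ) (he : Topology.IsEmbedding i) :
    LeavesComplete (d := d) i (fun _ => ⊤) := by
  intro y T _
  have hm : ∀ y, i y ∈ umbSet a κ := fun y => by rw [← hr]; exact ⟨y, rfl⟩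
  set c := ‖a‖ ^ 2 - 1 with hc
  set w := push i y T with hw
  set z := i y with hz
  set r := lor w w with hrd
  -- The direction of acceleration at `z`. It is orthogonal to `K` and to the initial velocity, and
  -- its products with `z` and itself are `-1` and `c`, so adding multiples of it preserves the
  -- heights.
  set V := (-c) • z - κ a with hV
  have hwz : lor w z = 0 := lor_push_self hi y T
  have hwκ : ∀ t, lor w (κ t) = 0 := fun t => lor_push_coneFrame hi hm y T t
  have hr0 : 0 ≤ r := lor_self_nonneg (hm y).1 hwz
  have hzz : lor z z = -1 := (hm y).1.1
  have hzκ : ∀ t, lor z (κ t) = ⟪a, t⟫ := (hm y).2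
  have haa : ⟪a, a⟫ = c + 1 := by rw [real_inner_self_eq_norm_sq]; ring
  have hVκ : ∀ t, lor V (κ t) = 0 := fun t => by
    rw [hV, lor_sub_left, lor_smul_left, hzκ, hκ, haa]; ring
  have hVz : lor V z = -1 := by
    rw [hV, lor_sub_left, lor_smul_left, hzz, lor_comm, hzκ, haa]; ring
  have hVw : lor V w = 0 := by
    rw [hV, lor_sub_left, lor_smul_left, lor_comm, hwz, lor_comm (κ a), hwκ]; ring
  have hVV : lor V V = c := by
    conv_lhs => rw [hV]
    rw [lor_sub_left, lor_smul_left, lor_comm z, hVz, lor_comm (κ a), hVκ]; ring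
  obtain ⟨S, C, hS, hC, hdC, hdS, hS0, hC0, hSC, hCpos⟩ := exists_generalized_sine (c * r)
  set e : ℝ → Lor n := fun τ => z + S τ • w + (r * C τ) • V with hed
  have hde : ∀ τ, HasDerivAt e ((1 - c * r * C τ) • w + (r * S τ) • V) τ := fun τ => by
    have := ((hdS τ).smul_const w).const_add z |>.add (((hdC τ).const_mul r).smul_const V)
    exact this
  have hde' : deriv e = fun τ => (1 - c * r * C τ) • w + (r * S τ) • V :=
    funext fun τ => (hde τ).deriv
  have hdde : ∀ τ, deriv (deriv e) τ = r • ((-c) • e τ - κ a) := fun τ => by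
    rw [hde']
    have h1 := (((hdC τ).const_mul (c * r)).const_sub 1).smul_const w
    have h2 := ((hdS τ).const_mul r).smul_const V
    rw [(h1.fun_add h2).deriv]
    have h3 : κ a = (-c) • z - V := by rw [hV]; abel
    rw [h3, hed]
    module
  have hes : ContDiff ℝ ∞ e :=
    (contDiff_const.add (hS.smul contDiff_const)).add ((contDiff_const.mul hC).smul contDiff_const)
  have hem : ∀ τ, e τ ∈ umbSet a κ := fun τ => by
    refine ⟨mem_Hyp_of_lor_neg (hm y).1 ?_ ?_, fun t => ?_⟩
    · simp only [hed, lor_add_left, lor_add_right, lor_smul_left, lor_smul_right, hzz, hwz, hVz, hVw,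
        hVV, lor_comm z w, lor_comm z V, lor_comm w V, ← hrd]
      linear_combination r * hSC τ
    · rw [← hz]
      simp only [hed, lor_add_right, lor_smul_right, hzz, hwz, hVz, lor_comm z w, lor_comm z V]
      have := mul_nonneg hr0 (hCpos τ)
      linarith
    · simp only [hed, lor_add_left, lor_smul_left, hzκ, hwκ, hVκ]; ring
  obtain ⟨γ, hγ, hγe⟩ := exists_smooth_lift (J := 𝓘(ℝ, ℝ)) hi hr he hes.contMDiff hem
  refine ⟨γ, hγ, ?_, ?_, fun _ => trivial, fun τ X _ => ?_⟩
  · refine he.injective ?_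
    rw [show i (γ 0) = e 0 from congrFun hγe 0, hed]
    simp [hS0, hC0, hz]
  · rw [hγe, hde']
    simp [hS0, hC0]
  · rw [hγe, hdde, show i (γ τ) = e τ from congrFun hγe τ]
    have h1 : lor (e τ) (push i (γ τ) X) = 0 := by
      rw [← show i (γ τ) = e τ from congrFun hγe τ, lor_comm]; exact lor_push_self hi _ _
    have h2 : lor (κ a) (push i (γ τ) X) = 0 := by
      rw [lor_comm]; exact lor_push_coneFrame hi hm _ _ _
    rw [lor_add_left, lor_smul_left, lor_sub_left, lor_smul_left, lor_smul_left, h1, h2]; ring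

theorem isUmbilicalInclusion_of_range (hκ : IsConeFrame a κ) (hd : d + ν = n)
    (hi : IsHypImmersion d i) (hr : Set.range i = umbSet a κ) (he : Topology.IsEmbedding i)
    (hs : SimplyConnectedSpace Q) : IsUmbilicalInclusion d (‖a‖ ^ 2 - 1) i where
  toIsHypImmersion := hi
  isEmbedding := he
  simplyConnected := hs
  complete := leavesComplete_of_range hκ hi hr he
  umbilical := umbilical_of_mem_umbSet hκ hd hi fun y => by rw [← hr]; exact ⟨y, rfl⟩

theorem isNormalFrame_normalVec (hκ : IsConeFrame a κ) (hd : d + ν = n)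
    (hi : IsHypImmersion d i) (hr : Set.range i = umbSet a κ) :
    IsNormalFrame d i (fun j y => normalVec a κ (i y) (EuclideanSpace.single j 1)) := by
  have hm : ∀ y, i y ∈ umbSet a κ := fun y => by rw [← hr]; exact ⟨y, rfl⟩
  refine ⟨hd, fun j => ?_, fun j y => normalVec_mem hi hm y _, fun j l y => ?_⟩
  · have : ContDiff ℝ ∞ fun z : Lor n => normalVec a κ z (EuclideanSpace.single j 1) :=
      contDiff_const.add (contDiff_id.const_smul _)
    exact this.contMDiff.comp hi.smooth
  · rw [lor_normalVec hκ (hm y)]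
    simp [EuclideanSpace.inner_single_left]

theorem sum_smul_normalVec (z : Lor n) (t : EuclideanSpace ℝ (Fin ν)) :
    ∑ j, t j • normalVec a κ z (EuclideanSpace.single j 1) = normalVec a κ z t := by
  let N : EuclideanSpace ℝ (Fin ν) →ₗ[ℝ] Lor n :=
    κ.toLinearMap + (innerSL ℝ a).toLinearMap.smulRight z
  have hN : ∀ t, N t = normalVec a κ z t := fun t => by simp [N, normalVec]
  simp only [← hN]
  conv_rhs => rw [← (EuclideanSpace.basisFun (Fin ν) ℝ).sum_repr t, map_sum]
  simp

end Models

/-! ### Building generalized cones -/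

section Build

variable {n ν k m : ℕ} {a : EuclideanSpace ℝ (Fin ν)} {κ : EuclideanSpace ℝ (Fin ν) →L[ℝ] Lor n}

/-- The umbilical submanifold `umbSet a κ` is the image of a complete simply connected one. -/
def HasModel (d : ℕ) (a : EuclideanSpace ℝ (Fin ν)) (κ : EuclideanSpace ℝ (Fin ν) →L[ℝ] Lor n) :
    Prop :=
  ∃ (Q : Type) (_ : TopologicalSpace Q) (_ : ChartedSpace (EuclideanSpace ℝ (Fin d)) Q)
    (_ : IsManifold (𝓡 d) ∞ Q) (i : Q → Lor n), IsHypImmersion d i ∧ Set.range i = umbSet a κ ∧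
    Topology.IsEmbedding i ∧ SimplyConnectedSpace Q

/-- For the frame `normalVec` at the standard basis, the map `G` of the cone is `coneMap`. The base
immersion lifts to the model and carries the induced metric, and `c ≠ -1` is `a ≠ 0`. -/
theorem exists_generalizedCone (hκ : IsConeFrame a κ) (ha : a ≠ 0) (hn : ν ≤ n)
    (hQ : HasModel (n - ν) a κ)
    {S : Type u} [TopologicalSpace S] [ChartedSpace (EuclideanSpace ℝ (Fin k)) S]
    [IsManifold (𝓡 k) ∞ S] [T2Space S] [SecondCountableTopology S] [ConnectedSpace S]
    {h : S → Lor n} (hh : IsHypImmersion k h) (hm : ∀ x, h x ∈ umbSet a κ)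
    {M : Type*} [TopologicalSpace M] [ChartedSpace (EuclideanSpace ℝ (Fin m)) M]
    (f : M → Lor n)
    (Φ : PartialDiffeomorph (𝓡 m) ((𝓡 k).prod (𝓡 ν)) M (S × EuclideanSpace ℝ (Fin ν)) ∞)
    (hf : ∀ x ∈ Φ.source, f x = coneMap a κ (h (Φ x).1) (Φ x).2)
    (hΦ : Φ.target ⊆ {p | Function.Injective (mfderiv ((𝓡 k).prod (𝓡 ν)) 𝓘(ℝ, Lor n)
      (fun p : S × EuclideanSpace ℝ (Fin ν) => coneMap a κ (h p.1) p.2) p)}) :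
    ∃ (C : GeneralizedCone.{u} n k ν) (Ψ : PartialDiffeomorph (𝓡 m) ((𝓡 k).prod (𝓡 ν)) M
      (C.S × EuclideanSpace ℝ (Fin ν)) ∞), Ψ.source = Φ.source ∧ C.CoincidesVia f Ψ ∧
      (Φ.target = Set.univ → Ψ.target = C.domain) := by
  obtain ⟨Q, _, _, _, i, hi, hr, he, hs⟩ := hQ
  obtain ⟨g, hg, hgi⟩ := exists_smooth_lift (J := 𝓡 k) hi hr he hh.smooth hm
  obtain ⟨G, hG⟩ := exists_induced_metric hh
  rw [← hgi] at hG
  have hd : n - ν + ν = n := Nat.sub_add_cancel hn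
  have hzQ : ∀ y, i y ∈ umbSet a κ := fun y => by rw [← hr]; exact ⟨y, rfl⟩
  let C : GeneralizedCone.{u} n k ν :=
    { c := ‖a‖ ^ 2 - 1
      c_ne := by
        have := norm_ne_zero_iff.2 ha
        have h2 : ‖a‖ ^ 2 ≠ 0 := pow_ne_zero 2 this
        intro h
        exact h2 (by linarith)
      Q := Q
      i := i
      umbilicalInclusion := isUmbilicalInclusion_of_range hκ hd hi hr he hs
      frame := _
      normalFrame := isNormalFrame_normalVec hκ hd hi hr
      S := S
      metric := G
      g := g
      smooth_g := hg
      isometric_g := hG }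
  have hCG : C.G = fun p : S × EuclideanSpace ℝ (Fin ν) => coneMap a κ (h p.1) p.2 := by
    funext p
    change hexp (i (g p.1)) (∑ j, p.2 j • normalVec a κ (i (g p.1)) (EuclideanSpace.single j 1)) = _
    rw [sum_smul_normalVec, hexp_normalVec hκ (hzQ _), show i (g p.1) = h p.1 from congrFun hgi _]
  have hdom : C.domain = {p | Function.Injective (mfderiv ((𝓡 k).prod (𝓡 ν)) 𝓘(ℝ, Lor n)
      (fun p : S × EuclideanSpace ℝ (Fin ν) => coneMap a κ (h p.1) p.2) p)} := by
    rw [← hCG]; rfl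
  refine ⟨C, Φ, rfl, ⟨?_, fun x hx => ?_⟩, fun hu => ?_⟩
  · rw [hdom]; exact hΦ
  · rw [hCG]; exact hf x hx
  · rw [hdom]
    exact Set.Subset.antisymm hΦ (by rw [hu]; exact Set.subset_univ _)

end Build

/-! ### Explicit models: graphs over `ℝ^d` for `c ≤ 0`, round spheres for `c > 0` -/

section ModelConstructions

open Filter Topology

variable {n ν d : ℕ} {a : EuclideanSpace ℝ (Fin ν)} {κ : EuclideanSpace ℝ (Fin ν) →L[ℝ] Lor n}
  {q : Lor n}

local notation "⟪" x ", " y "⟫" => inner ℝ x y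

/-- The projection of `y` to the tangent space at `p` has square `⟨y,p⟩² - 1`, which is nonnegative.
-/
theorem lor_le_neg_one {p y : Lor n} (hp : p ∈ Hyp n) (hy : y ∈ Hyp n) : lor y p ≤ -1 := by
  have h1 := lor_mul_self_lt hy hp
  have h2 := lor_self_nonneg (w := y + lor y p • p) hp (by
    rw [lor_add_left, lor_smul_left, hp.1]; ring)
  simp only [lor_add_left, lor_add_right, lor_smul_left, lor_smul_right, hp.1, hy.1,
    lor_comm p y] at h2
  nlinarith

/-- The vectors orthogonal to the image of `κ`. -/
def frameOrth (κ : EuclideanSpace ℝ (Fin ν) →L[ℝ] Lor n) : Submodule ℝ (Lor n) :=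
  (lorForm n).orthogonal (LinearMap.range κ.toLinearMap)

theorem mem_frameOrth {v : Lor n} : v ∈ frameOrth κ ↔ ∀ t, lor v (κ t) = 0 := by
  constructor
  · intro h t
    rw [lor_comm]
    exact h _ ⟨t, rfl⟩
  · rintro h _ ⟨t, rfl⟩
    change lor (κ t) v = 0
    rw [lor_comm]; exact h t

theorem finrank_frameOrth (hκ : IsConeFrame a κ) (hq : q ∈ umbSet a κ) (hd : d + ν = n) :
    Module.finrank ℝ (frameOrth κ) = d + 1 := by
  rw [frameOrth, LinearMap.BilinForm.finrank_orthogonal lorForm_nondegenerate,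
    LinearMap.finrank_range_of_inj (injective_coneFrame hκ hq)]
  simp; omega

theorem finrank_frameOrth_inf (hκ : IsConeFrame a κ) (hq : q ∈ umbSet a κ) (hd : d + ν = n) :
    Module.finrank ℝ ((lorForm n).orthogonal (LinearMap.range κ.toLinearMap ⊔
      Submodule.span ℝ {q}) : Submodule ℝ (Lor n)) = d := by
  let J : ℝ × EuclideanSpace ℝ (Fin ν) →ₗ[ℝ] Lor n :=
    (LinearMap.toSpanSingleton ℝ (Lor n) q).coprod κ.toLinearMap
  have hJ : LinearMap.range J = LinearMap.range κ.toLinearMap ⊔ Submodule.span ℝ {q} := by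
    rw [LinearMap.range_coprod, LinearMap.range_toSpanSingleton, sup_comm]
  have hJi : Function.Injective J := by
    rw [injective_iff_map_eq_zero]
    rintro ⟨r, t⟩ h
    have h' : r • q + κ t = 0 := h
    have h1 := congrArg (fun v => lor q v) h'
    have h2 := congrArg (fun v => lor v (κ t)) h'
    simp only [lor_add_right, lor_add_left, lor_smul_right, lor_smul_left, hq.1.1, hq.2, hκ t t,
      lor_zero_left, lor_zero_right, real_inner_self_eq_norm_sq] at h1 h2
    have hr : ⟪a, t⟫ = r := by linarith
    rw [hr] at h2
    have h3 : ‖t‖ ^ 2 = 0 := by linarith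
    have ht : t = 0 := by simpa using h3
    rw [ht, inner_zero_right] at hr
    exact Prod.ext hr.symm ht
  rw [← hJ, LinearMap.BilinForm.finrank_orthogonal lorForm_nondegenerate,
    LinearMap.finrank_range_of_inj hJi]
  simp; omega

/-- The submanifold is a graph over its tangent space at `q`: a point is `q + β y + s V`, and lying
on the hyperboloid means `c s² - 2 s + ‖y‖² = 0`. The model is thus `ℝ^d`, and linear projection
back to `y` gives both immersion and embedding. -/
theorem exists_model_of_norm_le_one (hκ : IsConeFrame a κ) (hq : q ∈ umbSet a κ) (ha : ‖a‖ ≤ 1)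
    (hd : d + ν = n) : HasModel d a κ := by
  have hW : ∀ v, v ∈ (lorForm n).orthogonal (LinearMap.range κ.toLinearMap ⊔
      Submodule.span ℝ {q}) ↔ (∀ t, lor v (κ t) = 0) ∧ lor v q = 0 := by
    intro v
    constructor
    · intro h
      refine ⟨fun t => ?_, ?_⟩
      · rw [lor_comm]; exact h _ (Submodule.mem_sup_left ⟨t, rfl⟩)
      · rw [lor_comm]; exact h _ (Submodule.mem_sup_right (Submodule.mem_span_singleton_self q))
    · rintro ⟨h1, h2⟩ w hw
      obtain ⟨_, ⟨t, rfl⟩, w', hw', rfl⟩ := Submodule.mem_sup.1 hw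
      obtain ⟨r, rfl⟩ := Submodule.mem_span_singleton.1 hw'
      change lor (κ t + r • q) v = 0
      rw [lor_add_left, lor_smul_left, lor_comm, h1, lor_comm, h2]; ring
  obtain ⟨β, hβr, hβ⟩ := exists_orthonormal_parametrization (lorForm n) lor_comm _
    (fun w hw hw0 => lor_self_pos hq.1 ((hW w).1 hw).2 hw0) (finrank_frameOrth_inf hκ hq hd)
  have hβ' : ∀ s t, lor (β s) (β t) = ⟪s, t⟫ := hβ
  have hβm : ∀ y, (∀ t, lor (β y) (κ t) = 0) ∧ lor (β y) q = 0 := fun y =>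
    (hW _).1 (by rw [← hβr]; exact ⟨y, rfl⟩)
  set c := ‖a‖ ^ 2 - 1 with hc
  have hc0 : c ≤ 0 := by have := norm_nonneg a; nlinarith
  have haa : ⟪a, a⟫ = c + 1 := by rw [real_inner_self_eq_norm_sq]; ring
  set V := (-c) • q - κ a with hV
  have hVκ : ∀ t, lor V (κ t) = 0 := fun t => by
    rw [hV, lor_sub_left, lor_smul_left, hq.2, hκ, haa]; ring
  have hVq : lor V q = -1 := by
    rw [hV, lor_sub_left, lor_smul_left, hq.1.1, lor_comm, hq.2, haa]; ring
  have hVβ : ∀ y, lor V (β y) = 0 := fun y => by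
    rw [hV, lor_sub_left, lor_smul_left, lor_comm, (hβm y).2, lor_comm, (hβm y).1]; ring
  have hVV : lor V V = c := by
    conv_lhs => rw [hV]
    rw [lor_sub_left, lor_smul_left, lor_comm q, hVq, lor_comm (κ a), hVκ]; ring
  set D : EuclideanSpace ℝ (Fin d) → ℝ := fun y => √(1 - c * ‖y‖ ^ 2) with hDdef
  have hD1 : ∀ y : EuclideanSpace ℝ (Fin d), 1 ≤ 1 - c * ‖y‖ ^ 2 := fun y => by nlinarith [sq_nonneg ‖y‖]
  have hD2 : ∀ y, D y ^ 2 = 1 - c * ‖y‖ ^ 2 := fun y => Real.sq_sqrt (by linarith [hD1 y])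
  have hD0 : ∀ y, 0 ≤ D y := fun y => Real.sqrt_nonneg _
  -- The smaller root of the quadratic, in the form that stays valid for the horosphere `c = 0`,
  -- where it is `‖y‖² / 2`.
  set s : EuclideanSpace ℝ (Fin d) → ℝ := fun y => ‖y‖ ^ 2 / (1 + D y) with hsdef
  have hs0 : ∀ y, 0 ≤ s y := fun y => div_nonneg (sq_nonneg _) (by linarith [hD0 y])
  have hs1 : ∀ y, s y * (1 + D y) = ‖y‖ ^ 2 := fun y =>
    div_mul_cancel₀ _ (by linarith [hD0 y])
  have hs2 : ∀ y, 1 - c * s y = D y := fun y => by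
    have h1 : (1 + D y) * (1 - c * s y - D y) = 0 := by
      linear_combination (-c) * hs1 y - hD2 y
    rcases mul_eq_zero.1 h1 with h | h <;> linarith [hD0 y]
  have hDs : ContDiff ℝ ∞ D := by
    rw [contDiff_iff_contDiffAt]
    intro y
    exact (contDiffAt_const.sub (contDiffAt_const.mul (contDiff_norm_sq ℝ).contDiffAt)).sqrt
      (by linarith [hD1 y])
  have hss : ContDiff ℝ ∞ s :=
    (contDiff_norm_sq ℝ).div (contDiff_const.add hDs) fun y => by linarith [hD0 y]
  set i : EuclideanSpace ℝ (Fin d) → Lor n := fun y => q + β y + s y • V with hi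
  have his : ContDiff ℝ ∞ i :=
    (contDiff_const.add β.contDiff).add (hss.smul contDiff_const)
  have him : ∀ y, i y ∈ umbSet a κ := fun y => by
    have hqβ : lor q (β y) = 0 := by rw [lor_comm]; exact (hβm y).2
    refine ⟨mem_Hyp_of_lor_neg hq.1 ?_ ?_, fun t => ?_⟩
    · simp only [hi, lor_add_left, lor_add_right, lor_smul_left, lor_smul_right, hq.1.1, hqβ,
        (hβm y).2, hVq, hVV, lor_comm q V, hVβ, lor_comm (β y) V, hβ', real_inner_self_eq_norm_sq]
      linear_combination -hs1 y - s y * hs2 y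
    · simp only [hi, lor_add_right, lor_smul_right, hq.1.1, hqβ, hVq, lor_comm q V]
      linarith [hs0 y]
    · simp only [hi, lor_add_left, lor_smul_left, hq.2, (hβm y).1, hVκ]; ring
  let P : Lor n →L[ℝ] EuclideanSpace ℝ (Fin d) :=
    ∑ j, (lorL n (β (EuclideanSpace.single j 1))).smulRight (EuclideanSpace.single j 1)
  have hP : ∀ y, P (i y) = y := fun y => by
    have h1 : ∀ j, lor (β (EuclideanSpace.single j 1)) (i y) = y j := fun j => by
      simp only [hi, lor_add_right, lor_smul_right, (hβm _).2, lor_comm (β _) V, hVβ, hβ',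
        EuclideanSpace.inner_single_left]
      simp
    have h2 : P (i y) = ∑ j, y j • EuclideanSpace.single j (1 : ℝ) := by
      simp [P, h1]
    rw [h2]
    conv_rhs => rw [← (EuclideanSpace.basisFun (Fin d) ℝ).sum_repr y]
    simp
  refine ⟨EuclideanSpace ℝ (Fin d), inferInstance, inferInstance, inferInstance, i,
    ⟨his.contMDiff, fun y => (him y).1, fun y => ?_⟩, ?_, ?_, ?_⟩
  · have h1 : HasFDerivAt (P ∘ i) (P ∘L fderiv ℝ i y) y :=
      P.hasFDerivAt.comp y (his.differentiable (by simp) y).hasFDerivAt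
    have h2 : HasFDerivAt (P ∘ i) (ContinuousLinearMap.id ℝ _) y := by
      rw [show P ∘ i = id from funext hP]; exact hasFDerivAt_id y
    have h3 := h1.unique h2
    have h4 : ∀ X, P (fderiv ℝ i y X) = X := fun X => congrArg (fun l => l X) h3
    have h5 : ∀ X : TangentSpace (𝓡 d) y, push i y X = fderiv ℝ i y X := fun X => by
      rw [push, mfderiv_eq_fderiv]
      rfl
    intro X Y h
    rw [h5, h5] at h
    rw [← h4 X, ← h4 Y]
    exact congrArg P h
  · refine Set.Subset.antisymm (by rintro _ ⟨y, rfl⟩; exact him y) fun z hz => ?_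
    set σ := -lor z q - 1 with hσ
    have hσ0 : 0 ≤ σ := by have := lor_le_neg_one hq.1 hz.1; linarith
    have hmem : z - q - σ • V ∈ (lorForm n).orthogonal (LinearMap.range κ.toLinearMap ⊔
        Submodule.span ℝ {q}) := by
      refine (hW _).2 ⟨fun t => ?_, ?_⟩
      · rw [lor_sub_left, lor_sub_left, lor_smul_left, hz.2, hq.2, hVκ]; ring
      · rw [lor_sub_left, lor_sub_left, lor_smul_left, hq.1.1, hVq]; ring
    rw [← hβr] at hmem
    obtain ⟨y, hy⟩ := hmem
    have hy' : β y = z - q - σ • V := hy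
    have hz' : z = q + β y + σ • V := by rw [hy']; abel
    have hqβ : lor q (β y) = 0 := by rw [lor_comm]; exact (hβm y).2
    have h1 : ‖y‖ ^ 2 + c * σ ^ 2 = 2 * σ := by
      have := hz.1.1
      rw [hz'] at this
      simp only [lor_add_left, lor_add_right, lor_smul_left, lor_smul_right, hq.1.1, hqβ,
        (hβm y).2, hVq, hVV, lor_comm q V, hVβ, lor_comm (β y) V, hβ',
        real_inner_self_eq_norm_sq] at this
      linarith
    have h2 : 1 - c * σ = D y := by
      refine (pow_left_inj₀ (by nlinarith) (hD0 y) two_ne_zero).1 ?_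
      rw [hD2]; linear_combination c * h1
    have h3 : σ = s y := by
      rw [eq_div_iff (by linarith [hD0 y]), ← h2]; linear_combination -h1
    exact ⟨y, by rw [hz', h3]⟩
  · exact Function.LeftInverse.isEmbedding (f := P) hP P.continuous his.continuous
  · exact SimplyConnectedSpace.ofContractible _

/-- Here `κ a` is timelike, so `K^⊥` is spacelike of dimension `d + 1`, and the submanifold is a
sphere of radius `1 / √c` in an affine subspace parallel to it, centred at `-c⁻¹ κ a`. -/
theorem exists_model_of_one_lt_norm (hκ : IsConeFrame a κ) (hq : q ∈ umbSet a κ) (ha : 1 < ‖a‖)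
    (hd : d + ν = n)
    (hs : SimplyConnectedSpace (Metric.sphere (0 : EuclideanSpace ℝ (Fin (d + 1))) 1)) :
    HasModel d a κ := by
  set c := ‖a‖ ^ 2 - 1 with hc
  have hc0 : 0 < c := by nlinarith
  have haa : ⟪a, a⟫ = c + 1 := by rw [real_inner_self_eq_norm_sq]; ring
  have hκa : lor (κ a) (κ a) = -(c + 1) * c := by rw [hκ, haa]; ring
  set r := √((c + 1) * c) with hr
  have hr0 : 0 < r := Real.sqrt_pos.2 (by positivity)
  have hr2 : r ^ 2 = (c + 1) * c := Real.sq_sqrt (by positivity)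
  have hpH : (-r⁻¹) • κ a ∈ Hyp n := by
    refine mem_Hyp_of_lor_neg hq.1 ?_ ?_
    · rw [lor_smul_left, lor_smul_right, hκa, show -(c + 1) * c = -r ^ 2 by rw [hr2]; ring]
      field_simp
    · rw [lor_smul_right, hq.2, haa]
      have : 0 < r⁻¹ * (c + 1) := by positivity
      linarith
  obtain ⟨β, hβr, hβ⟩ := exists_orthonormal_parametrization (lorForm n) lor_comm (frameOrth κ)
    (fun w hw hw0 => lor_self_pos hpH (by
      rw [lor_smul_right, mem_frameOrth.1 hw, mul_zero]) hw0) (finrank_frameOrth hκ hq hd)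
  have hβ' : ∀ s t, lor (β s) (β t) = ⟪s, t⟫ := hβ
  have hβm : ∀ y t, lor (β y) (κ t) = 0 := fun y =>
    mem_frameOrth.1 (by rw [← hβr]; exact ⟨y, rfl⟩)
  set b := √c with hb
  have hb0 : 0 < b := Real.sqrt_pos.2 hc0
  have hb2 : b ^ 2 = c := Real.sq_sqrt hc0.le
  have hbi : b⁻¹ * b⁻¹ = c⁻¹ := by rw [← mul_inv, ← sq, hb2]
  set I : EuclideanSpace ℝ (Fin (d + 1)) → Lor n := fun y => (-c⁻¹) • κ a + b⁻¹ • β y with hI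
  have hIs : ContDiff ℝ ∞ I := contDiff_const.add (β.contDiff.const_smul _)
  have hIκ : ∀ y t, lor (I y) (κ t) = ⟪a, t⟫ := fun y t => by
    simp only [hI, lor_add_left, lor_smul_left, hβm, hκ a t, haa]
    field_simp
    ring
  have hII : ∀ y, lor (I y) (I y) = -1 - c⁻¹ + c⁻¹ * ‖y‖ ^ 2 := fun y => by
    have h1 : lor (I y) (κ a) = c + 1 := by rw [hIκ, haa]
    have h2 : lor (I y) (β y) = b⁻¹ * ‖y‖ ^ 2 := by
      simp only [hI, lor_add_left, lor_smul_left, lor_comm (κ a), hβm, hβ',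
        real_inner_self_eq_norm_sq]
      ring
    have h3 : lor (I y) ((-c⁻¹) • κ a + b⁻¹ • β y) = -1 - c⁻¹ + c⁻¹ * ‖y‖ ^ 2 := by
      rw [lor_add_right, lor_smul_right, lor_smul_right, h1, h2, ← mul_assoc, hbi]
      field_simp
      ring
    exact h3
  have hIm : ∀ y, ‖y‖ = 1 → I y ∈ umbSet a κ := fun y hy => by
    refine ⟨mem_Hyp_of_lor_neg hpH ?_ ?_, hIκ y⟩
    · rw [hII, hy]; ring
    · rw [lor_smul_left, lor_comm, hIκ, haa]
      have : 0 < r⁻¹ * (c + 1) := by positivity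
      linarith
  let P : Lor n →L[ℝ] EuclideanSpace ℝ (Fin (d + 1)) :=
    b • ∑ j, (lorL n (β (EuclideanSpace.single j 1))).smulRight (EuclideanSpace.single j 1)
  have hP : ∀ y, P (I y) = y := fun y => by
    have h1 : ∀ j, lor (β (EuclideanSpace.single j 1)) (I y) = b⁻¹ * y j := fun j => by
      simp only [hI, lor_add_right, lor_smul_right, hβm, hβ', EuclideanSpace.inner_single_left]
      simp
    have h2 : P (I y) = ∑ j, y j • EuclideanSpace.single j (1 : ℝ) := by
      simp only [P, smul_apply, sum_apply, ContinuousLinearMap.smulRight_apply, lorL_apply, h1,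
        Finset.smul_sum, smul_smul, mul_inv_cancel_left₀ hb0.ne']
    rw [h2]
    conv_rhs => rw [← (EuclideanSpace.basisFun (Fin (d + 1)) ℝ).sum_repr y]
    simp
  have hfact : Fact (Module.finrank ℝ (EuclideanSpace ℝ (Fin (d + 1))) = d + 1) :=
    ⟨finrank_euclideanSpace_fin⟩
  have hsph : IsManifold (𝓡 d) ∞ (Metric.sphere (0 : EuclideanSpace ℝ (Fin (d + 1))) 1) :=
    IsManifold.of_le (n := ω) le_top
  set i : Metric.sphere (0 : EuclideanSpace ℝ (Fin (d + 1))) 1 → Lor n := fun y => I y with hi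
  have his : ContMDiff (𝓡 d) 𝓘(ℝ, Lor n) ∞ i := hIs.contMDiff.comp contMDiff_coe_sphere
  have him : ∀ y, i y ∈ umbSet a κ := fun y => hIm y (by simp)
  refine ⟨Metric.sphere (0 : EuclideanSpace ℝ (Fin (d + 1))) 1, inferInstance, inferInstance,
    hsph, i, ⟨his, fun y => (him y).1, fun y => ?_⟩, ?_, ?_, hs⟩
  · have h1 : ∀ X : TangentSpace (𝓡 d) y, P (push i y X) =
        mfderiv (𝓡 d) 𝓘(ℝ, EuclideanSpace ℝ (Fin (d + 1)))
          (Subtype.val : Metric.sphere (0 : EuclideanSpace ℝ (Fin (d + 1))) 1 → _) y X := fun X => by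
      have h2 : (Subtype.val : Metric.sphere (0 : EuclideanSpace ℝ (Fin (d + 1))) 1 → _) = P ∘ i := funext fun y => (hP y).symm
      rw [h2, mfderiv_comp y P.mdifferentiableAt ((his y).mdifferentiableAt (by simp)),
        mfderiv_eq_fderiv, P.fderiv]
      rfl
    have h2 : Function.Injective (mfderiv (𝓡 d) 𝓘(ℝ, EuclideanSpace ℝ (Fin (d + 1)))
        (Subtype.val : Metric.sphere (0 : EuclideanSpace ℝ (Fin (d + 1))) 1 → _) y) := by
      convert! injective_mvfderiv_subtypeVal_sphere y
    intro X Y h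
    refine h2 ?_
    rw [← h1, ← h1]
    exact congrArg P h
  · refine Set.Subset.antisymm (by rintro _ ⟨y, rfl⟩; exact him y) fun z hz => ?_
    have hmem : b • (z + c⁻¹ • κ a) ∈ frameOrth κ := by
      refine mem_frameOrth.2 fun t => ?_
      rw [lor_smul_left, lor_add_left, lor_smul_left, hz.2, hκ, haa]
      field_simp
      ring
    rw [← hβr] at hmem
    obtain ⟨y, hy⟩ := hmem
    have hy' : β y = b • (z + c⁻¹ • κ a) := hy
    have hz' : I y = z := by
      rw [hI]
      simp only
      rw [hy', smul_smul, inv_mul_cancel₀ hb0.ne', one_smul]; module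
    have hn : ‖y‖ = 1 := by
      have h1 := hII y
      rw [hz', hz.1.1] at h1
      have h2 : c⁻¹ * (‖y‖ ^ 2 - 1) = 0 := by linarith
      have h3 : ‖y‖ ^ 2 = 1 := by
        rcases mul_eq_zero.1 h2 with h | h
        · exact absurd h (inv_ne_zero hc0.ne')
        · linarith
      exact (pow_eq_one_iff_of_nonneg (norm_nonneg y) two_ne_zero).1 h3
    exact ⟨⟨y, by simpa using hn⟩, hz'⟩
  · have h1 : Topology.IsEmbedding I :=
      Function.LeftInverse.isEmbedding (f := P) hP P.continuous hIs.continuous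
    exact h1.comp Topology.IsEmbedding.subtypeVal

end ModelConstructions

/-! ### Spheres are simply connected -/

section Spheres

open Filter Topology unitInterval

variable {E : Type*} [NormedAddCommGroup E] [InnerProductSpace ℝ E]

/-- Stereographic projection from `v` maps the loop to a vector space, where it contracts; the
contraction is mapped back. -/
theorem homotopic_refl_of_forall_ne {x v : Metric.sphere (0 : E) 1} (γ : Path x x)
    (h : ∀ t, γ t ≠ v) : γ.Homotopic (Path.refl x) := by
  have hv : ‖(v : E)‖ = 1 := by simp
  set e := stereographic hv
  have hs : ∀ y, y ≠ v → y ∈ e.source := fun y hy => by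
    rw [stereographic_source]
    exact fun h' => hy h'
  let J : C((Submodule.span ℝ {(v : E)})ᗮ, Metric.sphere (0 : E) 1) :=
    ⟨e.symm, (isOpenEmbedding_stereographic_symm hv).continuous⟩
  have hJ : ∀ y, y ≠ v → J (e y) = y := fun y hy => e.left_inv (hs y hy)
  let δ : Path (e x) (e x) :=
    { toFun := fun t => e (γ t)
      continuous_toFun := e.continuousOn.comp_continuous γ.continuous fun t => hs _ (h t)
      source' := by simp
      target' := by simp }
  have hx : x ≠ v := by simpa using h 0
  have h1 : (δ.map J.continuous).Homotopic ((Path.refl (e x)).map J.continuous) :=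
    (SimplyConnectedSpace.paths_homotopic δ (Path.refl (e x))).map J
  have h2 := h1.pathCast (hJ x hx).symm (hJ x hx).symm
  have e1 : (δ.map J.continuous).cast (hJ x hx).symm (hJ x hx).symm = γ := by
    ext t
    exact congrArg Subtype.val (hJ _ (h t))
  have e2 : ((Path.refl (e x)).map J.continuous).cast (hJ x hx).symm (hJ x hx).symm =
      Path.refl x := by
    ext t
    exact congrArg Subtype.val (hJ _ hx)
  rwa [e1, e2] at h2

theorem exists_smooth_path_near [FiniteDimensional ℝ E] {x : E} (γ : Path x x) :
    ∃ p : ℝ → E, ContDiff ℝ ∞ p ∧ p 0 = x ∧ p 1 = x ∧ ∀ t : I, ‖p t - γ t‖ < 1 := by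
  obtain ⟨q, hq, hd, -⟩ := γ.extend.continuous.exists_contDiff_approx ⊤
    (continuous_const (y := (1 / 4 : ℝ))) (fun _ => by norm_num)
  -- An affine correction restores the endpoints. With tolerance `1/4`, the total error is at most
  -- `3/4`.
  refine ⟨fun t => q t + ((1 - t) • (x - q 0) + t • (x - q 1)), ?_, by simp, by simp, fun t => ?_⟩
  · exact hq.add (((contDiff_const.sub contDiff_id).smul contDiff_const).add
      (contDiff_id.smul contDiff_const))
  · have h0 := hd 0
    have h1 := hd 1
    have h2 := hd t
    rw [dist_eq_norm] at h0 h1 h2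
    rw [Path.extend_zero] at h0
    rw [Path.extend_one] at h1
    rw [Path.extend_apply γ t.2] at h2
    rw [norm_sub_rev] at h0 h1
    have ht0 := t.2.1
    have ht1 := t.2.2
    calc ‖q t + ((1 - (t : ℝ)) • (x - q 0) + (t : ℝ) • (x - q 1)) - γ t‖
        = ‖(q t - γ t) + ((1 - (t : ℝ)) • (x - q 0) + (t : ℝ) • (x - q 1))‖ := by congr 1; abel
      _ ≤ ‖q t - γ t‖ + (‖(1 - (t : ℝ)) • (x - q 0)‖ + ‖(t : ℝ) • (x - q 1)‖) :=
          (norm_add_le _ _).trans (by gcongr; exact norm_add_le _ _)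
      _ ≤ 1 / 4 + (1 / 4 + 1 / 4) := by
          rw [norm_smul, norm_smul, Real.norm_of_nonneg ht0, Real.norm_of_nonneg (by linarith)]
          have : (1 - (t : ℝ)) * ‖x - q 0‖ ≤ 1 * (1 / 4) := by gcongr; linarith
          have : (t : ℝ) * ‖x - q 1‖ ≤ 1 * (1 / 4) := by gcongr
          linarith
      _ < 1 := by norm_num

theorem normalize_mem_sphere {z : E} (hz : z ≠ 0) : ‖z‖⁻¹ • z ∈ Metric.sphere (0 : E) 1 := by
  have : ‖z‖ ≠ 0 := norm_ne_zero_iff.2 hz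
  simp [norm_smul, this]

/-- A continuous loop may fill the sphere, so it is first replaced by a nearby smooth one,
normalized to the sphere; distance less than one keeps the connecting segments away from the origin.
A smooth loop misses a point and contracts. -/
theorem simplyConnectedSpace_sphere [FiniteDimensional ℝ E] (hE : 2 < Module.finrank ℝ E) :
    SimplyConnectedSpace (Metric.sphere (0 : E) 1) := by
  rw [simply_connected_iff_loops_nullhomotopic]
  constructor
  · rw [← isPathConnected_iff_pathConnectedSpace]
    exact isPathConnected_sphere (by
      rw [← Module.finrank_eq_rank]
      exact_mod_cast (by omega : 1 < Module.finrank ℝ E)) 0 zero_le_one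
  · intro x γ
    obtain ⟨p, hp, hp0, hp1, hpγ⟩ := exists_smooth_path_near (γ.map continuous_subtype_val)
    have hpγ' : ∀ t : I, ‖p t - (γ t : E)‖ < 1 := hpγ
    have hx : ‖(x : E)‖ = 1 := by simp
    have hne : ∀ s t : I, (γ t : E) + (s : ℝ) • (p t - (γ t : E)) ≠ 0 := by
      intro s t h0
      have h1 : ‖(γ t : E)‖ = 1 := by simp
      rw [eq_neg_of_add_eq_zero_left h0, norm_neg, norm_smul, Real.norm_of_nonneg s.2.1] at h1
      have h2 := hpγ' t
      have h3 : (s : ℝ) * ‖p t - (γ t : E)‖ ≤ 1 * ‖p t - (γ t : E)‖ := by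
        gcongr; exact s.2.2
      linarith
    have hpc : Continuous fun t : I => p t := hp.continuous.comp continuous_subtype_val
    have hγc : Continuous fun t : I => (γ t : E) := continuous_subtype_val.comp γ.continuous
    have hp_ne : ∀ t : I, p t ≠ 0 := fun t => by simpa using hne 1 t
    let γ' : Path x x :=
      { toFun := fun t => ⟨‖p t‖⁻¹ • p t, normalize_mem_sphere (hp_ne t)⟩
        continuous_toFun := by
          refine Continuous.subtype_mk ?_ _
          exact (hpc.norm.inv₀ fun t => norm_ne_zero_iff.2 (hp_ne t)).smul hpc
        source' := by ext; simp [hp0, hx]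
        target' := by ext; simp [hp1, hx] }
    have hH : γ.Homotopic γ' := by
      refine ⟨⟨⟨⟨fun st => ⟨‖(γ st.2 : E) + (st.1 : ℝ) • (p st.2 - (γ st.2 : E))‖⁻¹ •
        ((γ st.2 : E) + (st.1 : ℝ) • (p st.2 - (γ st.2 : E))),
        normalize_mem_sphere (hne _ _)⟩, ?_⟩, ?_, ?_⟩, ?_⟩⟩
      · refine Continuous.subtype_mk ?_ _
        have h1 : Continuous fun st : I × I =>
            (γ st.2 : E) + (st.1 : ℝ) • (p st.2 - (γ st.2 : E)) := by fun_prop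
        exact (h1.norm.inv₀ fun st => norm_ne_zero_iff.2 (hne _ _)).smul h1
      · intro t
        ext
        simp
      · intro t
        ext
        simp [γ']
      · rintro s t (rfl | rfl)
        · ext
          simp [hp0, hx]
        · ext
          simp [hp1, hx]
    refine hH.trans ?_
    -- The linear cone over the smooth curve is a `C¹` image of the plane. As `dim E > 2`, its
    -- complement is dense, and any nonzero vector outside it gives a missed direction.
    let F : ℝ × ℝ → E := fun st => st.1 • p st.2
    have hF : ContDiff ℝ 1 F := contDiff_fst.smul ((hp.of_le (by simp)).comp contDiff_snd)
    have hdense := hF.dense_compl_range_of_finrank_lt_finrank (by simpa using hE)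
    have : Nontrivial E := Module.nontrivial_of_finrank_pos (R := ℝ) (by omega)
    obtain ⟨v, hv0, hv⟩ := hdense.inter_open_nonempty {v : E | v ≠ 0} isOpen_ne (exists_ne 0)
    refine homotopic_refl_of_forall_ne (v := ⟨_, normalize_mem_sphere hv0⟩) γ' fun t ht => hv ?_
    have h1 : ‖p t‖⁻¹ • p t = ‖v‖⁻¹ • v := congrArg Subtype.val ht
    have h2 : ‖v‖ ≠ 0 := norm_ne_zero_iff.2 hv0
    refine ⟨(‖v‖ * ‖p t‖⁻¹, t), ?_⟩
    change (‖v‖ * ‖p t‖⁻¹) • p t = v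
    rw [mul_smul, h1, smul_smul, mul_inv_cancel₀ h2, one_smul]

end Spheres

/-- Every set `umbSet a κ` of dimension at least two is the image of a model. -/
theorem exists_model {n ν d : ℕ} {a : EuclideanSpace ℝ (Fin ν)}
    {κ : EuclideanSpace ℝ (Fin ν) →L[ℝ] Lor n} {q : Lor n} (hκ : IsConeFrame a κ)
    (hq : q ∈ umbSet a κ) (hd : d + ν = n) (hd2 : 2 ≤ d) : HasModel d a κ := by
  rcases le_or_gt ‖a‖ 1 with ha | ha
  · exact exists_model_of_norm_le_one hκ hq ha hd
  · exact exists_model_of_one_lt_norm hκ hq ha hd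
      (simplyConnectedSpace_sphere (by rw [finrank_euclideanSpace_fin]; omega))

/-! ### Flow boxes for a map of constant rank with transverse coordinates -/

section FlatBox

open Set Metric

variable {E V K T : Type*} [NormedAddCommGroup E] [NormedSpace ℝ E] [FiniteDimensional ℝ E]
  [NormedAddCommGroup V] [NormedSpace ℝ V] [FiniteDimensional ℝ V]
  [NormedAddCommGroup K] [NormedSpace ℝ K] [FiniteDimensional ℝ K]
  [NormedAddCommGroup T] [NormedSpace ℝ T] [FiniteDimensional ℝ T]

/-- If `L` maps `ker A` onto `T` and is injective there, then `A` followed by a suitable linear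
map, together with `L`, is an isomorphism. -/
theorem exists_equiv_of_transverse
    (hd : Module.finrank ℝ E = Module.finrank ℝ K + Module.finrank ℝ T)
    (A : E →L[ℝ] V) (L : E →L[ℝ] T) (hinj : ∀ X, A X = 0 → L X = 0 → X = 0)
    (hsurj : ∀ s, ∃ X, A X = 0 ∧ L X = s) :
    ∃ (l : V →L[ℝ] K) (e : E ≃L[ℝ] K × T), (e : E →L[ℝ] K × T) = (l ∘L A).prod L := by
  have hker : Module.finrank ℝ (LinearMap.ker A.toLinearMap) = Module.finrank ℝ T := by
    refine LinearEquiv.finrank_eq (LinearEquiv.ofBijective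
      (L.toLinearMap.domRestrict (LinearMap.ker A.toLinearMap)) ⟨?_, fun s => ?_⟩)
    · rw [injective_iff_map_eq_zero]
      exact fun X hX => Subtype.ext (hinj X X.2 hX)
    · obtain ⟨X, h1, h2⟩ := hsurj s
      exact ⟨⟨X, h1⟩, h2⟩
  have hr : Module.finrank ℝ (LinearMap.range A.toLinearMap) = Module.finrank ℝ K := by
    have := A.toLinearMap.finrank_range_add_finrank_ker
    omega
  let j := LinearEquiv.ofFinrankEq _ _ hr
  obtain ⟨l, hl⟩ := LinearMap.exists_extend j.toLinearMap
  have hl' : ∀ X, l (A X) = j ⟨A X, ⟨X, rfl⟩⟩ := fun X => by rw [← LinearEquiv.coe_coe, ← hl]; rfl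
  let G : E →ₗ[ℝ] K × T := (l ∘ₗ A.toLinearMap).prod L.toLinearMap
  have hG : Function.Injective G := by
    rw [injective_iff_map_eq_zero]
    intro X hX
    have h1 : l (A X) = 0 := congrArg Prod.fst hX
    rw [hl', LinearEquiv.map_eq_zero_iff] at h1
    exact hinj X (congrArg Subtype.val h1) (congrArg Prod.snd hX)
  refine ⟨l.toContinuousLinearMap, (LinearEquiv.ofInjectiveOfFinrankEq G hG
    (by rw [hd, Module.finrank_prod])).toContinuousLinearEquiv, ?_⟩
  ext X <;> rfl

/-- A pair of maps that is a submersion onto the second factor along the kernel of the first one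
has, locally, the form `(ρ ∘ pr₁, pr₂)` on a product of balls. -/
theorem exists_flat_box (hd : Module.finrank ℝ E = Module.finrank ℝ K + Module.finrank ℝ T)
    {W : Set E} (hW : IsOpen W) {w₀ : E} (hw₀ : w₀ ∈ W) {h : E → V} {t : E → T}
    (hh : ContDiffOn ℝ ∞ h W) (ht : ContDiffOn ℝ ∞ t W)
    (hinj : ∀ w ∈ W, ∀ X, fderiv ℝ h w X = 0 → fderiv ℝ t w X = 0 → X = 0)
    (hsurj : ∀ w ∈ W, ∀ s, ∃ X, fderiv ℝ h w X = 0 ∧ fderiv ℝ t w X = s) :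
    ∃ (e : OpenPartialHomeomorph E (K × T)) (l : V →L[ℝ] K) (r : ℝ), 0 < r ∧ w₀ ∈ e.source ∧
      e.source ⊆ W ∧ (∀ w, e w = (l (h w), t w)) ∧
      e.target = ball (l (h w₀)) r ×ˢ ball (t w₀) r ∧ ContDiffOn ℝ ∞ e.symm e.target ∧
      ∀ y ∈ ball (l (h w₀)) r, ∀ s ∈ ball (t w₀) r, ∀ s' ∈ ball (t w₀) r,
        h (e.symm (y, s)) = h (e.symm (y, s')) := by
  have : CompleteSpace E := FiniteDimensional.complete ℝ E
  have : CompleteSpace K := FiniteDimensional.complete ℝ K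
  have : CompleteSpace T := FiniteDimensional.complete ℝ T
  obtain ⟨l, e₀, he₀⟩ := exists_equiv_of_transverse (K := K) hd (fderiv ℝ h w₀) (fderiv ℝ t w₀)
    (hinj w₀ hw₀) (hsurj w₀ hw₀)
  let G : E → K × T := fun w => (l (h w), t w)
  have hGs : ContDiffOn ℝ ∞ G W := (l.contDiff.comp_contDiffOn hh).prodMk ht
  have hhd : ∀ w ∈ W, HasFDerivAt h (fderiv ℝ h w) w := fun w hw =>
    ((hh.contDiffAt (hW.mem_nhds hw)).differentiableAt (by simp)).hasFDerivAt
  have htd : ∀ w ∈ W, HasFDerivAt t (fderiv ℝ t w) w := fun w hw =>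
    ((ht.contDiffAt (hW.mem_nhds hw)).differentiableAt (by simp)).hasFDerivAt
  have hGd : ∀ w ∈ W, HasFDerivAt G ((l ∘L fderiv ℝ h w).prod (fderiv ℝ t w)) w := fun w hw =>
    (l.hasFDerivAt.comp w (hhd w hw)).prodMk (htd w hw)
  have hG₀ : ContDiffAt ℝ ∞ G w₀ := hGs.contDiffAt (hW.mem_nhds hw₀)
  have hG₀' : HasFDerivAt G (e₀ : E →L[ℝ] K × T) w₀ := by rw [he₀]; exact hGd w₀ hw₀
  let c := hG₀.toOpenPartialHomeomorph G hG₀' (by simp)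
  have hc : ∀ w, c w = G w := fun w => rfl
  have hcs : w₀ ∈ c.source := hG₀.mem_toOpenPartialHomeomorph_source hG₀' (by simp)
  -- Restricting to the open set where the differential is invertible makes the inverse smooth on
  -- its whole domain, not only at the image of `w₀`.
  have hW' : IsOpen (W ∩ fderiv ℝ G ⁻¹' (range ((↑) : (E ≃L[ℝ] K × T) → E →L[ℝ] K × T))) :=
    (hGs.continuousOn_fderiv_of_isOpen hW (by simp)).isOpen_inter_preimage hW
      ContinuousLinearEquiv.isOpen
  set W' := W ∩ fderiv ℝ G ⁻¹' (range ((↑) : (E ≃L[ℝ] K × T) → E →L[ℝ] K × T)) with hW'd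
  have hw₀' : w₀ ∈ W' := ⟨hw₀, e₀, hG₀'.fderiv.symm⟩
  let c₁ := c.restrOpen W' hW'
  have hc₁ : w₀ ∈ c₁.source := ⟨hcs, hw₀'⟩
  have hc₁s : c₁.source = c.source ∩ W' := c.restrOpen_source W' hW'
  obtain ⟨r, hr, hrb⟩ := Metric.isOpen_iff.1 c₁.open_target _ (c₁.map_source hc₁)
  have hGe : c₁ w₀ = (l (h w₀), t w₀) := rfl
  rw [hGe, ← ball_prod_same] at hrb
  let e := (c₁.symm.restrOpen (ball (l (h w₀)) r ×ˢ ball (t w₀) r)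
    (isOpen_ball.prod isOpen_ball)).symm
  have het : e.target = ball (l (h w₀)) r ×ˢ ball (t w₀) r := inter_eq_right.2 hrb
  have hes : ∀ w ∈ e.source, w ∈ W' := fun w hw => by
    have h1 : e.symm (e w) = w := e.left_inv hw
    have h2 : e w ∈ c₁.target := hrb (het ▸ e.map_source hw)
    have h3 := c₁.map_target h2
    have h4 : c₁.symm (e w) = w := h1
    rw [h4] at h3
    exact (hc₁s ▸ h3).2
  have hew : ∀ w, e w = (l (h w), t w) := fun w => rfl
  have hw₀e : w₀ ∈ e.source := by
    have h1 : e w₀ ∈ e.target := by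
      rw [het, hew]; exact ⟨mem_ball_self hr, mem_ball_self hr⟩
    have h2 : e.symm (e w₀) = w₀ := c₁.left_inv hc₁
    rw [← h2]
    exact e.map_target h1
  refine ⟨e, l, r, hr, hw₀e, fun w hw => (hes w hw).1, hew, het, ?_, ?_⟩
  · intro q hq
    have hq' := hes _ (e.map_target hq)
    obtain ⟨u, hu⟩ := hq'.2
    have h1 : ContDiffAt ℝ ∞ e (e.symm q) := hGs.contDiffAt (hW.mem_nhds hq'.1)
    refine (e.contDiffAt_symm (f₀' := u) hq ?_ h1).contDiffWithinAt
    rw [hu]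
    exact ((hGs.contDiffAt (hW.mem_nhds hq'.1)).differentiableAt (by simp)).hasFDerivAt
  · intro y hy s hs s' hs'
    -- Moving `s` alone moves the point in the direction `X` with `dh X = 0` and `dt X = σ`, which
    -- exists by transversality; the map `h` does not change.
    have hder : ∀ s ∈ ball (t w₀) r, HasFDerivAt (fun s => h (e.symm (y, s)))
        (0 : T →L[ℝ] V) s := by
      intro s hs
      have hq : (y, s) ∈ e.target := by rw [het]; exact ⟨hy, hs⟩
      have hq' := hes _ (e.map_target hq)
      obtain ⟨u, hu⟩ := hq'.2
      have hGu : HasFDerivAt e (u : E →L[ℝ] K × T) (e.symm (y, s)) := by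
        rw [hu]
        exact ((hGs.contDiffAt (hW.mem_nhds hq'.1)).differentiableAt (by simp)).hasFDerivAt
      have h1 := e.hasFDerivAt_symm hq hGu
      have h2 := ((hhd _ hq'.1).comp _ h1).comp s (hasFDerivAt_prodMk_right y s)
      refine h2.congr_fderiv ?_
      ext σ
      obtain ⟨X, hX1, hX2⟩ := hsurj _ hq'.1 σ
      have h3 : u X = (0, σ) := by
        have : (u : E →L[ℝ] K × T) X = _ := congrArg (fun A => A X) (hGu.unique (hGd _ hq'.1))
        rw [← ContinuousLinearEquiv.coe_coe, this]
        simp [hX1, hX2]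
      have h4 : u.symm (0, σ) = X := by rw [← h3]; simp
      change fderiv ℝ h (e.symm (y, s)) (u.symm (0, σ)) = 0
      rw [h4, hX1]
    refine (convex_ball (t w₀) r).is_const_of_fderivWithin_eq_zero (𝕜 := ℝ)
      (fun s hs => (hder s hs).differentiableAt.differentiableWithinAt) (fun s hs => ?_) hs hs'
    rw [fderivWithin_of_isOpen isOpen_ball hs, (hder s hs).fderiv]

end FlatBox

/-! ### Splittings of a manifold and the manifold structure of their fibres -/

section Splittings

open Set Metric Filter Topology

variable {m k ν : ℕ} {M : Type*} [TopologicalSpace M] [ChartedSpace (EuclideanSpace ℝ (Fin m)) M]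
  {V : Type*} [NormedAddCommGroup V] [NormedSpace ℝ V]

/-- On the open set `O` the pair `(h, t)` is an immersion, and `t` is a submersion along the kernel
of the differential of `h`. -/
structure IsSplitting (m : ℕ) {M : Type*} [TopologicalSpace M]
    [ChartedSpace (EuclideanSpace ℝ (Fin m)) M] (O : Set M) (h : M → V)
    (t : M → EuclideanSpace ℝ (Fin ν)) : Prop where
  isOpen : IsOpen O
  smooth_fst : ContMDiffOn (𝓡 m) 𝓘(ℝ, V) ∞ h O
  smooth_snd : ContMDiffOn (𝓡 m) 𝓘(ℝ, EuclideanSpace ℝ (Fin ν)) ∞ t O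
  inj : ∀ x ∈ O, ∀ X : TangentSpace (𝓡 m) x, mfderiv (𝓡 m) 𝓘(ℝ, V) h x X = (0 : V) →
    mfderiv (𝓡 m) 𝓘(ℝ, EuclideanSpace ℝ (Fin ν)) t x X = (0 : EuclideanSpace ℝ (Fin ν)) → X = 0
  surj : ∀ x ∈ O, ∀ s : EuclideanSpace ℝ (Fin ν), ∃ X : TangentSpace (𝓡 m) x,
    mfderiv (𝓡 m) 𝓘(ℝ, V) h x X = (0 : V) ∧
      mfderiv (𝓡 m) 𝓘(ℝ, EuclideanSpace ℝ (Fin ν)) t x X = s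

variable [IsManifold (𝓡 m) ∞ M] {O : Set M} {h : M → V} {t : M → EuclideanSpace ℝ (Fin ν)}

theorem IsSplitting.mono (hS : IsSplitting m O h t) {O' : Set M} (hO : IsOpen O') (h' : O' ⊆ O) :
    IsSplitting m O' h t :=
  ⟨hO, hS.smooth_fst.mono h', hS.smooth_snd.mono h', fun x hx => hS.inj x (h' hx),
    fun x hx => hS.surj x (h' hx)⟩

/-- A chart adapted to a splitting. -/
structure IsBox (O : Set M) (h : M → V) (t : M → EuclideanSpace ℝ (Fin ν)) (p : M)
    (ψ : OpenPartialHomeomorph M (EuclideanSpace ℝ (Fin k) × EuclideanSpace ℝ (Fin ν)))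
    (l : V →L[ℝ] EuclideanSpace ℝ (Fin k)) (r : ℝ) : Prop where
  pos : 0 < r
  mem : p ∈ ψ.source
  subset : ψ.source ⊆ O
  apply : ∀ x ∈ ψ.source, ψ x = (l (h x), t x)
  target : ψ.target = ball (l (h p)) r ×ˢ ball (t p) r
  smooth : ContMDiffOn 𝓘(ℝ, EuclideanSpace ℝ (Fin k) × EuclideanSpace ℝ (Fin ν)) (𝓡 m) ∞ ψ.symm
    ψ.target
  const : ∀ y ∈ ball (l (h p)) r, ∀ s ∈ ball (t p) r, ∀ s' ∈ ball (t p) r,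
    h (ψ.symm (y, s)) = h (ψ.symm (y, s'))

theorem IsSplitting.exists_box [FiniteDimensional ℝ V] (hS : IsSplitting m O h t) (hm : k + ν = m)
    {p : M} (hp : p ∈ O) :
    ∃ (ψ : OpenPartialHomeomorph M (EuclideanSpace ℝ (Fin k) × EuclideanSpace ℝ (Fin ν)))
      (l : V →L[ℝ] EuclideanSpace ℝ (Fin k)) (r : ℝ), IsBox (m := m) O h t p ψ l r := by
  let c := chartAt (EuclideanSpace ℝ (Fin m)) p
  have hφ : ∀ w, (extChartAt (𝓡 m) p).symm w = c.symm w := fun w => rfl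
  have hφt : (extChartAt (𝓡 m) p).target = c.target := by
    rw [extChartAt_target]; simp [c]
  have hW : IsOpen (c.target ∩ c.symm ⁻¹' O) := c.symm.isOpen_inter_preimage hS.isOpen
  have hpc : p ∈ c.source := mem_chart_source _ p
  have hpp : c.symm (c p) = p := c.left_inv hpc
  have hpW : c p ∈ c.target ∩ c.symm ⁻¹' O := ⟨c.map_source hpc, by
    rw [mem_preimage, hpp]; exact hp⟩
  have hhd : ∀ w ∈ c.target ∩ c.symm ⁻¹' O, ContMDiffAt (𝓡 m) 𝓘(ℝ, V) ∞ h (c.symm w) :=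
    fun w hw => hS.smooth_fst.contMDiffAt (hS.isOpen.mem_nhds hw.2)
  have htd : ∀ w ∈ c.target ∩ c.symm ⁻¹' O,
      ContMDiffAt (𝓡 m) 𝓘(ℝ, EuclideanSpace ℝ (Fin ν)) ∞ t (c.symm w) :=
    fun w hw => hS.smooth_snd.contMDiffAt (hS.isOpen.mem_nhds hw.2)
  have hfh : ∀ w ∈ c.target ∩ c.symm ⁻¹' O, ∀ Z, mfderiv (𝓡 m) 𝓘(ℝ, V) h (c.symm w)
      (chartFrame p w Z) = fderiv ℝ (h ∘ c.symm) w Z := fun w hw Z =>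
    mfderiv_chartFrame (hφt ▸ hw.1) ((hhd w hw).mdifferentiableAt (by simp)) Z
  have hft : ∀ w ∈ c.target ∩ c.symm ⁻¹' O, ∀ Z, mfderiv (𝓡 m)
      𝓘(ℝ, EuclideanSpace ℝ (Fin ν)) t (c.symm w)
      (chartFrame p w Z) = fderiv ℝ (t ∘ c.symm) w Z := fun w hw Z =>
    mfderiv_chartFrame (hφt ▸ hw.1) ((htd w hw).mdifferentiableAt (by simp)) Z
  obtain ⟨e, l, r, hr, he1, he2, he3, he4, he5, he6⟩ := exists_flat_box
    (K := EuclideanSpace ℝ (Fin k)) (h := h ∘ c.symm) (t := t ∘ c.symm) (by simp [hm]) hW hpW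
    (fun w hw => (contDiffAt_comp_chart_symm (hφt ▸ hw.1) (hhd w hw)).contDiffWithinAt)
    (fun w hw => (contDiffAt_comp_chart_symm (hφt ▸ hw.1) (htd w hw)).contDiffWithinAt)
    (fun w hw Z hZ1 hZ2 => by
      refine (isInvertible_chartFrame (p := p) (hφt ▸ hw.1)).injective
        ((hS.inj _ hw.2 _ ((hfh w hw Z).trans hZ1) ((hft w hw Z).trans hZ2)).trans
          (map_zero _).symm))
    (fun w hw s => by
      obtain ⟨X, h1, h2⟩ := hS.surj _ hw.2 s
      obtain ⟨Z, rfl⟩ := (isInvertible_chartFrame (p := p) (hφt ▸ hw.1)).surjective X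
      exact ⟨Z, (hfh w hw Z).symm.trans h1, (hft w hw Z).symm.trans h2⟩)
  have hct : e.source ⊆ c.target := fun w hw => (he2 hw).1
  have het : (c.trans e).target = e.target := by
    rw [OpenPartialHomeomorph.trans_target]
    exact inter_eq_left.2 fun q hq => hct (e.map_target hq)
  have hsymm : ∀ q, (c.trans e).symm q = c.symm (e.symm q) := fun q => rfl
  have hb : (h ∘ c.symm) (c p) = h p := congrArg h hpp
  have hb' : (t ∘ c.symm) (c p) = t p := congrArg t hpp
  rw [hb, hb'] at he4 he6
  refine ⟨c.trans e, l, r, hr, ?_, ?_, ?_, het.trans he4, ?_, he6⟩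
  · rw [OpenPartialHomeomorph.trans_source]; exact ⟨hpc, he1⟩
  · intro x hx
    rw [OpenPartialHomeomorph.trans_source] at hx
    have := (he2 hx.2).2
    rwa [mem_preimage, c.left_inv hx.1] at this
  · intro x hx
    rw [OpenPartialHomeomorph.trans_source] at hx
    rw [OpenPartialHomeomorph.trans_apply, he3, Function.comp, Function.comp, c.left_inv hx.1]
  · rw [het]
    have h1 : ContMDiffOn (𝓡 m) (𝓡 m) ∞ c.symm c.target := contMDiffOn_chart_symm
    exact h1.comp he5.contMDiffOn fun q hq => hct (e.map_target hq)

/-- A space with charts that are linear functions of a map `i`, the inverses of which are smooth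
after composition with `i`, is a manifold immersed by `i`. -/
theorem exists_manifold_of_charts {A : Type*} [TopologicalSpace A] {i : A → V}
    (hA : ∀ p : A, ∃ (c : OpenPartialHomeomorph A (EuclideanSpace ℝ (Fin k)))
      (l : V →L[ℝ] EuclideanSpace ℝ (Fin k)), p ∈ c.source ∧ (∀ x ∈ c.source, c x = l (i x)) ∧
        ContDiffOn ℝ ∞ (i ∘ c.symm) c.target) :
    ∃ (_ : ChartedSpace (EuclideanSpace ℝ (Fin k)) A) (_ : IsManifold (𝓡 k) ∞ A),
      ContMDiff (𝓡 k) 𝓘(ℝ, V) ∞ i ∧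
        ∀ x : A, Function.Injective (mfderiv (𝓡 k) 𝓘(ℝ, V) i x) := by
  choose c l hc hl hs using hA
  let cs : ChartedSpace (EuclideanSpace ℝ (Fin k)) A :=
    { atlas := range c
      chartAt := c
      mem_chart_source := hc
      chart_mem_atlas := fun p => ⟨p, rfl⟩ }
  have hM : IsManifold (𝓡 k) ∞ A := by
    refine isManifold_of_contDiffOn _ _ _ ?_
    rintro _ _ ⟨p, rfl⟩ ⟨q, rfl⟩
    simp only [modelWithCornersSelf_coe, modelWithCornersSelf_coe_symm, Function.id_comp,
      Function.comp_id, preimage_id_eq, id_eq, range_id, inter_univ]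
    have h1 : ContDiffOn ℝ ∞ (l q ∘ (i ∘ (c p).symm)) ((c p).symm ≫ₕ c q).source :=
      (l q).contDiff.comp_contDiffOn ((hs p).mono fun y hy => by
        rw [OpenPartialHomeomorph.trans_source] at hy; exact hy.1)
    refine h1.congr fun y hy => ?_
    rw [OpenPartialHomeomorph.trans_source] at hy
    exact hl q _ hy.2
  have hi : ContMDiff (𝓡 k) 𝓘(ℝ, V) ∞ i := by
    intro p
    have h1 : ContMDiffAt (𝓡 k) (𝓡 k) ∞ (c p) p := contMDiffAt_of_mem_maximalAtlas
      (IsManifold.chart_mem_maximalAtlas p) (hc p)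
    have h2 : ContMDiffAt (𝓡 k) 𝓘(ℝ, V) ∞ (i ∘ (c p).symm) (c p p) :=
      ((hs p).contDiffAt ((c p).open_target.mem_nhds ((c p).map_source (hc p)))).contMDiffAt
    refine (h2.comp p h1).congr_of_eventuallyEq ?_
    filter_upwards [(c p).open_source.mem_nhds (hc p)] with x hx
    simp [(c p).left_inv hx]
  refine ⟨cs, hM, hi, fun p => ?_⟩
  have h1 : mfderiv (𝓡 k) 𝓘(ℝ, EuclideanSpace ℝ (Fin k)) (l p ∘ i) p =
      mfderiv (𝓡 k) 𝓘(ℝ, EuclideanSpace ℝ (Fin k)) (extChartAt (𝓡 k) p) p := by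
    refine EventuallyEq.mfderiv_eq ?_
    filter_upwards [(c p).open_source.mem_nhds (hc p)] with x hx
    exact (hl p x hx).symm
  have h2 := (isInvertible_mfderiv_extChartAt (I := 𝓡 k) (mem_extChartAt_source p)).injective
  rw [← h1, mfderiv_comp p
    ((l p).contMDiff.contMDiffAt.mdifferentiableAt (n := ∞) (by simp))
    ((hi p).mdifferentiableAt (by simp))] at h2
  exact Function.Injective.of_comp h2

/-- The fibres of the second component of a splitting are manifolds immersed by the first one. -/
theorem IsSplitting.exists_manifold [FiniteDimensional ℝ V] (hS : IsSplitting m O h t)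
    (hm : k + ν = m) (t₀ : EuclideanSpace ℝ (Fin ν)) :
    ∃ (_ : ChartedSpace (EuclideanSpace ℝ (Fin k)) {x // x ∈ O ∧ t x = t₀})
      (_ : IsManifold (𝓡 k) ∞ {x // x ∈ O ∧ t x = t₀}),
      ContMDiff (𝓡 k) 𝓘(ℝ, V) ∞ (fun x : {x // x ∈ O ∧ t x = t₀} => h x) ∧
        ∀ x, Function.Injective
          (mfderiv (𝓡 k) 𝓘(ℝ, V) (fun x : {x // x ∈ O ∧ t x = t₀} => h x) x) := by
  classical
  refine exists_manifold_of_charts fun p => ?_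
  obtain ⟨ψ, l, r, hb⟩ := hS.exists_box hm p.2.1
  have ht₀ : t₀ ∈ ball (t p) r := by rw [p.2.2]; exact mem_ball_self hb.pos
  have htar : ∀ y ∈ ball (l (h p)) r, (y, t₀) ∈ ψ.target := fun y hy => by
    rw [hb.target]; exact ⟨hy, ht₀⟩
  have happ : ∀ y ∈ ball (l (h p)) r,
      (l (h (ψ.symm (y, t₀))), t (ψ.symm (y, t₀))) = (y, t₀) := fun y hy => by
    rw [← hb.apply _ (ψ.map_target (htar y hy)), ψ.right_inv (htar y hy)]
  have hmem : ∀ y ∈ ball (l (h p)) r, ψ.symm (y, t₀) ∈ O ∧ t (ψ.symm (y, t₀)) = t₀ := fun y hy =>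
    ⟨hb.subset (ψ.map_target (htar y hy)), congrArg Prod.snd (happ y hy)⟩
  have hsec : ContMDiffOn 𝓘(ℝ, EuclideanSpace ℝ (Fin k)) (𝓡 m) ∞ (fun y => ψ.symm (y, t₀))
      (ball (l (h p)) r) :=
    hb.smooth.comp (contDiff_prodMk_left t₀).contMDiff.contMDiffOn fun y hy => htar y hy
  have hψs : ∀ x : {x // x ∈ O ∧ t x = t₀}, (x : M) ∈ ψ.source →
      ψ x = (l (h x), t₀) ∧ l (h x) ∈ ball (l (h p)) r := fun x hx => by
    have h1 := hb.apply x hx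
    rw [x.2.2] at h1
    have h2 := ψ.map_source hx
    rw [hb.target, h1] at h2
    exact ⟨h1, h2.1⟩
  -- Outside the ball the value is the irrelevant point `p`.
  let inv : EuclideanSpace ℝ (Fin k) → {x // x ∈ O ∧ t x = t₀} := fun y =>
    if hy : y ∈ ball (l (h p)) r then ⟨ψ.symm (y, t₀), hmem y hy⟩ else p
  have hinv : ∀ y ∈ ball (l (h p)) r, (inv y : M) = ψ.symm (y, t₀) := fun y hy => by
    simp only [inv, dif_pos hy]
  let c : OpenPartialHomeomorph {x // x ∈ O ∧ t x = t₀} (EuclideanSpace ℝ (Fin k)) :=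
    { toFun := fun x => l (h x)
      invFun := inv
      source := {x | (x : M) ∈ ψ.source}
      target := ball (l (h p)) r
      map_source' := fun x hx => (hψs x hx).2
      map_target' := fun y hy => by
        change (inv y : M) ∈ ψ.source; rw [hinv y hy]; exact ψ.map_target (htar y hy)
      left_inv' := fun x hx => by
        apply Subtype.ext
        rw [hinv _ (hψs x hx).2, ← (hψs x hx).1, ψ.left_inv hx]
      right_inv' := fun y hy => by
        rw [hinv y hy]; exact congrArg Prod.fst (happ y hy)
      open_source := ψ.open_source.preimage continuous_subtype_val
      open_target := isOpen_ball
      continuousOn_toFun := l.continuous.comp_continuousOn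
        (hS.smooth_fst.continuousOn.comp continuous_subtype_val.continuousOn fun x _ => x.2.1)
      continuousOn_invFun := by
        refine Topology.IsInducing.subtypeVal.continuousOn_iff.2 ?_
        exact hsec.continuousOn.congr hinv }
  refine ⟨c, l, hb.mem, fun x _ => rfl, ?_⟩
  have h1 : ContMDiffOn 𝓘(ℝ, EuclideanSpace ℝ (Fin k)) 𝓘(ℝ, V) ∞
      (fun y => h (ψ.symm (y, t₀))) (ball (l (h p)) r) :=
    hS.smooth_fst.comp hsec fun y hy => (hmem y hy).1
  refine h1.contDiffOn.congr fun y hy => ?_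
  exact congrArg h (hinv y hy)

end Splittings

/-! ### From a product decomposition to a generalized cone -/

section ConeCharts

open Set Metric Filter Topology

variable {m n k ν : ℕ} {M : Type u} [TopologicalSpace M]
  [ChartedSpace (EuclideanSpace ℝ (Fin m)) M]
  {a : EuclideanSpace ℝ (Fin ν)} {κ : EuclideanSpace ℝ (Fin ν) →L[ℝ] Lor n}
  {f h : M → Lor n} {t : M → EuclideanSpace ℝ (Fin ν)} {O : Set M}

theorem IsSplitting.injective_mfderiv_prodMk {V : Type*} [NormedAddCommGroup V] [NormedSpace ℝ V]
    {h : M → V} (hS : IsSplitting m O h t) {x : M} (hx : x ∈ O) :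
    Function.Injective (mfderiv (𝓡 m) 𝓘(ℝ, V × EuclideanSpace ℝ (Fin ν))
      (fun y => (h y, t y)) x) := by
  have h1 := hS.smooth_fst.contMDiffAt (hS.isOpen.mem_nhds hx)
  have h2 := hS.smooth_snd.contMDiffAt (hS.isOpen.mem_nhds hx)
  have hd := (h1.prodMk_space h2).mdifferentiableAt (by simp)
  have e1 : mfderiv (𝓡 m) 𝓘(ℝ, V) (ContinuousLinearMap.fst ℝ V (EuclideanSpace ℝ (Fin ν)) ∘
      fun y => (h y, t y)) x = _ := mfderiv_comp x (ContMDiffAt.mdifferentiableAt (n := ∞)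
    (ContinuousLinearMap.contMDiff _).contMDiffAt (by simp)) hd
  have e2 : mfderiv (𝓡 m) 𝓘(ℝ, EuclideanSpace ℝ (Fin ν))
      (ContinuousLinearMap.snd ℝ V (EuclideanSpace ℝ (Fin ν)) ∘
      fun y => (h y, t y)) x = _ := mfderiv_comp x (ContMDiffAt.mdifferentiableAt (n := ∞)
    (ContinuousLinearMap.contMDiff _).contMDiffAt (by simp)) hd
  rw [injective_iff_map_eq_zero]
  intro X hX
  refine hS.inj x hx X ?_ ?_
  · refine (congrArg (fun L => L X) e1).trans ?_
    exact (congrArg (mfderiv 𝓘(ℝ, V × EuclideanSpace ℝ (Fin ν)) _ _ (h x, t x)) hX).trans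
      (map_zero _)
  · refine (congrArg (fun L => L X) e2).trans ?_
    exact (congrArg (mfderiv 𝓘(ℝ, V × EuclideanSpace ℝ (Fin ν)) _ _ (h x, t x)) hX).trans
      (map_zero _)

/-- The fibre of `t` over `t₀` in `O`. -/
abbrev Slice (O : Set M) (t : M → EuclideanSpace ℝ (Fin ν)) (t₀ : EuclideanSpace ℝ (Fin ν)) :=
  {x // x ∈ O ∧ t x = t₀}

/-- On `O`, the map `f` is the generalized cone over `h`, with fibre coordinate `t`. -/
structure IsConeChart (m : ℕ) {M : Type*} [TopologicalSpace M]
    [ChartedSpace (EuclideanSpace ℝ (Fin m)) M] (a : EuclideanSpace ℝ (Fin ν))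
    (κ : EuclideanSpace ℝ (Fin ν) →L[ℝ] Lor n) (f : M → Lor n) (O : Set M) (h : M → Lor n)
    (t : M → EuclideanSpace ℝ (Fin ν)) : Prop extends IsSplitting m O h t where
  mem : ∀ x ∈ O, h x ∈ umbSet a κ
  eq : ∀ x ∈ O, f x = coneMap a κ (h x) (t x)

theorem IsConeChart.mono [IsManifold (𝓡 m) ∞ M] (hC : IsConeChart m a κ f O h t) {O' : Set M}
    (hO : IsOpen O') (h' : O' ⊆ O) : IsConeChart m a κ f O' h t :=
  ⟨hC.toIsSplitting.mono hO h', fun x hx => hC.mem x (h' hx), fun x hx => hC.eq x (h' hx)⟩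

/-- If `O` is, topologically, the product of a fibre of `t` and an open set `B`, then `f` is a
generalized cone on `O`. -/
theorem IsConeChart.exists_generalizedCone [IsManifold (𝓡 m) ∞ M] [T2Space M]
    [SecondCountableTopology M] (hC : IsConeChart m a κ f O h t)
    (hf : IsHypImmersion m f) (hκ : IsConeFrame a κ) (ha : a ≠ 0) {q : Lor n}
    (hq : q ∈ umbSet a κ) (hm : k + ν = m) (hn : ν + 2 ≤ n) (t₀ : EuclideanSpace ℝ (Fin ν))
    [ConnectedSpace (Slice O t t₀)] {B : Set (EuclideanSpace ℝ (Fin ν))}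
    (hB : IsOpen B) (htB : ∀ x ∈ O, t x ∈ B) (r : M → Slice O t t₀)
    (hr : ContinuousOn r O) (hrh : ∀ x ∈ O, h (r x) = h x)
    (Ψ : Slice O t t₀ × EuclideanSpace ℝ (Fin ν) → M)
    (hΨ : ContinuousOn Ψ (univ ×ˢ B)) (hΨO : ∀ p, p.2 ∈ B → Ψ p ∈ O)
    (hΨt : ∀ p, p.2 ∈ B → t (Ψ p) = p.2) (hΨr : ∀ p, p.2 ∈ B → r (Ψ p) = p.1)
    (hΨl : ∀ x ∈ O, Ψ (r x, t x) = x) :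
    ∃ (C : GeneralizedCone.{u} n k ν) (Φ : PartialDiffeomorph (𝓡 m) ((𝓡 k).prod (𝓡 ν)) M
      (C.S × EuclideanSpace ℝ (Fin ν)) ∞), Φ.source = O ∧ C.CoincidesVia f Φ ∧
      (B = univ → Φ.target = C.domain) := by
  obtain ⟨_, _, hs, hi⟩ := hC.toIsSplitting.exists_manifold hm t₀
  let j : Slice O t t₀ → Lor n := fun x => h x
  have hj : IsHypImmersion k j := ⟨hs, fun x => (hC.mem x x.2.1).1, hi⟩
  have hOn := hC.isOpen
  -- Only continuity of `r` and `Ψ` is assumed. Smoothness follows because they are lifts of smooth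
  -- maps through the immersions `h` and `(h, t)`.
  have hrs : ContMDiffOn (𝓡 m) (𝓡 k) ∞ r O := by
    intro x hx
    refine ContMDiffAt.contMDiffWithinAt ?_
    refine contMDiffAt_of_comp_immersion (i := j) (hs _) (hi _)
      (hr.continuousAt (hOn.mem_nhds hx)) ?_
    refine (hC.smooth_fst.contMDiffAt (hOn.mem_nhds hx)).congr_of_eventuallyEq ?_
    filter_upwards [hOn.mem_nhds hx] with y hy using hrh y hy
  have hTo : IsOpen (univ ×ˢ B : Set (Slice O t t₀ × EuclideanSpace ℝ (Fin ν))) := isOpen_univ.prod hB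
  have hΨs : ContMDiffOn ((𝓡 k).prod (𝓡 ν)) (𝓡 m) ∞ Ψ (univ ×ˢ B) := by
    intro p hp
    have hpO := hΨO p hp.2
    refine ContMDiffAt.contMDiffWithinAt ?_
    refine contMDiffAt_of_comp_immersion (i := fun y => (h y, t y))
      ((hC.smooth_fst.contMDiffAt (hOn.mem_nhds hpO)).prodMk_space
        (hC.smooth_snd.contMDiffAt (hOn.mem_nhds hpO)))
      (hC.injective_mfderiv_prodMk hpO) (hΨ.continuousAt (hTo.mem_nhds hp)) ?_
    have h1 : ContMDiffAt ((𝓡 k).prod (𝓡 ν)) 𝓘(ℝ, Lor n × EuclideanSpace ℝ (Fin ν)) ∞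
        (fun p : Slice O t t₀ × EuclideanSpace ℝ (Fin ν) => (j p.1, p.2)) p :=
      ((hs _).comp p contMDiffAt_fst).prodMk_space contMDiffAt_snd
    refine h1.congr_of_eventuallyEq ?_
    filter_upwards [hTo.mem_nhds hp] with q hq
    refine Prod.ext ?_ (hΨt q hq.2)
    change h (Ψ q) = h q.1
    rw [← hrh _ (hΨO q hq.2), hΨr q hq.2]
  let Φ : PartialDiffeomorph (𝓡 m) ((𝓡 k).prod (𝓡 ν)) M (Slice O t t₀ × EuclideanSpace ℝ (Fin ν)) ∞ :=
    { toFun := fun x => (r x, t x)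
      invFun := Ψ
      source := O
      target := univ ×ˢ B
      map_source' := fun x hx => ⟨mem_univ _, htB x hx⟩
      map_target' := fun p hp => hΨO p hp.2
      left_inv' := hΨl
      right_inv' := fun p hp => Prod.ext (hΨr p hp.2) (hΨt p hp.2)
      open_source := hOn
      open_target := hTo
      contMDiffOn_toFun := hrs.prodMk hC.smooth_snd
      contMDiffOn_invFun := hΨs }
  have hfΦ : ∀ x ∈ Φ.source, f x = coneMap a κ (j (Φ x).1) (Φ x).2 := fun x hx => by
    change f x = coneMap a κ (h (r x)) (t x)
    rw [hrh x hx]; exact hC.eq x hx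
  -- On the image of the diffeomorphism the cone map is `f ∘ Ψ`, an immersion composed with a local
  -- diffeomorphism.
  have hΦ : Φ.target ⊆ {p | Function.Injective (mfderiv ((𝓡 k).prod (𝓡 ν)) 𝓘(ℝ, Lor n)
      (fun p : Slice O t t₀ × EuclideanSpace ℝ (Fin ν) => coneMap a κ (j p.1) p.2) p)} := by
    intro p hp
    have hpO := hΨO p hp.2
    have hloc : IsLocalDiffeomorphAt ((𝓡 k).prod (𝓡 ν)) (𝓡 m) ∞ Ψ p :=
      Φ.symm.isLocalDiffeomorphAt _ _ _ hp
    have e1 : mfderiv ((𝓡 k).prod (𝓡 ν)) 𝓘(ℝ, Lor n)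
        (fun p : Slice O t t₀ × EuclideanSpace ℝ (Fin ν) => coneMap a κ (j p.1) p.2) p =
        mfderiv ((𝓡 k).prod (𝓡 ν)) 𝓘(ℝ, Lor n) (f ∘ Ψ) p := by
      refine EventuallyEq.mfderiv_eq ?_
      filter_upwards [hTo.mem_nhds hp] with q hq
      rw [Function.comp, hC.eq _ (hΨO q hq.2), hΨt q hq.2, ← hrh _ (hΨO q hq.2), hΨr q hq.2]
    change Function.Injective _
    rw [e1, mfderiv_comp p ((hf.smooth _).mdifferentiableAt (by simp))
      (hloc.mdifferentiableAt (by simp))]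
    exact Function.Injective.comp (g := mfderiv (𝓡 m) 𝓘(ℝ, Lor n) f (Ψ p)) (hf.injective_push _)
      (hloc.mfderivToContinuousLinearEquiv (by simp)).injective
  have : SecondCountableTopology (Slice O t t₀) :=
    Topology.IsEmbedding.subtypeVal.secondCountableTopology
  obtain ⟨C, Θ, h1, h2, h3⟩ := HypCone.exists_generalizedCone hκ ha (by omega)
    (exists_model hκ hq (by omega) (by omega)) hj (fun x => hC.mem x x.2.1) f Φ hfΦ hΦ
  refine ⟨C, Θ, h1, h2, fun hBu => h3 ?_⟩
  change univ ×ˢ B = univ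
  rw [hBu, univ_prod_univ]

/-- A cone chart with an adapted box gives a generalized cone near a point. -/
theorem IsConeChart.exists_local [IsManifold (𝓡 m) ∞ M] [T2Space M]
    [SecondCountableTopology M] (hC : IsConeChart m a κ f O h t)
    (hf : IsHypImmersion m f) (hκ : IsConeFrame a κ) (ha : a ≠ 0)
    (hm : k + ν = m) (hn : ν + 2 ≤ n) {p : M} (hp : p ∈ O) :
    ∃ (C : GeneralizedCone.{u} n k ν) (Φ : PartialDiffeomorph (𝓡 m) ((𝓡 k).prod (𝓡 ν)) M
      (C.S × EuclideanSpace ℝ (Fin ν)) ∞), p ∈ Φ.source ∧ C.CoincidesVia f Φ := by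
  classical
  obtain ⟨ψ, l, ρ, hb⟩ := hC.toIsSplitting.exists_box hm hp
  have hC' := hC.mono ψ.open_source hb.subset
  set U := ball (l (h p)) ρ with hU
  set B := ball (t p) ρ with hBd
  have hpB : t p ∈ B := mem_ball_self hb.pos
  have hψ : ∀ x ∈ ψ.source, l (h x) ∈ U ∧ t x ∈ B := fun x hx => by
    have h2 := ψ.map_source hx
    rw [hb.target, hb.apply x hx] at h2
    exact h2
  have htar : ∀ y ∈ U, ∀ s ∈ B, (y, s) ∈ ψ.target := fun y hy s hs => by
    rw [hb.target]; exact ⟨hy, hs⟩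
  have happ : ∀ y ∈ U, ∀ s ∈ B, l (h (ψ.symm (y, s))) = y ∧ t (ψ.symm (y, s)) = s :=
    fun y hy s hs => Prod.mk.inj (by
      rw [← hb.apply _ (ψ.map_target (htar y hy s hs)), ψ.right_inv (htar y hy s hs)])
  have hrm : ∀ x ∈ ψ.source, ψ.symm (l (h x), t p) ∈ ψ.source ∧
      t (ψ.symm (l (h x), t p)) = t p := fun x hx =>
    ⟨ψ.map_target (htar _ (hψ x hx).1 _ hpB), (happ _ (hψ x hx).1 _ hpB).2⟩
  let r : M → Slice ψ.source t (t p) := fun x =>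
    if hx : x ∈ ψ.source then ⟨ψ.symm (l (h x), t p), hrm x hx⟩ else ⟨p, hb.mem, rfl⟩
  have hrv : ∀ x ∈ ψ.source, (r x : M) = ψ.symm (l (h x), t p) := fun x hx => by
    simp only [r, dif_pos hx]
  have hψl : ∀ x ∈ ψ.source, ψ.symm (l (h x), t x) = x := fun x hx => by
    rw [← hb.apply x hx, ψ.left_inv hx]
  have hlh : ContinuousOn (fun x => l (h x)) ψ.source :=
    l.continuous.comp_continuousOn hC'.smooth_fst.continuousOn
  have hψc : ContinuousOn ψ.symm (U ×ˢ B) := by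
    rw [← hb.target]; exact ψ.continuousOn_symm
  have hr : ContinuousOn r ψ.source := by
    refine Topology.IsInducing.subtypeVal.continuousOn_iff.2 ?_
    refine ContinuousOn.congr (f := fun x => ψ.symm (l (h x), t p)) ?_ hrv
    exact hψc.comp (hlh.prodMk continuousOn_const) fun x hx => ⟨(hψ x hx).1, hpB⟩
  have hrh : ∀ x ∈ ψ.source, h (r x) = h x := fun x hx => by
    rw [hrv x hx, hb.const _ (hψ x hx).1 _ hpB _ (hψ x hx).2, hψl x hx]
  have hconn : ConnectedSpace (Slice ψ.source t (t p)) := by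
    have : PreconnectedSpace (Slice ψ.source t (t p)) := by
      refine ⟨?_⟩
      -- The base must be connected; within the box, the slice is the image of a ball.
      have h1 : IsPreconnected ((fun y => r (ψ.symm (y, t p))) '' U) := by
        refine (convex_ball _ _).isPreconnected.image _ ?_
        exact hr.comp (hψc.comp (by fun_prop) fun y hy => ⟨hy, hpB⟩)
          fun y hy => ψ.map_target (htar y hy _ hpB)
      refine (eq_univ_of_forall fun x => ?_) ▸ h1
      refine ⟨l (h x), (hψ x x.2.1).1, Subtype.ext ?_⟩
      have h2 : ψ.symm (l (h x), t p) = x := by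
        have := hψl x x.2.1
        rwa [x.2.2] at this
      change ((r (ψ.symm (l (h x), t p)) : Slice ψ.source t (t p)) : M) = x
      rw [h2, hrv _ x.2.1, h2]
    exact ⟨⟨⟨p, hb.mem, rfl⟩⟩⟩
  obtain ⟨C, Φ, h1, h2, -⟩ := hC'.exists_generalizedCone hf hκ ha (hC.mem p hp) hm hn (t p)
    (B := B) isOpen_ball (fun x hx => (hψ x hx).2) r hr hrh
    (fun q => ψ.symm (l (h q.1), q.2))
    (hψc.comp ((hlh.comp (continuous_subtype_val.comp continuous_fst).continuousOn
      fun q _ => q.1.2.1).prodMk continuousOn_snd) fun q hq => ⟨(hψ _ q.1.2.1).1, hq.2⟩)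
    (fun q hq => ψ.map_target (htar _ (hψ _ q.1.2.1).1 _ hq))
    (fun q hq => (happ _ (hψ _ q.1.2.1).1 _ hq).2)
    (fun q hq => Subtype.ext (by
      rw [hrv _ (ψ.map_target (htar _ (hψ _ q.1.2.1).1 _ hq)), (happ _ (hψ _ q.1.2.1).1 _ hq).1]
      have := hψl q.1 q.1.2.1
      rwa [q.1.2.2] at this))
    (fun x hx => by rw [hrh x hx, hψl x hx])
  exact ⟨C, Φ, h1 ▸ hb.mem, h2⟩

end ConeCharts

/-! ### Base point and fibre coordinate from the heights of `f` -/

section ConeCharts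

open Set Metric Filter Topology

local notation "⟪" x ", " y "⟫" => inner ℝ x y

variable {m n ν : ℕ} {M : Type*} [TopologicalSpace M]
  [ChartedSpace (EuclideanSpace ℝ (Fin m)) M]
  {a : EuclideanSpace ℝ (Fin ν)} {κ : EuclideanSpace ℝ (Fin ν) →L[ℝ] Lor n} {f : M → Lor n}

/-- The heights of a point over the hyperplanes orthogonal to a cone frame. -/
theorem exists_heightMap (κ : EuclideanSpace ℝ (Fin ν) →L[ℝ] Lor n) :
    ∃ H : Lor n →L[ℝ] EuclideanSpace ℝ (Fin ν), ∀ y s, ⟪H y, s⟫ = lor y (κ s) := by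
  let H : Lor n →ₗ[ℝ] EuclideanSpace ℝ (Fin ν) :=
    { toFun := fun y => ∑ j, lor y (κ (EuclideanSpace.single j 1)) • EuclideanSpace.single j (1 : ℝ)
      map_add' := fun x y => by
        simp only [lor_add_left, add_smul, Finset.sum_add_distrib]
      map_smul' := fun c y => by
        simp only [lor_smul_left, mul_smul, Finset.smul_sum, RingHom.id_apply] }
  refine ⟨H.toContinuousLinearMap, fun y s => ?_⟩
  have h1 : lor y (κ s) = ∑ j, s j * lor y (κ (EuclideanSpace.single j 1)) := by
    conv_lhs => rw [← (EuclideanSpace.basisFun (Fin ν) ℝ).sum_repr s, map_sum, lor_sum_right]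
    simp [lor_smul_right]
  rw [h1]
  change ⟪∑ j, lor y (κ (EuclideanSpace.single j 1)) • EuclideanSpace.single j (1 : ℝ), s⟫ = _
  rw [sum_inner]
  refine Finset.sum_congr rfl fun j _ => ?_
  rw [real_inner_smul_left, EuclideanSpace.inner_single_left]
  simp [mul_comm]

theorem coneMap_eq_smul_add (z : Lor n) (t : EuclideanSpace ℝ (Fin ν)) :
    coneMap a κ z t = coneFactor a t • z + κ (hyS (‖t‖ ^ 2) • t) := by
  rw [coneMap, map_smul]

theorem contDiff_hyS_smul :
    ContDiff ℝ ∞ fun t : EuclideanSpace ℝ (Fin ν) => hyS (‖t‖ ^ 2) • t :=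
  contDiff_hyS_norm.smul contDiff_id

theorem mfderiv_comp_apply {W : Type*} [NormedAddCommGroup W] [NormedSpace ℝ W] {x : M}
    (hf : MDifferentiableAt (𝓡 m) 𝓘(ℝ, Lor n) f x) {G : Lor n → W}
    (hG : DifferentiableAt ℝ G (f x)) (X : TangentSpace (𝓡 m) x) :
    mfderiv (𝓡 m) 𝓘(ℝ, W) (G ∘ f) x X = fderiv ℝ G (f x) (push f x X) := by
  rw [mfderiv_comp x hG.mdifferentiableAt hf, mfderiv_eq_fderiv]
  rfl

theorem fderiv_push_eq_zero {W : Type*} [NormedAddCommGroup W] [NormedSpace ℝ W] {x : M}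
    (hf : MDifferentiableAt (𝓡 m) 𝓘(ℝ, Lor n) f x) {G : Lor n → W}
    (hG : DifferentiableAt ℝ G (f x)) {c : W} (hc : ∀ᶠ y in 𝓝 x, G (f y) = c)
    (X : TangentSpace (𝓡 m) x) : fderiv ℝ G (f x) (push f x X) = 0 := by
  rw [← mfderiv_comp_apply hf hG]
  have : G ∘ f =ᶠ[𝓝 x] fun _ => c := hc
  rw [this.mfderiv_eq, mfderiv_const]
  rfl

/-- Inverting the heights gives the fibre coordinate, and solving `f = coneMap a κ h t` for `h`
gives the base point. The content is that `h` is constant along `𝒟`, so that `t` must be an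
isomorphism there by injectivity of `f_*` and a dimension count. -/
theorem isConeChart_of_heights [IsManifold (𝓡 m) ∞ M] (hf : IsHypImmersion m f)
    (hκ : IsConeFrame a κ)
    {O : Set M} (hO : IsOpen O)
    (hD : ∀ x ∈ O, ∀ X : TangentSpace (𝓡 m) x, X ∈ relNullity f x ↔
      ∃ b : ℝ, push f x X + b • f x ∈ LinearMap.range κ.toLinearMap)
    (hν : ∀ x, Module.finrank ℝ (relNullity (d := m) f x) = ν)
    {H : Lor n →L[ℝ] EuclideanSpace ℝ (Fin ν)} (hH : ∀ y s, ⟪H y, s⟫ = lor y (κ s))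
    {T : EuclideanSpace ℝ (Fin ν) → EuclideanSpace ℝ (Fin ν)}
    (hTs : ∀ x ∈ O, ContDiffAt ℝ ∞ T (H (f x)))
    (hT : ∀ x ∈ O, heights a (T (H (f x))) = H (f x))
    (hφ : ∀ x ∈ O, coneFactor a (T (H (f x))) ≠ 0) :
    IsConeChart m a κ f O
      (fun x => (coneFactor a (T (H (f x))))⁻¹ •
        (f x - hyS (‖T (H (f x))‖ ^ 2) • κ (T (H (f x))))) (fun x => T (H (f x))) := by
  let τ : Lor n → EuclideanSpace ℝ (Fin ν) := fun y => T (H y)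
  let J : Lor n → Lor n := fun y => (coneFactor a (τ y))⁻¹ • (y - hyS (‖τ y‖ ^ 2) • κ (τ y))
  have hτs : ∀ x ∈ O, ContDiffAt ℝ ∞ τ (f x) := fun x hx => (hTs x hx).comp _ H.contDiff.contDiffAt
  have hJs : ∀ x ∈ O, ContDiffAt ℝ ∞ J (f x) := fun x hx => by
    refine ContDiffAt.smul (((contDiff_coneFactor a).contDiffAt.comp _ (hτs x hx)).inv (hφ x hx)) ?_
    exact contDiffAt_id.sub ((contDiff_hyS_norm.contDiffAt.comp _ (hτs x hx)).smul
      (κ.contDiff.contDiffAt.comp _ (hτs x hx)))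
  have hτd : ∀ x ∈ O, DifferentiableAt ℝ τ (f x) := fun x hx =>
    (hτs x hx).differentiableAt (by simp)
  have hJd : ∀ x ∈ O, DifferentiableAt ℝ J (f x) := fun x hx =>
    (hJs x hx).differentiableAt (by simp)
  have hfd : ∀ x, MDifferentiableAt (𝓡 m) 𝓘(ℝ, Lor n) f x := fun x =>
    (hf.smooth x).mdifferentiableAt (by simp)
  have hmem : ∀ x ∈ O, J (f x) ∈ umbSet a κ := fun x hx =>
    mem_umbSet_of_heights hκ (hf.mem x) (fun s => by rw [← hH, ← hT x hx]) (hφ x hx)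
  have hrec : ∀ x ∈ O, coneMap a κ (J (f x)) (τ (f x)) = f x := fun x hx =>
    coneMap_recover (hφ x hx)
  have hder : ∀ x ∈ O, ∀ Y, Y = coneFactor a (τ (f x)) • fderiv ℝ J (f x) Y +
      fderiv ℝ (coneFactor a) (τ (f x)) (fderiv ℝ τ (f x) Y) • J (f x) +
      κ (fderiv ℝ (fun t : EuclideanSpace ℝ (Fin ν) => hyS (‖t‖ ^ 2) • t) (τ (f x))
        (fderiv ℝ τ (f x) Y)) := by
    intro x hx Y
    have h1 : HasFDerivAt (fun y => coneFactor a (τ y) • J y + κ (hyS (‖τ y‖ ^ 2) • τ y)) _ (f x) :=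
      (((((contDiff_coneFactor a).differentiable (by simp)).differentiableAt.hasFDerivAt.comp _
        (hτd x hx).hasFDerivAt)).smul (hJd x hx).hasFDerivAt).add
      (κ.hasFDerivAt.comp _ ((contDiff_hyS_smul.differentiable (by simp)).differentiableAt.hasFDerivAt.comp
        _ (hτd x hx).hasFDerivAt))
    have h2 : (fun y => coneFactor a (τ y) • J y + κ (hyS (‖τ y‖ ^ 2) • τ y)) =ᶠ[𝓝 (f x)] id := by
      have h3 : ContinuousAt (fun y => coneFactor a (τ y)) (f x) :=
        (contDiff_coneFactor a).continuous.continuousAt.comp (hτd x hx).continuousAt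
      filter_upwards [h3.eventually_ne (hφ x hx)] with y hy
      rw [← coneMap_eq_smul_add]
      exact coneMap_recover hy
    have h3 := congrArg (fun L => L Y) (h1.unique ((hasFDerivAt_id (𝕜 := ℝ) (f x)).congr_of_eventuallyEq h2))
    simpa using h3.symm
  have hJJ : ∀ x ∈ O, ∀ X : TangentSpace (𝓡 m) x,
      lor (fderiv ℝ J (f x) (push f x X)) (J (f x)) = 0 := by
    intro x hx X
    have := fderiv_push_eq_zero (G := fun y => lor (J y) (J y)) (c := -1) (hfd x)
      ((contDiff_lor.contDiffAt.comp (f x) ((hJs x hx).prodMk (hJs x hx))).differentiableAt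
        (by simp)) (by filter_upwards [hO.mem_nhds hx] with y hy using (hmem y hy).1.1) X
    rw [fderiv_lor (hJd x hx) (hJd x hx), lor_comm (J (f x))] at this
    linarith
  have hJκ : ∀ x ∈ O, ∀ X : TangentSpace (𝓡 m) x, ∀ s,
      lor (fderiv ℝ J (f x) (push f x X)) (κ s) = 0 := by
    intro x hx X s
    have := fderiv_push_eq_zero (G := fun y => lor (J y) (κ s)) (c := ⟪a, s⟫) (hfd x)
      ((contDiff_lor.contDiffAt.comp (f x) ((hJs x hx).prodMk contDiffAt_const)).differentiableAt
        (by simp)) (by filter_upwards [hO.mem_nhds hx] with y hy using (hmem y hy).2 s) X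
    rw [fderiv_lor (hJd x hx) (differentiableAt_const _)] at this
    simpa [lor_zero_right] using this
  -- For `X ∈ 𝒟` both `f_* X` and `f` lie in `K + ℝ z`, hence so does the derivative of the base
  -- point. It is also orthogonal to `K` and to `z`, and the product is nondegenerate on `K + ℝ z`.
  have hJD : ∀ x ∈ O, ∀ X ∈ relNullity (d := m) f x, fderiv ℝ J (f x) (push f x X) = 0 := by
    intro x hx X hX
    obtain ⟨b, s₁, hs₁⟩ := (hD x hx X).1 hX
    have hs₁' : κ s₁ = push f x X + b • f x := hs₁
    have h1 := hder x hx (push f x X)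
    have h2 := hrec x hx
    rw [coneMap_eq_smul_add] at h2
    set Y := push f x X
    set z := J (f x)
    set φ := coneFactor a (τ (f x)) with hφd
    set e := fderiv ℝ (coneFactor a) (τ (f x)) (fderiv ℝ τ (f x) Y)
    set w := fderiv ℝ (fun t : EuclideanSpace ℝ (Fin ν) => hyS (‖t‖ ^ 2) • t) (τ (f x))
        (fderiv ℝ τ (f x) Y)
    set w₀ := hyS (‖τ (f x)‖ ^ 2) • τ (f x)
    obtain ⟨s, c, hsc⟩ : ∃ (s : EuclideanSpace ℝ (Fin ν)) (c : ℝ),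
        fderiv ℝ J (f x) Y = κ s + c • z := by
      refine ⟨φ⁻¹ • (s₁ - b • w₀ - w), φ⁻¹ * (-(b * φ) - e), ?_⟩
      have h3 : φ • fderiv ℝ J (f x) Y = κ (s₁ - b • w₀ - w) + (-(b * φ) - e) • z := by
        have e1 : φ • fderiv ℝ J (f x) Y = Y - e • z - κ w := by
          rw [eq_sub_iff_add_eq, eq_sub_iff_add_eq]
          refine Eq.trans ?_ h1.symm
          abel
        rw [e1, map_sub, map_sub, map_smul, hs₁', ← h2]
        module
      rw [map_smul, mul_smul, ← smul_add, ← h3, smul_smul, inv_mul_cancel₀ (hφ x hx), one_smul]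
    have h4 := hJJ x hx X
    have h5 := hJκ x hx X s
    have h6 := (hmem x hx).1.1
    have h7 := (hmem x hx).2 s
    change lor z z = -1 at h6
    change lor z (κ s) = _ at h7
    change lor (fderiv ℝ J (f x) Y) z = 0 at h4
    change lor (fderiv ℝ J (f x) Y) (κ s) = 0 at h5
    rw [hsc, lor_add_left, lor_smul_left, lor_comm, h6, h7] at h4
    rw [hsc, lor_add_left, lor_smul_left, h7, hκ s s, real_inner_self_eq_norm_sq] at h5
    have hc : c = ⟪a, s⟫ := by linarith
    rw [hc] at h5
    have hs : s = 0 := by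
      have : ‖s‖ ^ 2 = 0 := by linarith
      simpa using this
    rw [hsc, hc, hs]
    simp
  have hinj : ∀ x ∈ O, ∀ X : TangentSpace (𝓡 m) x, fderiv ℝ J (f x) (push f x X) = 0 →
      fderiv ℝ τ (f x) (push f x X) = 0 → X = 0 := by
    intro x hx X h1 h2
    have h3 := hder x hx (push f x X)
    rw [h1, h2] at h3
    refine hf.injective_push x (h3.trans ?_)
    rw [push_zero]
    simp
  refine ⟨⟨hO, ?_, ?_, ?_, ?_⟩, hmem, fun x hx => (hrec x hx).symm⟩
  · intro x hx
    exact ((hJs x hx).contMDiffAt.comp x (hf.smooth x)).contMDiffWithinAt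
  · intro x hx
    exact ((hτs x hx).contMDiffAt.comp x (hf.smooth x)).contMDiffWithinAt
  · intro x hx X h1 h2
    exact hinj x hx X ((mfderiv_comp_apply (hfd x) (hJd x hx) X).symm.trans h1)
      ((mfderiv_comp_apply (hfd x) (hτd x hx) X).symm.trans h2)
  · intro x hx s
    let A : relNullity (d := m) f x →ₗ[ℝ] EuclideanSpace ℝ (Fin ν) :=
      ((fderiv ℝ τ (f x)).toLinearMap ∘ₗ (mfderiv (𝓡 m) 𝓘(ℝ, Lor n) f x).toLinearMap).domRestrict _
    have hA : Function.Injective A := by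
      rw [injective_iff_map_eq_zero]
      exact fun X hX => Subtype.ext (hinj x hx X (hJD x hx X X.2) hX)
    have : FiniteDimensional ℝ (TangentSpace (𝓡 m) x) :=
      inferInstanceAs (FiniteDimensional ℝ (EuclideanSpace ℝ (Fin m)))
    obtain ⟨X, hX⟩ := (LinearMap.injective_iff_surjective_of_finrank_eq_finrank
      (by rw [hν x, finrank_euclideanSpace_fin])).1 hA s
    exact ⟨X, (mfderiv_comp_apply (hfd x) (hJd x hx) X.1).trans (hJD x hx X X.2),
      (mfderiv_comp_apply (hfd x) (hτd x hx) X.1).trans hX⟩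

end ConeCharts

/-! ### The local theorem -/

section Local

open Set Metric Filter Topology

local notation "⟪" x ", " y "⟫" => inner ℝ x y

variable {m n ν : ℕ} {M : Type u} [TopologicalSpace M]
  [ChartedSpace (EuclideanSpace ℝ (Fin m)) M] {f : M → Lor n}

theorem IsHypImmersion.dim_le [IsManifold (𝓡 m) ∞ M] (hf : IsHypImmersion m f) (x : M) : m ≤ n := by
  let J : ℝ × TangentSpace (𝓡 m) x →ₗ[ℝ] Lor n :=
    (LinearMap.toSpanSingleton ℝ _ (f x)).coprod
      (mfderiv (𝓡 m) 𝓘(ℝ, Lor n) f x).toLinearMap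
  have hJi : Function.Injective J := by
    rw [injective_iff_map_eq_zero]
    rintro ⟨b, X⟩ h
    obtain ⟨h1, h2⟩ := smul_add_push_eq_zero hf (show b • f x + push f x X = 0 from h)
    exact Prod.ext h1 h2
  have : FiniteDimensional ℝ (TangentSpace (𝓡 m) x) :=
    inferInstanceAs (FiniteDimensional ℝ (EuclideanSpace ℝ (Fin m)))
  have h1 := LinearMap.finrank_le_finrank_of_injective hJi
  have h2 : Module.finrank ℝ (TangentSpace (𝓡 m) x) = m :=
    finrank_euclideanSpace_fin (𝕜 := ℝ) (n := m)
  rw [Module.finrank_prod, h2, Module.finrank_self, finrank_euclideanSpace_fin] at h1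
  omega

theorem isLocallyGeneralizedCone [IsManifold (𝓡 m) ∞ M] [T2Space M] [SecondCountableTopology M]
    {g : RiemMetric m M} (hf : IsIsometricImmersion g f) (hν : 1 ≤ ν) (hνm : ν + 2 ≤ m)
    (hnull : ∀ x : M, Module.finrank ℝ (relNullity (d := m) f x) = ν)
    (humb : OrthUmbilical g (relNullity (d := m) f)) :
    IsLocallyGeneralizedCone (m := m) ν f := by
  intro p
  obtain ⟨δ, hδ, humb⟩ := humb
  have hK : Module.finrank ℝ (conicSpace f δ p) = ν :=
    (finrank_conicSpace hf.toIsHypImmersion δ p).trans (hnull p)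
  obtain ⟨a, κ, q, t₀, hκ, hq, hr, ha, hqt, hφ⟩ := exists_coneFrame_through (hf.mem p)
    (notMem_conicSpace hf.toIsHypImmersion δ p) hK hν
  obtain ⟨H, hH⟩ := exists_heightMap κ
  obtain ⟨W, T, hWo, hW, hTt, hTs, hT⟩ := exists_heights_inverse hφ
  have hHp : H (f p) = heights a t₀ := by
    refine ext_inner_right ℝ fun s => ?_
    rw [hH, ← hqt, lor_coneMap hκ hq]
  obtain ⟨O₁, hO₁, hO₁o, hpO₁⟩ := eventually_nhds_iff.1
    (conicSpace_eventually_eq hf hνm hnull hδ.1 humb p)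
  have hHf : Continuous fun x => H (f x) := H.continuous.comp hf.smooth.continuous
  have hO : IsOpen (O₁ ∩ (fun x => H (f x)) ⁻¹' W) := hO₁o.inter (hWo.preimage hHf)
  have hC := isConeChart_of_heights hf.toIsHypImmersion hκ hO
    (fun x hx X => by
      rw [mem_relNullity_iff hf.toIsHypImmersion δ x X, hr, hO₁ x hx.1]) hnull hH
    (fun x hx => hTs.contDiffAt (hWo.mem_nhds hx.2)) (fun x hx => (hT _ hx.2).1)
    (fun x hx => (hT _ hx.2).2)
  have hmn := hf.dim_le p
  exact hC.exists_local hf.toIsHypImmersion hκ ha (Nat.sub_add_cancel (by omega)) (by omega)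
    ⟨hpO₁, by rw [mem_preimage, hHp]; exact hW⟩

end Local

/-! ### Radial curves of a splitting and their dependence on parameters -/

section Lifting

open Set Metric Filter Topology

variable {m n k ν : ℕ} {M : Type*} [TopologicalSpace M]
  [ChartedSpace (EuclideanSpace ℝ (Fin m)) M] [IsManifold (𝓡 m) ∞ M]
  {V : Type*} [NormedAddCommGroup V] [NormedSpace ℝ V] [FiniteDimensional ℝ V]
  {h : M → V} {t : M → EuclideanSpace ℝ (Fin ν)}

theorem IsSplitting.isLocallyInjective (hS : IsSplitting m univ h t) (hm : k + ν = m) :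
    IsLocallyInjective fun x => (h x, t x) := by
  intro x
  obtain ⟨ψ, l, r, hb⟩ := hS.exists_box hm (mem_univ x)
  refine ⟨ψ.source, ψ.open_source, hb.mem, fun y hy z hz hyz => ψ.injOn hy hz ?_⟩
  obtain ⟨h1, h2⟩ := Prod.mk.inj hyz
  rw [hb.apply y hy, hb.apply z hz, h1, h2]

/-- A curve along which the first component of a splitting is constant, and the second one is
`τ ↦ τ v`. -/
structure IsRadial (h : M → V) (t : M → EuclideanSpace ℝ (Fin ν)) (w : V)
    (v : EuclideanSpace ℝ (Fin ν)) (γ : ℝ → M) : Prop where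
  continuous : Continuous γ
  fst : ∀ τ, h (γ τ) = w
  snd : ∀ τ, t (γ τ) = τ • v

theorem IsRadial.unique [T2Space M] (hS : IsSplitting m univ h t) (hm : k + ν = m) {w : V}
    {v : EuclideanSpace ℝ (Fin ν)} {γ γ' : ℝ → M} (hγ : IsRadial h t w v γ)
    (hγ' : IsRadial h t w v γ') {τ₀ : ℝ} (h0 : γ τ₀ = γ' τ₀) : γ = γ' :=
  (T2Space.isSeparatedMap _).eq_of_comp_eq (hS.isLocallyInjective hm) hγ.continuous hγ'.continuous
    (funext fun τ => Prod.ext ((hγ.fst τ).trans (hγ'.fst τ).symm)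
      ((hγ.snd τ).trans (hγ'.snd τ).symm)) τ₀ h0

/-- The set of times at which the family is continuous at `z₀` is open and closed. Within one box
the nearby curves are given by the inverse chart, so continuity at one time of the box passes to
every other. -/
theorem continuous_radial [T2Space M] (hS : IsSplitting m univ h t) (hm : k + ν = m)
    {Z : Type*} [TopologicalSpace Z] {v : Z → EuclideanSpace ℝ (Fin ν)} (hv : Continuous v)
    {w : Z → V} {γ : Z → ℝ → M} (hγ : ∀ z, IsRadial h t (w z) (v z) (γ z)) {τ₀ : ℝ}
    (h0 : Continuous fun z => γ z τ₀) (τ₁ : ℝ) : Continuous fun z => γ z τ₁ := by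
  have hh : Continuous h := continuousOn_univ.1 hS.smooth_fst.continuousOn
  have hw : Continuous w := by
    have : w = fun z => h (γ z τ₀) := funext fun z => ((hγ z).fst τ₀).symm
    rw [this]; exact hh.comp h0
  rw [continuous_iff_continuousAt] at h0 ⊢
  intro z₀
  have key : ∀ τ', ∃ I ∈ 𝓝 τ', ∀ τ₁ ∈ I, ∀ τ₂ ∈ I, ContinuousAt (fun z => γ z τ₁) z₀ →
      ContinuousAt (fun z => γ z τ₂) z₀ := by
    intro τ'
    obtain ⟨ψ, l, r, hb⟩ := hS.exists_box hm (mem_univ (γ z₀ τ'))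
    refine ⟨γ z₀ ⁻¹' ψ.source, (hγ z₀).continuous.continuousAt.preimage_mem_nhds
      (ψ.open_source.mem_nhds hb.mem), fun τ₁ h₁ τ₂ h₂ hc => ?_⟩
    have hmem : ∀ x ∈ ψ.source, l (h x) ∈ ball (l (h (γ z₀ τ'))) r ∧
        t x ∈ ball (t (γ z₀ τ')) r := fun x hx => by
      have h2 := ψ.map_source hx
      rw [hb.target, hb.apply x hx] at h2
      exact h2
    set U := ball (l (h (γ z₀ τ'))) r
    set B := ball (t (γ z₀ τ')) r with hBd
    have htg : ψ.target = U ×ˢ B := hb.target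
    have hlU : l (w z₀) ∈ U := (hγ z₀).fst τ₁ ▸ (hmem _ h₁).1
    have hsB : ∀ τ, γ z₀ τ ∈ ψ.source → τ • v z₀ ∈ B := fun τ hτ =>
      (hγ z₀).snd τ ▸ (hmem _ hτ).2
    have e1 : ∀ᶠ z in 𝓝 z₀, γ z τ₁ ∈ ψ.source := hc.eventually (ψ.open_source.mem_nhds h₁)
    have e2 : ∀ᶠ z in 𝓝 z₀, l (w z) ∈ U :=
      (l.continuous.comp hw).continuousAt.eventually (isOpen_ball.mem_nhds hlU)
    have e3 : ∀ τ, γ z₀ τ ∈ ψ.source → ∀ᶠ z in 𝓝 z₀, τ • v z ∈ B := fun τ hτ => by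
      have hc : Continuous fun z => τ • v z := hv.const_smul τ
      exact (isOpen_ball.preimage hc).mem_nhds (hsB τ hτ)
    have htar : ∀ y ∈ U, ∀ s ∈ B, (y, s) ∈ ψ.target := fun y hy s hs => by
      rw [htg]; exact mk_mem_prod hy hs
    have heq : ∀ᶠ z in 𝓝 z₀, γ z τ₂ = ψ.symm (l (w z), τ₂ • v z) := by
      filter_upwards [e1, e2, e3 τ₁ h₁, e3 τ₂ h₂] with z hz1 hz2 hz3 hz4
      -- Convexity of the ball keeps the segment inside the box, so the curve can be compared with
      -- the one given by the chart on the whole interval.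
      have hB : ∀ τ ∈ uIcc τ₁ τ₂, τ • v z ∈ B := by
        have : Convex ℝ ((fun τ : ℝ => τ • v z) ⁻¹' B) :=
          (convex_ball _ _).linear_preimage (LinearMap.toSpanSingleton ℝ _ (v z))
        exact fun τ hτ => this.ordConnected.uIcc_subset hz3 hz4 hτ
      have hstart : γ z τ₁ = ψ.symm (l (w z), τ₁ • v z) := by
        rw [← ψ.left_inv hz1, hb.apply _ hz1, (hγ z).fst, (hγ z).snd]
      have hη : ContinuousOn (fun τ => ψ.symm (l (w z), τ • v z)) (uIcc τ₁ τ₂) :=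
        ψ.continuousOn_symm.comp (Continuous.continuousOn (continuous_const.prodMk
          (continuous_id.smul continuous_const))) fun τ hτ => htar _ hz2 _ (hB τ hτ)
      refine (T2Space.isSeparatedMap _).eqOn_of_comp_eqOn (hS.isLocallyInjective hm)
        isPreconnected_uIcc (hγ z).continuous.continuousOn hη (fun τ hτ => ?_)
        left_mem_uIcc hstart right_mem_uIcc
      refine Prod.ext ?_ ?_
      · change h (γ z τ) = h (ψ.symm (l (w z), τ • v z))
        rw [hb.const _ hz2 _ (hB τ hτ) _ hz3, ← hstart, (hγ z).fst, (hγ z).fst]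
      · change t (γ z τ) = t (ψ.symm (l (w z), τ • v z))
        have h5 := htar _ hz2 _ (hB τ hτ)
        have h6 := hb.apply _ (ψ.map_target h5)
        rw [ψ.right_inv h5] at h6
        rw [(hγ z).snd]
        exact congrArg Prod.snd h6
    refine ContinuousAt.congr ?_ (heq.mono fun z hz => hz.symm)
    have hc : Continuous fun z => (l (w z), τ₂ • v z) :=
      (l.continuous.comp hw).prodMk (hv.const_smul τ₂)
    exact ContinuousAt.comp (f := fun z => (l (w z), τ₂ • v z)) (ψ.continuousOn_symm.continuousAt
      (ψ.open_target.mem_nhds (htar _ hlU _ (hsB τ₂ h₂)))) hc.continuousAt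
  have hclopen : IsClopen {τ | ContinuousAt (fun z => γ z τ) z₀} := by
    refine ⟨⟨isOpen_iff_mem_nhds.2 fun τ hτ => ?_⟩, isOpen_iff_mem_nhds.2 fun τ hτ => ?_⟩
    · obtain ⟨I, hI, hk⟩ := key τ
      filter_upwards [hI] with τ' hτ' hc using hτ (hk τ' hτ' τ (mem_of_mem_nhds hI) hc)
    · obtain ⟨I, hI, hk⟩ := key τ
      filter_upwards [hI] with τ' hτ' using hk τ (mem_of_mem_nhds hI) τ' hτ' hτ
  have := hclopen.eq_univ ⟨τ₀, h0 z₀⟩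
  exact (this ▸ mem_univ τ₁ : τ₁ ∈ {τ | ContinuousAt (fun z => γ z τ) z₀})

end Lifting

/-! ### The global product structure -/

section Global

open Set Metric Filter Topology

variable {m n k ν : ℕ} {M : Type u} [TopologicalSpace M]
  [ChartedSpace (EuclideanSpace ℝ (Fin m)) M] [IsManifold (𝓡 m) ∞ M] [T2Space M]
  [SecondCountableTopology M] [ConnectedSpace M]
  {a : EuclideanSpace ℝ (Fin ν)} {κ : EuclideanSpace ℝ (Fin ν) →L[ℝ] Lor n}
  {f h : M → Lor n} {t : M → EuclideanSpace ℝ (Fin ν)}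

/-- A cone chart defined on all of `M`, the fibres of which contain radial curves that are defined
for all times, makes `f` a generalized cone. -/
theorem IsConeChart.exists_global (hC : IsConeChart m a κ f univ h t)
    (hf : IsHypImmersion m f) (hκ : IsConeFrame a κ) (ha : a ≠ 0)
    (hm : k + ν = m) (hn : ν + 2 ≤ n)
    (hR : ∀ x v τ₀, t x = τ₀ • v → ∃ γ : ℝ → M, IsRadial h t (h x) v γ ∧ γ τ₀ = x) :
    ∃ (C : GeneralizedCone.{u} n k ν) (Φ : PartialDiffeomorph (𝓡 m) ((𝓡 k).prod (𝓡 ν)) M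
      (C.S × EuclideanSpace ℝ (Fin ν)) ∞), Φ.source = univ ∧ Φ.target = C.domain ∧
        C.CoincidesVia f Φ := by
  have hS := hC.toIsSplitting
  have ht : Continuous t := continuousOn_univ.1 hS.smooth_snd.continuousOn
  -- The radial curve through `x`, parametrized to pass through `x` at time one; its foot at time
  -- zero is the retraction to the fibre over `0`. The inverse follows the curve from the foot in
  -- the direction given by the fibre coordinate.
  choose α hα hα1 using fun x => hR x (t x) 1 (one_smul _ _).symm
  have hR0 : ∀ p : Slice univ t 0 × EuclideanSpace ℝ (Fin ν), t p.1 = (0 : ℝ) • p.2 := fun p => by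
    rw [zero_smul]; exact p.1.2.2
  choose β hβ hβ0 using fun p : Slice univ t 0 × EuclideanSpace ℝ (Fin ν) => hR p.1 p.2 0 (hR0 p)
  let r : M → Slice univ t 0 := fun x => ⟨α x 0, mem_univ _, by rw [(hα x).snd, zero_smul]⟩
  have hr : Continuous r := by
    refine Continuous.subtype_mk ?_ _
    exact continuous_radial hS hm ht hα (τ₀ := 1) (by simpa only [hα1] using continuous_id') 0
  have hrh : ∀ x, h (r x) = h x := fun x => (hα x).fst 0
  have hΨ : Continuous fun p => β p 1 := by
    refine continuous_radial hS hm continuous_snd hβ (τ₀ := 0) ?_ 1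
    simp only [hβ0]
    exact continuous_subtype_val.comp continuous_fst
  have hΨt : ∀ p, t (β p 1) = p.2 := fun p => by rw [(hβ p).snd, one_smul]
  have hΨr : ∀ p, r (β p 1) = p.1 := fun p => by
    have h1 := hα (β p 1)
    rw [hΨt, (hβ p).fst] at h1
    have h2 := h1.unique hS hm (hβ p) (hα1 (β p 1))
    refine Subtype.ext ?_
    change α (β p 1) 0 = p.1
    rw [h2, hβ0]
  have hΨl : ∀ x, β (r x, t x) 1 = x := fun x => by
    have h1 := hβ (r x, t x)
    have h3 : h (r x, t x).1 = h x := hrh x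
    rw [h3] at h1
    have h2 := h1.unique hS hm (hα x) (hβ0 (r x, t x))
    rw [h2, hα1]
  have : ConnectedSpace (Slice univ t 0) :=
    Function.Surjective.connectedSpace (f := r) (fun y => ⟨β (y, 0) 1, hΨr (y, 0)⟩) hr
  obtain ⟨p⟩ := (inferInstance : Nonempty M)
  obtain ⟨C, Φ, h1, h2, h3⟩ := hC.exists_generalizedCone hf hκ ha (hC.mem p (mem_univ p)) hm hn 0
    (B := univ) isOpen_univ (fun x _ => mem_univ _) r hr.continuousOn (fun x _ => hrh x)
    (fun p => β p 1) hΨ.continuousOn (fun p _ => mem_univ _) (fun p _ => hΨt p) (fun p _ => hΨr p)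
    (fun x _ => hΨl x)
  exact ⟨C, Φ, h1, h3 rfl, h2⟩

end Global

/-! ### Geodesics of complete leaves -/

section LeafGeodesics

open Set Metric Filter Topology

theorem unique_of_hasDerivAt_twice {E : Type*} [NormedAddCommGroup E] [NormedSpace ℝ E]
    {q τ₀ : ℝ} {e e' c c' : ℝ → E} (he : ∀ τ, HasDerivAt e (e' τ) τ)
    (he' : ∀ τ, HasDerivAt e' (q • e τ) τ) (hc : ∀ τ, HasDerivAt c (c' τ) τ)
    (hc' : ∀ τ, HasDerivAt c' (q • c τ) τ) (h0 : c τ₀ = e τ₀) (h0' : c' τ₀ = e' τ₀) : c = e := by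
  let L : E × E →L[ℝ] E × E :=
    (ContinuousLinearMap.snd ℝ E E).prod (q • ContinuousLinearMap.fst ℝ E E)
  have := ODE_solution_unique_univ (v := fun _ p => L p) (s := fun _ => univ)
    (f := fun τ => (c τ, c' τ)) (g := fun τ => (e τ, e' τ)) (t₀ := τ₀)
    (fun _ => L.lipschitz.lipschitzOnWith) (fun τ => ⟨(hc τ).prodMk (hc' τ), mem_univ _⟩)
    (fun τ => ⟨(he τ).prodMk (he' τ), mem_univ _⟩) (Prod.ext h0 h0')
  exact funext fun τ => congrArg Prod.fst (congrFun this τ)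

theorem hasDerivAt_mem_submodule {E : Type*} [NormedAddCommGroup E] [NormedSpace ℝ E]
    [FiniteDimensional ℝ E] {K : Submodule ℝ E} {u : ℝ → E} {u' : E} {τ : ℝ}
    (h : HasDerivAt u u' τ) (hu : ∀ τ, u τ ∈ K) : u' ∈ K := by
  by_contra hK
  obtain ⟨l, hl, hlK⟩ := K.exists_le_ker_of_notMem hK
  have h1 := l.toContinuousLinearMap.hasFDerivAt.comp_hasDerivAt τ h
  have h2 : (l.toContinuousLinearMap ∘ u) = fun _ => 0 := funext fun τ => hlK (hu τ)
  rw [h2] at h1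
  exact hl (h1.unique (hasDerivAt_const τ 0))

variable {m n : ℕ} {M : Type*} [TopologicalSpace M]
  [ChartedSpace (EuclideanSpace ℝ (Fin m)) M] [IsManifold (𝓡 m) ∞ M] {f : M → Lor n}

/-- In complete leaves, all hyperbolic geodesics tangent to a leaf lie in it. -/
theorem exists_leaf_curve (hf : IsHypImmersion m f)
    {D : ∀ x : M, Submodule ℝ (TangentSpace (𝓡 m) x)} {K : Submodule ℝ (Lor n)}
    (hD : ∀ x, ∀ X : TangentSpace (𝓡 m) x, X ∈ D x → ∃ b : ℝ, push f x X + b • f x ∈ K)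
    (hL : ∀ x w, lor w (f x) = 0 → (∃ b : ℝ, w + b • f x ∈ K) → ∃ T ∈ D x, push f x T = w)
    (hK : ∀ x, f x ∉ K) (hcomp : LeavesComplete f D) {x : M} {w : Lor n}
    (hw : lor w (f x) = 0) (hb : ∃ b : ℝ, w + b • f x ∈ K) {e e' : ℝ → Lor n} {τ₀ : ℝ}
    (he : ∀ τ, HasDerivAt e (e' τ) τ) (he' : ∀ τ, HasDerivAt e' (lor w w • e τ) τ)
    (h0 : e τ₀ = f x) (h0' : e' τ₀ = w) :
    ∃ γ : ℝ → M, Continuous γ ∧ γ τ₀ = x ∧ ∀ τ, f (γ τ) = e τ := by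
  obtain ⟨T, hT, hTw⟩ := hL x w hw hb
  obtain ⟨γ, hγ, hγ0, hγ0', hγD, hγa⟩ := hcomp x T hT
  set c := f ∘ γ with hc
  have hcs : ContDiff ℝ ∞ c := (hf.smooth.comp hγ).contDiff
  have hcs1 : ContDiff ℝ ∞ (deriv c) := hcs.iterate_deriv 1
  have hcd : ∀ τ, HasDerivAt c (deriv c τ) τ := fun τ =>
    ((hcs.differentiable (by simp)).differentiableAt).hasDerivAt
  have hcd1 : ∀ τ, HasDerivAt (deriv c) (deriv (deriv c) τ) τ := fun τ =>
    ((hcs1.differentiable (by simp)).differentiableAt).hasDerivAt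
  have hpush : ∀ τ, deriv c τ = push f (γ τ) (mfderiv 𝓘(ℝ, ℝ) (𝓡 m) γ τ (1 : ℝ)) := fun τ => by
    have h1 := mfderiv_comp τ ((hf.smooth (γ τ)).mdifferentiableAt (by simp))
      ((hγ τ).mdifferentiableAt (by simp))
    have h2 : mfderiv 𝓘(ℝ, ℝ) 𝓘(ℝ, Lor n) c τ = fderiv ℝ c τ := mfderiv_eq_fderiv
    rw [← fderiv_apply_one_eq_deriv, ← h2]
    exact congrArg (fun L => L (1 : ℝ)) h1
  have h1 : ∀ τ, lor (deriv c τ) (c τ) = 0 := fun τ => by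
    rw [hpush]; exact lor_push_self hf _ _
  have h2 : ∀ τ, lor (deriv (deriv c) τ) (c τ) + lor (deriv c τ) (deriv c τ) = 0 := fun τ => by
    rw [← deriv_lor (hcd1 τ).differentiableAt (hcd τ).differentiableAt]
    simp only [h1, deriv_const]
  have h3 : ∀ τ, ∃ b : ℝ, deriv (deriv c) τ + b • c τ ∈ K := fun τ => by
    obtain ⟨l, hl, hlK⟩ := K.exists_le_ker_of_notMem (hK (γ τ))
    have hl' : l (c τ) ≠ 0 := hl
    let L := l.toContinuousLinearMap
    -- The functional `l` vanishes on `K` but not at `c τ`. It eliminates the unknown multiple of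
    -- the position from `c' + b c ∈ K`, with no need for `b` to be differentiable, and the result
    -- can be differentiated inside `K`.
    have hu : ∀ s, l (c s) • deriv c s - l (deriv c s) • c s ∈ K := fun s => by
      obtain ⟨b, hb⟩ := hD _ _ (hγD s)
      have hb' : deriv c s + b • c s ∈ K := by rw [hpush]; exact hb
      have h4 : l (deriv c s + b • c s) = 0 := hlK hb'
      rw [map_add, map_smul, smul_eq_mul] at h4
      have h5 : l (c s) • deriv c s - l (deriv c s) • c s = l (c s) • (deriv c s + b • c s) := by
        rw [eq_neg_of_add_eq_zero_left h4]; module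
      rw [h5]
      exact K.smul_mem _ hb'
    have hder : HasDerivAt (fun s => L (c s) • deriv c s - L (deriv c s) • c s) _ τ :=
      ((L.hasFDerivAt.comp_hasDerivAt τ (hcd τ)).fun_smul (hcd1 τ)).fun_sub
        ((L.hasFDerivAt.comp_hasDerivAt τ (hcd1 τ)).fun_smul (hcd τ))
    have h6 := K.smul_mem (l (c τ))⁻¹ (hasDerivAt_mem_submodule hder hu)
    refine ⟨-((l (c τ))⁻¹ * l (deriv (deriv c) τ)), ?_⟩
    convert h6 using 1
    change _ = (l (c τ))⁻¹ • (l (c τ) • deriv (deriv c) τ + l (deriv c τ) • deriv c τ -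
      (l (deriv c τ) • deriv c τ + l (deriv (deriv c) τ) • c τ))
    rw [add_comm (l (deriv c τ) • deriv c τ), add_sub_add_right_eq_sub, smul_sub, smul_smul,
      inv_mul_cancel₀ hl', one_smul, smul_smul, neg_smul, sub_eq_add_neg]
  -- The acceleration in `ℍⁿ` lies in `K + ℝ c`, hence is tangent to the leaf, and by assumption it
  -- is orthogonal to the leaf. It therefore vanishes: geodesics of the leaves are geodesics of
  -- `ℍⁿ`.
  have h4 : ∀ τ, deriv (deriv c) τ = lor (deriv c τ) (deriv c τ) • c τ := fun τ => by
    set v := deriv (deriv c) τ + lor (deriv (deriv c) τ) (c τ) • c τ with hv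
    have hvc : lor v (c τ) = 0 := by
      have : lor (c τ) (c τ) = -1 := (hf.mem (γ τ)).1
      rw [hv, lor_add_left, lor_smul_left, this]; ring
    obtain ⟨b, hb⟩ := h3 τ
    obtain ⟨S, hS, hSv⟩ := hL (γ τ) v hvc ⟨b - lor (deriv (deriv c) τ) (c τ), by
      convert hb using 1
      rw [hv]
      change _ + (b - lor (deriv (deriv c) τ) (c τ)) • c τ = _
      module⟩
    have h5 := hγa τ S hS
    rw [hSv] at h5
    have h6 : v = 0 := eq_zero_of_lor_self (hf.mem (γ τ)) hvc h5
    rw [hv, eq_neg_of_add_eq_zero_left (h2 τ)] at h6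
    rw [eq_neg_of_add_eq_zero_left h6]
    module
  have h5 : ∀ τ, lor (deriv c τ) (deriv c τ) = lor w w := by
    have hd : ∀ τ, deriv (fun τ => lor (deriv c τ) (deriv c τ)) τ = 0 := fun τ => by
      rw [deriv_lor (hcd1 τ).differentiableAt (hcd1 τ).differentiableAt, h4, lor_smul_left,
        lor_smul_right, h1, lor_comm (c τ), h1]
      ring
    have hdiff : Differentiable ℝ fun τ => lor (deriv c τ) (deriv c τ) :=
      (contDiff_lor.comp (hcs1.prodMk hcs1)).differentiable (by simp)
    intro τ
    have := is_const_of_deriv_eq_zero hdiff hd τ 0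
    rw [this, hγ0', hTw]
  -- The leaf geodesic starts at time zero and is shifted to start at `τ₀`; both curves solve the
  -- same linear equation with the same initial data.
  have h6 : (fun τ => c (τ - τ₀)) = e := by
    refine unique_of_hasDerivAt_twice he he' (c' := fun τ => deriv c (τ - τ₀)) (τ₀ := τ₀)
      (fun τ => ?_) (fun τ => ?_) ?_ ?_
    · exact (hcd _).comp_sub_const τ τ₀
    · have := (hcd1 _).comp_sub_const τ τ₀
      rwa [h4, h5] at this
    · simp only [sub_self, hc, Function.comp, hγ0, h0]
    · simp only [sub_self, hγ0', hTw, h0']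
  exact ⟨fun τ => γ (τ - τ₀), hγ.continuous.comp (continuous_id.sub continuous_const),
    by simp only [sub_self, hγ0], fun τ => congrFun h6 τ⟩

end LeafGeodesics

/-! ### The global theorem -/

section Global

open Set Metric Filter Topology

local notation "⟪" x ", " y "⟫" => inner ℝ x y

variable {m n ν : ℕ}

/-- The hyperbolic geodesic with initial point `z` and initial velocity `N`, where `‖N‖ = r`. -/
theorem hasDerivAt_geodesic {E : Type*} [NormedAddCommGroup E] [NormedSpace ℝ E] (z N : E) {r : ℝ}
    (hr : r ≠ 0) (τ : ℝ) :
    HasDerivAt (fun τ => Real.cosh (r * τ) • z + (Real.sinh (r * τ) / r) • N)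
      ((r * Real.sinh (r * τ)) • z + Real.cosh (r * τ) • N) τ ∧
    HasDerivAt (fun τ => (r * Real.sinh (r * τ)) • z + Real.cosh (r * τ) • N)
      (r ^ 2 • (Real.cosh (r * τ) • z + (Real.sinh (r * τ) / r) • N)) τ := by
  have h0 : HasDerivAt (fun τ => r * τ) r τ := by simpa using (hasDerivAt_id τ).const_mul r
  have hc := h0.cosh
  have hs := h0.sinh
  constructor
  · convert! (hc.smul_const z).fun_add ((hs.div_const r).smul_const N) using 1
    rw [mul_div_cancel_right₀ _ hr, mul_comm r]
  · convert! ((hs.const_mul r).smul_const z).fun_add (hc.smul_const N) using 1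
    rw [smul_add, smul_smul, smul_smul]
    congr 2
    · ring
    · field_simp

variable {M : Type u} [TopologicalSpace M]
  [ChartedSpace (EuclideanSpace ℝ (Fin m)) M] [IsManifold (𝓡 m) ∞ M]
  {a : EuclideanSpace ℝ (Fin ν)} {κ : EuclideanSpace ℝ (Fin ν) →L[ℝ] Lor n} {f : M → Lor n}

/-- If the leaves are complete, then `K` contains no timelike vector, since otherwise a leaf
geodesic would reach `K`. -/
theorem norm_le_one_of_leavesComplete (hf : IsHypImmersion m f)
    {D : ∀ x : M, Submodule ℝ (TangentSpace (𝓡 m) x)} {K : Submodule ℝ (Lor n)}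
    (hD : ∀ x, ∀ X : TangentSpace (𝓡 m) x, X ∈ D x → ∃ b : ℝ, push f x X + b • f x ∈ K)
    (hL : ∀ x w, lor w (f x) = 0 → (∃ b : ℝ, w + b • f x ∈ K) → ∃ T ∈ D x, push f x T = w)
    (hK : ∀ x, f x ∉ K) (hcomp : LeavesComplete f D) (hκ : IsConeFrame a κ)
    (hκK : LinearMap.range κ.toLinearMap = K) (x : M) : ‖a‖ ≤ 1 := by
  by_contra! ha
  have hκa : lor (κ a) (κ a) < 0 := by
    rw [hκ a a, real_inner_self_eq_norm_sq]
    nlinarith [sq_nonneg ‖a‖, one_lt_pow₀ ha two_ne_zero]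
  have hx := hf.mem x
  have hne : lor (κ a) (f x) ≠ 0 := fun h0 => by
    have := lor_self_nonneg hx h0
    linarith
  obtain ⟨y, hyK, hyy, hxy⟩ : ∃ y ∈ K, lor y y = -1 ∧ lor y (f x) < 0 := by
    set s := √(-lor (κ a) (κ a)) with hs
    have hs0 : 0 < s := Real.sqrt_pos.2 (by linarith)
    have hss : s ^ 2 = -lor (κ a) (κ a) := Real.sq_sqrt (by linarith)
    have hκaK : κ a ∈ K := hκK ▸ ⟨a, rfl⟩
    have hyy : ∀ c : ℝ, c ^ 2 = 1 → lor ((c * s⁻¹) • κ a) ((c * s⁻¹) • κ a) = -1 := fun c hc => by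
      rw [lor_smul_left, lor_smul_right, show lor (κ a) (κ a) = -s ^ 2 by rw [hss, neg_neg]]
      field_simp
      linarith
    rcases lt_or_gt_of_ne hne with h | h
    · refine ⟨(1 * s⁻¹) • κ a, K.smul_mem _ hκaK, hyy 1 (by norm_num), ?_⟩
      rw [lor_smul_left, one_mul]
      exact mul_neg_of_pos_of_neg (inv_pos.2 hs0) h
    · refine ⟨(-1 * s⁻¹) • κ a, K.smul_mem _ hκaK, hyy (-1) (by norm_num), ?_⟩
      rw [lor_smul_left, neg_one_mul, neg_mul]
      exact neg_neg_of_pos (mul_pos (inv_pos.2 hs0) h)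
  set w := y + lor y (f x) • f x with hw
  have hwx : lor w (f x) = 0 := by
    rw [hw, lor_add_left, lor_smul_left, hx.1]; ring
  have hww : lor w w = lor y (f x) ^ 2 - 1 := by
    rw [hw, lor_add_left, lor_add_right, lor_add_right, lor_smul_left, lor_smul_left,
      lor_smul_right, lor_smul_right, lor_comm (f x) y, hx.1, hyy]; ring
  have hw0 : w ≠ 0 := fun h0 => hK x (by
    have h1 : y = -(lor y (f x) • f x) := eq_neg_of_add_eq_zero_left h0
    rw [h1, K.neg_mem_iff, K.smul_mem_iff hxy.ne] at hyK
    exact hyK)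
  have hpos := lor_self_pos hx hwx hw0
  set r := √(lor w w) with hr
  have hr0 : 0 < r := Real.sqrt_pos.2 hpos
  have hrr : r ^ 2 = lor w w := Real.sq_sqrt hpos.le
  obtain ⟨γ, -, -, hγ⟩ := exists_leaf_curve hf hD hL hK hcomp hwx
    ⟨-lor y (f x), by rw [hw, neg_smul, add_neg_cancel_right]; exact hyK⟩ (τ₀ := 0)
    (fun τ => (hasDerivAt_geodesic (f x) w hr0.ne' τ).1)
    (fun τ => hrr ▸ (hasDerivAt_geodesic (f x) w hr0.ne' τ).2) (by simp) (by simp)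
  -- With `r² = ⟨y, f x⟩² - 1`, the geodesic is at this time `-⟨y, f x⟩ f x + w`, which is `y ∈ K`,
  -- although `f` avoids `K`.
  have h1 := hγ (Real.arsinh r / r)
  rw [mul_div_cancel₀ _ hr0.ne', Real.sinh_arsinh, Real.cosh_arsinh, div_self hr0.ne', one_smul,
    hrr, hww, show √(1 + (lor y (f x) ^ 2 - 1)) = -lor y (f x) by
      rw [add_sub_cancel, Real.sqrt_sq_eq_abs, abs_of_neg hxy], hw, neg_smul,
    add_comm y, neg_add_cancel_left] at h1
  exact hK _ (h1 ▸ hyK)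

/-- The radial curves of a cone are geodesics of the leaves. -/
theorem exists_radial_curve (hf : IsHypImmersion m f)
    {D : ∀ x : M, Submodule ℝ (TangentSpace (𝓡 m) x)} {K : Submodule ℝ (Lor n)}
    (hD : ∀ x, ∀ X : TangentSpace (𝓡 m) x, X ∈ D x → ∃ b : ℝ, push f x X + b • f x ∈ K)
    (hL : ∀ x w, lor w (f x) = 0 → (∃ b : ℝ, w + b • f x ∈ K) → ∃ T ∈ D x, push f x T = w)
    (hK : ∀ x, f x ∉ K) (hcomp : LeavesComplete f D) (hκ : IsConeFrame a κ)
    (hκK : LinearMap.range κ.toLinearMap = K) {x : M} {z : Lor n} (hz : z ∈ umbSet a κ)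
    {v : EuclideanSpace ℝ (Fin ν)} {τ₀ : ℝ} (hx : f x = coneMap a κ z (τ₀ • v))
    (hφ : coneFactor a (τ₀ • v) ≠ 0) :
    ∃ γ : ℝ → M, Continuous γ ∧ γ τ₀ = x ∧ ∀ τ, f (γ τ) = coneMap a κ z (τ • v) := by
  rcases eq_or_ne v 0 with rfl | hv
  · exact ⟨fun _ => x, continuous_const, rfl, fun τ => by rw [hx, smul_zero, smul_zero]⟩
  have hr0 : ‖v‖ ≠ 0 := norm_ne_zero_iff.2 hv
  set r := ‖v‖ with hr
  set N := normalVec a κ z v with hN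
  have hzN : lor z N = 0 := by rw [lor_comm]; exact lor_normalVec_base hz v
  have hNz : lor N z = 0 := lor_normalVec_base hz v
  have hNN : lor N N = r ^ 2 := by rw [hN, lor_normalVec hκ hz, real_inner_self_eq_norm_sq]
  have he : ∀ τ : ℝ, coneMap a κ z (τ • v) =
      Real.cosh (r * τ) • z + (Real.sinh (r * τ) / r) • N := fun τ => by
    have h1 : ‖τ • v‖ ^ 2 = (r * τ) ^ 2 := by
      rw [norm_smul, mul_pow, Real.norm_eq_abs, sq_abs]; ring
    have h2 : normalVec a κ z (τ • v) = τ • N := by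
      simp only [hN, normalVec, map_smul, real_inner_smul_right, smul_add, smul_smul]
    rw [coneMap_eq, h1, hyC_sq, h2, smul_smul, ← hyS_sq]
    congr 2
    field_simp
  have hd := fun τ => hasDerivAt_geodesic z N hr0 τ
  set C := Real.cosh (r * τ₀)
  set S := Real.sinh (r * τ₀)
  have hCS : C ^ 2 - S ^ 2 = 1 := by rw [Real.cosh_sq]; ring
  have hx' : Real.cosh (r * τ₀) • z + (Real.sinh (r * τ₀) / r) • N = f x := by rw [hx, he]
  have hww : lor ((r * S) • z + C • N) ((r * S) • z + C • N) = r ^ 2 := by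
    simp only [lor_add_left, lor_add_right, lor_smul_left, lor_smul_right, hzN, hNz, hNN, hz.1.1]
    linear_combination r ^ 2 * hCS
  obtain ⟨γ, h1, h2, h3⟩ := exists_leaf_curve hf hD hL hK hcomp (x := x) (w := (r * S) • z + C • N)
    (by
      rw [← hx']
      simp only [lor_add_left, lor_add_right, lor_smul_left, lor_smul_right, hzN, hNz, hNN,
        hz.1.1]
      field_simp
      ring)
    (by
      -- The velocity has `z`-coefficient `r S + C ⟪a, v⟫` modulo `K`, and `f x` has the cone
      -- factor; this multiple of `f x` cancels `z`.
      refine ⟨-((r * S + C * ⟪a, v⟫) / coneFactor a (τ₀ • v)), ?_⟩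
      rw [hx, coneMap_eq_smul_add, ← hκK]
      refine ⟨C • v - ((r * S + C * ⟪a, v⟫) / coneFactor a (τ₀ • v)) •
        (hyS (‖τ₀ • v‖ ^ 2) • τ₀ • v), ?_⟩
      change κ _ = _
      have h1 := div_mul_cancel₀ (r * S + C * ⟪a, v⟫) hφ
      generalize (r * S + C * ⟪a, v⟫) / coneFactor a (τ₀ • v) = b at h1 ⊢
      have h2 : b • coneFactor a (τ₀ • v) • z = (r * S) • z + (C * ⟪a, v⟫) • z := by
        rw [smul_smul, h1, add_smul]
      rw [map_sub, map_smul, map_smul, hN, normalVec, smul_add, smul_smul, smul_add, neg_smul,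
        h2]
      module)
    (τ₀ := τ₀) (fun τ => (hd τ).1) (fun τ => hww ▸ (hd τ).2) hx' rfl
  exact ⟨γ, h1, h2, fun τ => (h3 τ).trans (he τ).symm⟩

/-- On a connected manifold the locally constant subspace is constant. Completeness excludes `‖a‖ >
1`, which makes the heights globally invertible along `f`, and provides the radial curves. -/
theorem isGeneralizedCone [T2Space M] [SecondCountableTopology M] [ConnectedSpace M]
    {g : RiemMetric m M} (hf : IsIsometricImmersion g f) (hν : 1 ≤ ν) (hνm : ν + 2 ≤ m)
    (hnull : ∀ x : M, Module.finrank ℝ (relNullity (d := m) f x) = ν)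
    (humb : OrthUmbilical g (relNullity (d := m) f))
    (hcomp : LeavesComplete f (relNullity (d := m) f)) : IsGeneralizedCone (m := m) ν f := by
  obtain ⟨δ, hδ, humb⟩ := humb
  have hf' := hf.toIsHypImmersion
  obtain ⟨p⟩ := (inferInstance : Nonempty M)
  have hconst : ∀ x, conicSpace f δ x = conicSpace f δ p := fun x =>
    ((IsLocallyConstant.iff_eventually_eq _).2 (conicSpace_eventually_eq hf hνm hnull
      hδ.1 humb)).apply_eq_of_preconnectedSpace x p
  obtain ⟨a, κ, q, t₀, hκ, hq, hr, ha, hqt, hφ⟩ := exists_coneFrame_through (hf.mem p)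
    (notMem_conicSpace hf' δ p) ((finrank_conicSpace hf' δ p).trans (hnull p)) hν
  set K := conicSpace f δ p with hKd
  have hDK : ∀ x, ∀ X : TangentSpace (𝓡 m) x, X ∈ relNullity f x ↔
      ∃ b : ℝ, push f x X + b • f x ∈ K := fun x X => by
    rw [mem_relNullity_iff hf' δ x X, hconst]
  have hD := fun x X => (hDK x X).1
  have hL : ∀ x w, lor w (f x) = 0 → (∃ b : ℝ, w + b • f x ∈ K) →
      ∃ T ∈ relNullity (d := m) f x, push f x T = w := by
    rintro x w hw ⟨b, hb⟩
    rw [← hconst x, mem_conicSpace] at hb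
    obtain ⟨T, hT, hTw⟩ := hb
    refine ⟨T, hT, ?_⟩
    have h1 := congrArg (fun y => lor y (f x)) hTw
    simp only [lor_add_left, lor_smul_left, lor_push_self hf', hw, (hf.mem x).1] at h1
    have h2 : lor (push f x (δ x)) (push f x T) = b := by linarith
    rw [h2, add_comm] at hTw
    exact add_right_cancel hTw
  have hK : ∀ x, f x ∉ K := fun x => hconst x ▸ notMem_conicSpace hf' δ x
  have ha1 := norm_le_one_of_leavesComplete hf' hD hL hK hcomp hκ hr p
  obtain ⟨H, hH⟩ := exists_heightMap κ
  obtain ⟨T, hTh, hTs⟩ := exists_smooth_heights_inverse ha1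
  -- For `‖a‖ < 1` every vector is a height. For `‖a‖ = 1` the vector `κ a` is null and has positive
  -- product with `q`, hence with every point of `ℍⁿ`, which is the remaining condition.
  have hHf : ∀ x, ∃ s, heights a s = H (f x) := fun x => by
    refine exists_heights_eq ha1 fun ha2 => ?_
    rw [real_inner_comm, hH]
    refine lor_null_pos hq.1 (hf.mem x) ?_ ?_
    · rw [hκ a a, real_inner_self_eq_norm_sq, ha2]; norm_num
    · rw [hq.2 a, real_inner_self_eq_norm_sq, ha2]; norm_num
  have hC := isConeChart_of_heights hf' hκ isOpen_univ
    (fun x _ X => by rw [hDK x X, hr]) hnull hH (T := T)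
    (fun x _ => by obtain ⟨s, hs⟩ := hHf x; rw [← hs]; exact hTs s)
    (fun x _ => by obtain ⟨s, hs⟩ := hHf x; rw [← hs, hTh])
    (fun x _ => (coneFactor_pos ha1 _).ne')
  have hmn := hf'.dim_le p
  refine hC.exists_global hf' hκ ha (Nat.sub_add_cancel (by omega)) (by omega)
    fun x v τ₀ hx => ?_
  have hz := hC.mem x (mem_univ x)
  have hfx := hC.eq x (mem_univ x)
  set z := (coneFactor a (T (H (f x))))⁻¹ • (f x - hyS (‖T (H (f x))‖ ^ 2) • κ (T (H (f x))))
    with hzd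
  rw [hx] at hfx
  obtain ⟨γ, h1, h2, h3⟩ := exists_radial_curve hf' hD hL hK hcomp hκ hr hz hfx
    (coneFactor_pos ha1 _).ne'
  have h4 : ∀ τ, T (H (f (γ τ))) = τ • v := fun τ => by
    have : H (f (γ τ)) = heights a (τ • v) := by
      refine ext_inner_right ℝ fun s => ?_
      rw [hH, h3, lor_coneMap hκ hz]
    rw [this, hTh]
  refine ⟨γ, ⟨h1, fun τ => ?_, h4⟩, h2⟩
  have h5 := (coneFactor_pos ha1 (τ • v)).ne'
  simp only [h4]
  rw [h3, coneMap, add_sub_cancel_right, smul_smul, inv_mul_cancel₀ h5, one_smul]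

end Global

end HypCone

end

theorem mainTheorem2 {m n ν : ℕ} (hν : 1 ≤ ν) (hνm : ν + 2 ≤ m)
    {M : Type u} [TopologicalSpace M] [ChartedSpace (EuclideanSpace ℝ (Fin m)) M]
    [IsManifold (𝓡 m) ∞ M] [T2Space M] [SecondCountableTopology M]
    (g : HypCone.RiemMetric m M) (f : M → HypCone.Lor n)
    (hf : HypCone.IsIsometricImmersion g f)
    (hnull : ∀ x : M, Module.finrank ℝ (HypCone.relNullity (d := m) f x) = ν)
    (humb : HypCone.OrthUmbilical g (HypCone.relNullity (d := m) f)) :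
    HypCone.IsLocallyGeneralizedCone (m := m) ν f ∧
      (ConnectedSpace M → HypCone.LeavesComplete f (HypCone.relNullity (d := m) f) →
        HypCone.IsGeneralizedCone (m := m) ν f) := by
  refine ⟨HypCone.isLocallyGeneralizedCone hf hν hνm hnull humb, fun _ hcomp => ?_⟩
  exact HypCone.isGeneralizedCone hf hν hνm hnull humb hcomp
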